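/- Let $n\ge 1$. Let $L=L_{\infty/n}\subset\mathbb C[x_1,\dots,x_n]$ be the subring generated by the differences $x_i-x_j$, with its permutation action of $S_n$. Let $\mathfrak h=\{\sum v_iy_i:\sum v_i=0\}$ and $\mathfrak h^*=\{\sum v_ix_i:\sum v_i=0\}$ be the Cartan subalgebra of $\mathfrak{sl}_n$ and its dual, identified with each other through the standard form, and put $$H_{\infty/n}=\mathrm{Hom}_{S_n}(\Lambda^*\mathfrak h,L)=(\Lambda^*\mathfrak h^*\otimes L)^{S_n},$$ the stable limit as $m\to\infty$ of $H_{m/n}=\mathrm{Hom}_{S_n}(\Lambda^*\mathfrak h,L_{m/n})$, with the wedge product. Let $y_i$ act on $L$ by the limiting Dunkl operator $D_i=\sum_{j\ne i}\frac{s_{ij}-1}{x_i-x_j}$. For $N\ge1$ let $\partial_N$ and $\partial_{-N}$ be the contractions of forms with $\sum_i\tilde x_i^{\,N}x_i^*$, where $\tilde x_i=x_i-\frac1n\sum_jx_j$, and with $\sum_iD_i^{N}x_i^*$; that is, if $e_1,\dots,e_n$ are the projections to $\mathfrak h$ of the standard basis vectors, then $(\partial_N\varphi)(\cdot)=\sum_i\tilde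 x_i^{\,N}\varphi(e_i\wedge\cdot)$ and $(\partial_{-N}\varphi)(\cdot)=\sum_iD_i^N\varphi(e_i\wedge\cdot)$. Let $W=\prod_{i<j}(x_i-x_j)$, seen also as an element of $\mathrm{Hom}_{S_n}(\Lambda^{n-1}\mathfrak h,L)$ by a choice of a generator of $\Lambda^{n-1}\mathfrak h^*$, let $\nu=\partial_{-1}\partial_{-2}\cdots\partial_{-(n-1)}W\in\mathbb C$, and for $1\le i\le n-1$ put $$\xi_i=-\nu^{-1}\,\partial_{-1}\cdots\widehat{\partial_{-i}}\cdots\partial_{-(n-1)}W\in\mathrm{Hom}_{S_n}(\mathfrak h,L),\qquad u_i=\partial_1\xi_i\in L^{S_n}$$ (these do not depend on the choice). Let $\mathcal F_iL$ be the span of the elements $a=g(x)\,(h(y)\cdot W)$, where $g$ is a monomial in the $u_j$ and $h(y)$ is a product of elements of $\mathfrak h$, with $2\deg_u(g)-\deg(a)\le i$; here $\deg(a)=\deg_x(g)+\frac{n(n-1)}2-\deg(h)$. Let $\mathcal F_iH_{\infty/n}$ be the space of those elements of $H_{\infty/n}$ that take values in $\mathcal F_iL$, and $H_{\infty/n}^{\mathcal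 F}=\bigoplus_i\mathcal F_iH_{\infty/n}/\mathcal F_{i-1}H_{\infty/n}$. Proposition. The algebra $H_{\infty/n}$ is $\Lambda^*(\xi_1,\dots,\xi_{n-1})\otimes\mathbb C[u_1,\dots,u_{n-1}]$. The filtration $\mathcal F$ of $H_{\infty/n}$ is multiplicative, $\xi_k\in\mathcal F_{-k}$, $u_k\in\mathcal F_{1-k}$, and the ring $H_{\infty/n}^{\mathcal F}$ is likewise $\Lambda^*(\xi_1,\dots,\xi_{n-1})\otimes\mathbb C[u_1,\dots,u_{n-1}]$, generated by the classes of $\xi_k$ in degree $-k$ and of $u_k$ in degree $1-k$. For every $N\ge1$, $\partial_N$ maps $\mathcal F_iH_{\infty/n}$ to $\mathcal F_{i+N}H_{\infty/n}$ for all $i$, and the induced map $d_N:H^{\mathcal F}_{\infty/n}\to H^{\mathcal F}_{\infty/n}$ has the following properties. 1. $d_N(\varphi\psi)=(d_N\varphi)\psi+(-1)^{p}\varphi\,(d_N\psi)$ for $\varphi$ of exterior degree $p$ and all $\psi$. 2. $d_N(u_k)=0$ for $1\le k\le n-1$. 3. $d_N(\xi_k)=\sum_{j_1+\dots+j_N=k,\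 j_s\ge1}u_{j_1}u_{j_2}\cdots u_{j_N}$ for $1\le k\le n-1$. 4. Equivalently, with $\xi=\sum_{k=1}^{n-1}\xi_kt^k$ and $u=\sum_{k=1}^{n-1}u_kt^k$, and $d_N$ applied coefficientwise, $d_N\xi\equiv u^N \pmod{t^n}$. -/

import Mathlib

open scoped TensorProduct

namespace StableTorus

noncomputable section

/-! ## The Cartan subalgebra and the polynomial representation -/

/-- Vectors of `ℂⁿ` with coordinate sum zero.  This is the reflection representation of `Sₙ`: both
the Cartan subalgebra `𝔥` of `𝔰𝔩ₙ` (write `v` as `∑ vᵢ yᵢ`) and its dual `𝔥*` (write `v` as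
`∑ vᵢ xᵢ`), paired by `⟨v, w⟩ = ∑ vᵢ wᵢ`. -/
def cartan (n : ℕ) : Submodule ℂ (Fin n → ℂ) where
  carrier := {v | ∑ i, v i = 0}
  zero_mem' := by simp
  add_mem' := by
    intro a b ha hb
    simp only [Set.mem_ofPred_eq, Pi.add_apply, Finset.sum_add_distrib] at *
    rw [ha, hb, add_zero]
  smul_mem' := by
    intro c a ha
    simp only [Set.mem_ofPred_eq, Pi.smul_apply, smul_eq_mul, ← Finset.mul_sum] at *
    rw [ha, mul_zero]

/-- The `i`-th coordinate, a linear functional on `cartan n`. -/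
def coord (n : ℕ) (i : Fin n) : Module.Dual ℂ (cartan n) :=
  (LinearMap.proj i).comp (cartan n).subtype

/-- The orthogonal projection to `cartan n` of the `i`-th basis vector of `ℂⁿ`. -/
def basisProj (n : ℕ) (i : Fin n) : cartan n :=
  ⟨fun j => (if j = i then 1 else 0) - (n : ℂ)⁻¹, by
    have hn : (n : ℂ) ≠ 0 := by
      have := i.pos
      exact_mod_cast this.ne'
    change ∑ j, ((if j = i then (1 : ℂ) else 0) - (n : ℂ)⁻¹) = 0
    simp [Finset.sum_sub_distrib, hn]⟩

/-- The permutation action of `Sₙ` on `cartan n`. -/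
def permCartan (n : ℕ) (σ : Equiv.Perm (Fin n)) : cartan n →ₗ[ℂ] cartan n :=
  (LinearMap.funLeft ℂ ℂ (σ.symm : Fin n → Fin n)).restrict (by
    intro v hv
    change ∑ i, v (σ.symm i) = 0
    rw [Equiv.sum_comp σ.symm v]
    exact hv)

/-- The subring of `ℂ[x₁, …, xₙ]` generated by the differences `xᵢ - xⱼ`, a polynomial ring in
`n - 1` variables: the space of the polynomial representation `L_{∞/n}`. -/
def polyRep (n : ℕ) : Subalgebra ℂ (MvPolynomial (Fin n) ℂ) :=
  Algebra.adjoin ℂ {p | ∃ i j, p = MvPolynomial.X i - MvPolynomial.X j}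

/-- `xᵢ - xⱼ`. -/
def xDiff (n : ℕ) (i j : Fin n) : polyRep n :=
  ⟨MvPolynomial.X i - MvPolynomial.X j, Algebra.subset_adjoin ⟨i, j, rfl⟩⟩

/-- `x̃ᵢ = xᵢ - (1/n) ∑ⱼ xⱼ`, written as `(1/n) ∑ⱼ (xᵢ - xⱼ)`. -/
def xTilde (n : ℕ) (i : Fin n) : polyRep n :=
  (n : ℂ)⁻¹ • ∑ j, xDiff n i j

lemma rename_mem_polyRep (n : ℕ) (σ : Equiv.Perm (Fin n)) {p : MvPolynomial (Fin n) ℂ}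
    (hp : p ∈ polyRep n) : MvPolynomial.rename σ p ∈ polyRep n := by
  induction hp using Algebra.adjoin_induction with
  | mem x hx =>
    obtain ⟨i, j, rfl⟩ := hx
    exact Algebra.subset_adjoin ⟨σ i, σ j, by simp⟩
  | algebraMap r => simpa using (polyRep n).algebraMap_mem r
  | add x y _ _ hx hy => simpa using add_mem hx hy
  | mul x y _ _ hx hy => simpa using mul_mem hx hy

/-- The action of `Sₙ` on `polyRep n` by permutation of the variables. -/
def permPoly (n : ℕ) (σ : Equiv.Perm (Fin n)) : polyRep n →ₐ[ℂ] polyRep n :=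
  ((MvPolynomial.rename (R := ℂ) (σ : Fin n → Fin n)).comp (polyRep n).val).codRestrict
    (polyRep n) (fun p => rename_mem_polyRep n σ p.2)

/-! ## Dunkl operators at `c = ∞` -/

lemma X_sub_X_dvd (n : ℕ) (i j : Fin n) (p : MvPolynomial (Fin n) ℂ) :
    (MvPolynomial.X i - MvPolynomial.X j : MvPolynomial (Fin n) ℂ) ∣
      MvPolynomial.rename (Equiv.swap i j) p - p := by
  induction p using MvPolynomial.induction_on with
  | C a => simp
  | add p q hp hq =>
    rw [map_add, add_sub_add_comm]
    exact dvd_add hp hq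
  | mul_X p k hp =>
    have h : (MvPolynomial.X i - MvPolynomial.X j : MvPolynomial (Fin n) ℂ) ∣
        MvPolynomial.X (Equiv.swap i j k) - MvPolynomial.X k := by
      by_cases hi : k = i
      · subst hi
        rw [Equiv.swap_apply_left]
        exact ⟨-1, by ring⟩
      · by_cases hj : k = j
        · subst hj
          rw [Equiv.swap_apply_right]
        · rw [Equiv.swap_apply_of_ne_of_ne hi hj, sub_self]
          exact dvd_zero _
    rw [map_mul, MvPolynomial.rename_X]
    have e : MvPolynomial.rename (Equiv.swap i j) p * MvPolynomial.X (Equiv.swap i j k) -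
        p * MvPolynomial.X k =
        (MvPolynomial.rename (Equiv.swap i j) p - p) * MvPolynomial.X (Equiv.swap i j k) +
        p * (MvPolynomial.X (Equiv.swap i j k) - MvPolynomial.X k) := by ring
    rw [e]
    exact dvd_add (hp.mul_right _) (h.mul_left _)

lemma X_sub_X_ne_zero (n : ℕ) {i j : Fin n} (h : i ≠ j) :
    (MvPolynomial.X i - MvPolynomial.X j : MvPolynomial (Fin n) ℂ) ≠ 0 := by
  rw [sub_ne_zero]
  exact fun e => h (MvPolynomial.X_injective e)

/-- The quotient `(sᵢⱼ p - p) / (xᵢ - xⱼ)` (zero for `i = j`). -/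
def divDiffFun (n : ℕ) (i j : Fin n) (p : MvPolynomial (Fin n) ℂ) : MvPolynomial (Fin n) ℂ :=
  if i = j then 0 else Classical.choose (X_sub_X_dvd n i j p)

lemma divDiffFun_spec (n : ℕ) {i j : Fin n} (h : i ≠ j) (p : MvPolynomial (Fin n) ℂ) :
    (MvPolynomial.X i - MvPolynomial.X j) * divDiffFun n i j p =
      MvPolynomial.rename (Equiv.swap i j) p - p := by
  rw [divDiffFun, if_neg h]
  exact (Classical.choose_spec (X_sub_X_dvd n i j p)).symm

/-- The divided difference `p ↦ (sᵢⱼ p - p) / (xᵢ - xⱼ)` as a linear map. -/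
def divDiff (n : ℕ) (i j : Fin n) :
    MvPolynomial (Fin n) ℂ →ₗ[ℂ] MvPolynomial (Fin n) ℂ where
  toFun := divDiffFun n i j
  map_add' p q := by
    by_cases h : i = j
    · simp [divDiffFun, h]
    · apply mul_left_cancel₀ (X_sub_X_ne_zero n h)
      rw [mul_add, divDiffFun_spec n h, divDiffFun_spec n h, divDiffFun_spec n h, map_add]
      ring
  map_smul' c p := by
    by_cases h : i = j
    · simp [divDiffFun, h]
    · apply mul_left_cancel₀ (X_sub_X_ne_zero n h)
      rw [RingHom.id_apply, mul_smul_comm, divDiffFun_spec n h, divDiffFun_spec n h, map_smul,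
        smul_sub]

lemma divDiff_mul (n : ℕ) (i j : Fin n) (p q : MvPolynomial (Fin n) ℂ) :
    divDiff n i j (p * q) =
      divDiff n i j p * q + MvPolynomial.rename (Equiv.swap i j) p * divDiff n i j q := by
  change divDiffFun n i j (p * q) = divDiffFun n i j p * q + _ * divDiffFun n i j q
  by_cases h : i = j
  · simp [divDiffFun, h]
  · apply mul_left_cancel₀ (X_sub_X_ne_zero n h)
    rw [divDiffFun_spec n h, mul_add, ← mul_assoc, divDiffFun_spec n h, mul_left_comm,
      divDiffFun_spec n h, map_mul]
    ring

lemma divDiff_X (n : ℕ) (i j k : Fin n) :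
    divDiff n i j (MvPolynomial.X k) ∈ polyRep n := by
  change divDiffFun n i j _ ∈ _
  by_cases h : i = j
  · simp [divDiffFun, h]
  · have key : divDiffFun n i j (MvPolynomial.X k) =
        MvPolynomial.C (if k = i then -1 else if k = j then 1 else 0) := by
      apply mul_left_cancel₀ (X_sub_X_ne_zero n h)
      rw [divDiffFun_spec n h, MvPolynomial.rename_X]
      split_ifs with h1 h2
      · subst h1
        simp
      · subst h2
        simp
      · rw [Equiv.swap_apply_of_ne_of_ne h1 h2]
        simp
    rw [key]
    exact (polyRep n).algebraMap_mem _

lemma divDiff_mem_polyRep (n : ℕ) (i j : Fin n) {p : MvPolynomial (Fin n) ℂ}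
    (hp : p ∈ polyRep n) : divDiff n i j p ∈ polyRep n := by
  induction hp using Algebra.adjoin_induction with
  | mem x hx =>
    obtain ⟨a, b, rfl⟩ := hx
    rw [map_sub]
    exact sub_mem (divDiff_X n i j a) (divDiff_X n i j b)
  | algebraMap r =>
    have : divDiff n i j (algebraMap ℂ _ r) = 0 := by
      change divDiffFun n i j _ = 0
      by_cases h : i = j
      · simp [divDiffFun, h]
      · apply mul_left_cancel₀ (X_sub_X_ne_zero n h)
        rw [divDiffFun_spec n h]
        simp
    rw [this]
    exact zero_mem _
  | add x y _ _ hx hy =>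
    rw [map_add]
    exact add_mem hx hy
  | mul x y hx' hy' hx hy =>
    rw [divDiff_mul]
    exact add_mem (mul_mem hx hy') (mul_mem (rename_mem_polyRep n _ hx') hy)

/-- The operator `Dᵢ = ∑_{j ≠ i} (sᵢⱼ - 1) / (xᵢ - xⱼ)` on `polyRep n`: the limit for `c → ∞` of
the rescaled Dunkl operators `(1/c) ∂/∂xᵢ + ∑_{j ≠ i} (sᵢⱼ - 1) / (xᵢ - xⱼ)`. -/
def dunkl (n : ℕ) (i : Fin n) : Module.End ℂ (polyRep n) :=
  (∑ j, divDiff n i j).restrict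
    (p := Subalgebra.toSubmodule (polyRep n)) (q := Subalgebra.toSubmodule (polyRep n)) (by
    intro p hp
    rw [LinearMap.sum_apply]
    exact Submodule.sum_mem _ fun j _ => divDiff_mem_polyRep n i j hp)

/-- The action `∑ vᵢ Dᵢ` of `v = ∑ vᵢ yᵢ ∈ 𝔥` on `polyRep n`. -/
def dunklVec (n : ℕ) (v : cartan n) : Module.End ℂ (polyRep n) :=
  ∑ i, coord n i v • dunkl n i

/-! ## The space `H_{∞/n}` and the contractions -/

/-- `Λ* 𝔥* ⊗ L_{∞/n}`, polynomial differential forms on `𝔥`; equivalently `Hom(Λ* 𝔥, L_{∞/n})`.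
The algebra structure is the wedge product of forms. -/
abbrev Forms (n : ℕ) : Type := ExteriorAlgebra ℂ (cartan n) ⊗[ℂ] polyRep n

/-- The diagonal action of `Sₙ` on forms. -/
def permForms (n : ℕ) (σ : Equiv.Perm (Fin n)) : Forms n →ₐ[ℂ] Forms n :=
  Algebra.TensorProduct.map (ExteriorAlgebra.map (permCartan n σ)) (permPoly n σ)

/-- `H_{∞/n} = Hom_{Sₙ}(Λ* 𝔥, L_{∞/n})`, the algebra of `Sₙ`-invariant forms. -/
def stableH (n : ℕ) : Subalgebra ℂ (Forms n) :=
  ⨅ σ : Equiv.Perm (Fin n), AlgHom.equalizer (permForms n σ) (AlgHom.id ℂ (Forms n))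

/-- Contraction with `α : 𝔥 → End L_{∞/n}`: if `φ` is seen as an alternating form on `𝔥`, this is
`(∂_α φ)(v₂, …, v_k) = ∑ᵢ α(eᵢ) (φ(eᵢ, v₂, …, v_k))`, where `eᵢ` are the projections to `𝔥` of the
standard orthonormal basis (so `∑ᵢ eᵢ ⊗ eᵢ` is the invariant tensor of `𝔥 ⊗ 𝔥`). -/
def contraction (n : ℕ) (α : cartan n →ₗ[ℂ] Module.End ℂ (polyRep n)) :
    Module.End ℂ (Forms n) :=
  ∑ i, TensorProduct.map (CliffordAlgebra.contractLeft (coord n i)) (α (basisProj n i))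

/-- `α̃_N : 𝔥 → ℂ[𝔥*]`, `v ↦ ∑ vᵢ x̃ᵢ^N` (acting by multiplication): the composition of the
inclusion of `𝔥` in `ℂⁿ`, of `yᵢ ↦ xᵢ^N`, and of the projection `xᵢ ↦ x̃ᵢ`. -/
def alphaPos (n N : ℕ) : cartan n →ₗ[ℂ] Module.End ℂ (polyRep n) :=
  ∑ i, (coord n i).smulRight (LinearMap.mulLeft ℂ (xTilde n i ^ N))

/-- `α̃_{-N} : v ↦ ∑ vᵢ Dᵢ^N`, the Fourier transform of `α̃_N`. -/
def alphaNeg (n N : ℕ) : cartan n →ₗ[ℂ] Module.End ℂ (polyRep n) :=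
  ∑ i, (coord n i).smulRight (dunkl n i ^ N)

/-- `∂_N`, for `N > 0`, on forms. -/
def partialPos (n N : ℕ) : Module.End ℂ (Forms n) := contraction n (alphaPos n N)

/-- `∂_{-N}`, for `N > 0`, on forms. -/
def partialNeg (n N : ℕ) : Module.End ℂ (Forms n) := contraction n (alphaNeg n N)

/-! ## The generators -/

/-- The Vandermonde determinant `W = ∏_{i < j} (xᵢ - xⱼ)`. -/
def vandermonde (n : ℕ) : polyRep n := ∏ i, ∏ j ∈ Finset.Ioi i, xDiff n i j

/-- `W` as an element of `Hom_{Sₙ}(Λⁿ⁻¹ 𝔥, L_{∞/n})`: the top form `x̃₂ ∧ ⋯ ∧ x̃ₙ ⊗ W`.  (The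
choice of the generator of the line `Λⁿ⁻¹ 𝔥*` plays no role: `xi` does not depend on it.) -/
def vandermondeForm (n : ℕ) : Forms n :=
  ((List.finRange n).tail.map fun i => ExteriorAlgebra.ι ℂ (basisProj n i)).prod ⊗ₜ[ℂ]
    vandermonde n

/-- The coefficient in `L_{∞/n}` of the component of exterior degree zero of a form. -/
def functionPart (n : ℕ) : Forms n →ₗ[ℂ] polyRep n :=
  (TensorProduct.lid ℂ (polyRep n)).toLinearMap ∘ₗ
    TensorProduct.map (ExteriorAlgebra.algebraMapInv (R := ℂ) (M := cartan n)).toLinearMap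
      LinearMap.id

/-- The constant `ν = ∂_{-1} ∂_{-2} ⋯ ∂_{-(n-1)} W`. -/
def nu (n : ℕ) : ℂ :=
  MvPolynomial.constantCoeff
    (functionPart n (((List.range' 1 (n - 1)).map (partialNeg n)).prod (vandermondeForm n)) :
      MvPolynomial (Fin n) ℂ)

/-- `ξ_i = -ν⁻¹ ∂_{-1} ⋯ ∂̂_{-i} ⋯ ∂_{-(n-1)} W` for `1 ≤ i ≤ n - 1` (the factor `∂_{-i}` is left
out), a one-form. -/
def xi (n i : ℕ) : Forms n :=
  (-(nu n)⁻¹) • (((List.range' 1 (n - 1)).erase i).map (partialNeg n)).prod (vandermondeForm n)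

/-- `u_i = ∂_1 ξ_i` for `1 ≤ i ≤ n - 1`, a function. -/
def u (n i : ℕ) : polyRep n := functionPart n (partialPos n 1 (xi n i))

/-! ## The filtration -/

/-- The increasing filtration `F_i L_{∞/n}`: it is spanned by the elements `g(x) · (h(y) · W)`,
where `g = ∏ u_{j}^{a_j}` is a monomial in the `u_j`, where `h(y)` is a product of `k` elements of
`𝔥`, acting by Dunkl operators, and where the filtration degree
`2 deg_u(g) - deg(g(x) h(y) W) = 2 ∑ a_j - (∑ (j + 1) a_j + n (n - 1) / 2 - k)` is at most `i`. -/
def filtL (n : ℕ) (i : ℤ) : Submodule ℂ (polyRep n) :=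
  Submodule.span ℂ {p | ∃ (a : Fin (n - 1) → ℕ) (w : List (cartan n)),
    2 * (∑ j, (a j : ℤ)) -
      ((∑ j : Fin (n - 1), (((j : ℕ) : ℤ) + 2) * (a j : ℤ)) + (n.choose 2 : ℤ) - (w.length : ℤ)) ≤ i ∧
    p = (∏ j : Fin (n - 1), u n ((j : ℕ) + 1) ^ a j) *
      (w.map (dunklVec n)).prod (vandermonde n)}

/-- The induced filtration on `H_{∞/n}`: invariant forms with values in `F_i L_{∞/n}`. -/
def filtH (n : ℕ) (i : ℤ) : Submodule ℂ (Forms n) :=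
  Subalgebra.toSubmodule (stableH n) ⊓
    LinearMap.range (LinearMap.lTensor (ExteriorAlgebra ℂ (cartan n)) (filtL n i).subtype)

/-! ## Associated graded spaces -/

section Graded

variable {A : Type} [Ring A] [Algebra ℂ A]

/-- `F_i / F_{i-1}`. -/
abbrev GrPiece (F : ℤ → Submodule ℂ A) (i : ℤ) : Type :=
  ↥(F i) ⧸ (F (i - 1)).comap (F i).subtype

/-- The associated graded space `⨁_i F_i / F_{i-1}`. -/
def Gr (F : ℤ → Submodule ℂ A) : Type := DirectSum ℤ (GrPiece F)

instance (F : ℤ → Submodule ℂ A) : AddCommMonoid (Gr F) :=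
  inferInstanceAs (AddCommMonoid (DirectSum ℤ (GrPiece F)))

instance (F : ℤ → Submodule ℂ A) : Module ℂ (Gr F) :=
  inferInstanceAs (Module ℂ (DirectSum ℤ (GrPiece F)))

instance (F : ℤ → Submodule ℂ A) : AddCommGroup (Gr F) := Module.addCommMonoidToAddCommGroup ℂ

/-- The class in `F_i / F_{i-1}` of an element of `F_i`. -/
def cls (F : ℤ → Submodule ℂ A) (i : ℤ) : ↥(F i) →ₗ[ℂ] Gr F :=
  (DirectSum.lof ℂ ℤ (GrPiece F) i).comp (Submodule.mkQ ((F (i - 1)).comap (F i).subtype))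

lemma cls_eq_zero (F : ℤ → Submodule ℂ A) (i : ℤ) (x : ↥(F i)) (hx : (x : A) ∈ F (i - 1)) :
    cls F i x = 0 := by
  have : Submodule.mkQ ((F (i - 1)).comap (F i).subtype) x = 0 := by
    rw [Submodule.mkQ_apply, Submodule.Quotient.mk_eq_zero]
    exact hx
  change DirectSum.lof ℂ ℤ (GrPiece F) i (Submodule.mkQ ((F (i - 1)).comap (F i).subtype) x) = 0
  rw [this, map_zero]

/-- The linear map on `Gr F` which is given by `T i` on the classes of elements of `F_i`. -/
def grLift (F : ℤ → Submodule ℂ A) {B : Type} [AddCommGroup B] [Module ℂ B]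
    (T : ∀ i, ↥(F i) →ₗ[ℂ] B) (hT : ∀ i (x : ↥(F i)), (x : A) ∈ F (i - 1) → T i x = 0) :
    Gr F →ₗ[ℂ] B :=
  DirectSum.toModule ℂ ℤ B fun i =>
    Submodule.liftQ ((F (i - 1)).comap (F i).subtype) (T i)
      (fun x hx => LinearMap.mem_ker.2 (hT i x hx))

lemma grLift_cls (F : ℤ → Submodule ℂ A) {B : Type} [AddCommGroup B] [Module ℂ B]
    (T : ∀ i, ↥(F i) →ₗ[ℂ] B) (hT : ∀ i (x : ↥(F i)), (x : A) ∈ F (i - 1) → T i x = 0)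
    (i : ℤ) (x : ↥(F i)) : grLift F T hT (cls F i x) = T i x := by
  change DirectSum.toModule ℂ ℤ B _ (DirectSum.lof ℂ ℤ (GrPiece F) i _) = _
  rw [DirectSum.toModule_lof, Submodule.mkQ_apply, Submodule.liftQ_apply]

lemma gr_ext (F : ℤ → Submodule ℂ A) {B : Type} [AddCommGroup B] [Module ℂ B]
    {S T : Gr F →ₗ[ℂ] B} (h : ∀ i (x : ↥(F i)), S (cls F i x) = T (cls F i x)) : S = T := by
  refine DirectSum.linearMap_ext (M := GrPiece F) (ψ := S) (ψ' := T) ℂ fun i => ?_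
  refine LinearMap.ext fun z => ?_
  obtain ⟨x, rfl⟩ := Submodule.mkQ_surjective _ z
  exact h i x

/-- The map on associated graded spaces induced by a map that raises the filtration by `N`: it
sends the class of `x ∈ F_i` to the class of `T x ∈ F_{i+N}`. -/
def grMap (F : ℤ → Submodule ℂ A) (T : Module.End ℂ A) (N : ℤ)
    (hT : ∀ i, ∀ x ∈ F i, T x ∈ F (i + N)) : Module.End ℂ (Gr F) :=
  grLift F (fun i => (cls F (i + N)).comp (T.restrict (hT i))) (by
    intro i x hx
    apply cls_eq_zero
    have h := hT (i - 1) x hx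
    rwa [sub_add_eq_add_sub] at h)

lemma grMap_cls (F : ℤ → Submodule ℂ A) (T : Module.End ℂ A) (N : ℤ)
    (hT : ∀ i, ∀ x ∈ F i, T x ∈ F (i + N)) (i : ℤ) (x : ↥(F i)) :
    grMap F T N hT (cls F i x) = cls F (i + N) ⟨T x, hT i x x.2⟩ :=
  grLift_cls F _ _ i x

/-- The product on the associated graded space of a multiplicative filtration: the product of the
classes of `x ∈ F_i` and `y ∈ F_j` is the class of `x * y ∈ F_{i+j}` (see `grMul_cls`). -/
def grMul (F : ℤ → Submodule ℂ A)
    (hF : ∀ i j, ∀ x ∈ F i, ∀ y ∈ F j, x * y ∈ F (i + j)) : Gr F →ₗ[ℂ] Gr F →ₗ[ℂ] Gr F :=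
  grLift F
    (fun i =>
      { toFun := fun x => grMap F (LinearMap.mulLeft ℂ (x : A)) i
          (fun j y hy => by rw [add_comm]; exact hF i j x x.2 y hy)
        map_add' := fun x x' => gr_ext F fun j y => by
          rw [LinearMap.add_apply, grMap_cls, grMap_cls, grMap_cls, ← map_add]
          exact congrArg _ (Subtype.ext (add_mul _ _ _))
        map_smul' := fun c x => gr_ext F fun j y => by
          rw [RingHom.id_apply, LinearMap.smul_apply, grMap_cls, grMap_cls, ← map_smul]
          exact congrArg _ (Subtype.ext (smul_mul_assoc _ _ _)) })
    (fun i x hx => gr_ext F fun j y => by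
      change grMap F _ i _ (cls F j y) = 0
      rw [grMap_cls]
      apply cls_eq_zero
      have h := hF (i - 1) j x hx y y.2
      rwa [sub_add_eq_add_sub, add_comm i j] at h)

lemma grMul_cls (F : ℤ → Submodule ℂ A)
    (hF : ∀ i j, ∀ x ∈ F i, ∀ y ∈ F j, x * y ∈ F (i + j)) (i j : ℤ) (x : ↥(F i)) (y : ↥(F j)) :
    grMul F hF (cls F i x) (cls F j y) = cls F (i + j) ⟨x * y, hF i j x x.2 y y.2⟩ := by
  have h : grMul F hF (cls F i x) (cls F j y) =
      cls F (j + i) ⟨x * y, by rw [add_comm]; exact hF i j x x.2 y y.2⟩ := by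
    rw [grMul, grLift_cls]
    exact grMap_cls F _ i _ j y
  rw [h]
  have e : ∀ (k l : ℤ) (_ : k = l) (z : A) (hk : z ∈ F k) (hl : z ∈ F l),
      cls F k ⟨z, hk⟩ = cls F l ⟨z, hl⟩ := by
    rintro k _ rfl z _ _
    rfl
  exact e _ _ (add_comm j i) _ _ _

end Graded

/-- Forms of exterior degree `p`. -/
def formsOfDegree (n p : ℕ) : Submodule ℂ (Forms n) :=
  LinearMap.range (TensorProduct.map (⋀[ℂ]^p (cartan n)).subtype
    (LinearMap.id : polyRep n →ₗ[ℂ] polyRep n))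

/-! ## The model algebra -/

/-- `Λ*(ξ_1, …, ξ_{n-1}) ⊗ ℂ[u_1, …, u_{n-1}]`. -/
abbrev Model (n : ℕ) : Type :=
  ExteriorAlgebra ℂ (Fin (n - 1) → ℂ) ⊗[ℂ] MvPolynomial (Fin (n - 1)) ℂ

/-- The generator `ξ_{k+1}` of the model. -/
def genXi (n : ℕ) (k : Fin (n - 1)) : Model n :=
  ExteriorAlgebra.ι ℂ (Pi.single k (1 : ℂ)) ⊗ₜ[ℂ] 1

/-- The inclusion of the polynomial ring `ℂ[u_1, …, u_{n-1}]`, whose variable `X k` is `u_{k+1}`,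
into the model. -/
def inclU (n : ℕ) : MvPolynomial (Fin (n - 1)) ℂ →ₐ[ℂ] Model n :=
  Algebra.TensorProduct.includeRight

end

end StableTorus

namespace StableTorus

/-! ## The polynomial representation -/

/-! Invariant forms are controlled by an explicit coframe. Put P(t) = ∏ (t - x̃ᵢ) and let Pᵢ be P
without its i-th factor. The operator Dᵢ acts on the coefficients of Pᵢ as minus the derivative in t
(`dunkl_coeff`), and power sums of positive degree in the Dunkl operators vanish on L
(`sum_dunkl_pow`). So ∂_{-N} sends ∑ᵢ Pᵢ eᵢ to (-1)^N P^{(N+1)}. Inverting a triangular matrix of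
coefficients gives invariant one-forms ωₖ (`dualForm`) that are dual to the contractions δₖ = (-1)^k
∂_{-k}, and ∑ᵢ Pᵢ eᵢ = ∑ₖ P^{(k+1)} ωₖ.

Although Dunkl operators are not derivations of L, every ∂_{-N} is an odd derivation of H
(`partialNeg_mul`). For N = 1 the unwanted terms cancel in pairs. The operator Q = ∑ x̃ᵢ Dᵢ² is an
even derivation on invariants, and [Q, ∂_{-N}] = n ∂_{-N-1} carries the Leibniz rule from N to N +
1.

Once the discriminant is inverted, the ωₖ generate all forms over L. Averaging then shows that on H
each contraction with a functional is a combination of the δₖ (`ctr_eq_sum`). Hence an invariant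
form killed by all δₖ is an invariant function, and y = ωₖ δₖ y + δₖ(ωₖ y) peels off generators one
at a time: H is generated by the ωₖ over the invariant functions. The same formula, applied to the
top form W, shows that products of δ's send W to scalar multiples of products of ω's; in particular
ξₖ = ωₖ (`xi_eq_dualForm`).

Contracting the coframe identity with ∂_N gives ∑ᵢ x̃ᵢ^N Pᵢ = ∑ₖ c_{N,k} P^{(k+1)} over 0 ≤ k < n,
where c_{N,k} = ∂_N ξₖ for k ≥ 1 and c_{N,0} is the mean of the x̃ᵢ^N. For N = 1 this says t P' = n
P + ∑ u_j P^{(j+1)}. Solving it for the coefficients of P from the top down shows that the u_j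
generate the invariants; solving it with prescribed values of the u_j shows that they are
algebraically independent. Multiplication by t gives c_{N+1,k} = (n-k-1) c_{N,k+1} + ∑_{i+j=k} u_i
c_{N,j}. If u_k has weight k - 1 and ξ_k weight k, then c_{N,k} is the coefficient of t^k in u^N up
to terms of higher weight.

Finally, F is the filtration by minus the weight (`modelHom_mem_filtH_iff`). A product of ξ's is W
contracted with the complementary δ's, which bounds its filtration degree. Conversely, the δ's
reduce an element of H to invariant functions, where averaging kills fewer than n(n-1)/2 Dunkl
operators applied to W, while at least that many leave a constant. So the associated graded ring is
the model algebra, and d_N retains exactly the lowest weight part of ∂_N. -/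

lemma sum_xTilde (n : ℕ) : ∑ i, xTilde n i = 0 := by
  simp only [xTilde, ← Finset.smul_sum]
  have h : ∑ i, ∑ j, xDiff n i j = -∑ i, ∑ j, xDiff n i j := by
    conv_lhs => rw [Finset.sum_comm]
    simp only [← Finset.sum_neg_distrib]
    refine Finset.sum_congr rfl fun i _ => Finset.sum_congr rfl fun j _ => Subtype.ext ?_
    simp [xDiff]
  rw [self_eq_neg.1 h, smul_zero]

lemma xDiff_eq (n : ℕ) (i j : Fin n) : xDiff n i j = xTilde n i - xTilde n j := by
  have hn : (n : ℂ) ≠ 0 := by exact_mod_cast i.pos.ne'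
  simp only [xTilde, ← smul_sub, ← Finset.sum_sub_distrib]
  have : ∀ k, xDiff n i k - xDiff n j k = xDiff n i j := fun k => by
    refine Subtype.ext ?_
    change (MvPolynomial.X i - MvPolynomial.X k) - (MvPolynomial.X j - MvPolynomial.X k) =
      (MvPolynomial.X i - MvPolynomial.X j : MvPolynomial (Fin n) ℂ)
    ring
  simp only [this, Finset.sum_const, Finset.card_univ, Fintype.card_fin]
  rw [← Nat.cast_smul_eq_nsmul ℂ, smul_smul, inv_mul_cancel₀ hn, one_smul]

lemma xDiff_neg (n : ℕ) (i j : Fin n) : xDiff n j i = -xDiff n i j := by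
  rw [xDiff_eq, xDiff_eq, neg_sub]

lemma xDiff_ne_zero (n : ℕ) {i j : Fin n} (h : i ≠ j) : xDiff n i j ≠ 0 := by
  intro e
  have e' : (xDiff n i j : MvPolynomial (Fin n) ℂ) = 0 := by rw [e]; rfl
  exact X_sub_X_ne_zero n h e'

/-- The differences xᵢ - xⱼ equal x̃ᵢ - x̃ⱼ, so the x̃ᵢ generate. They are preferable as generators
because their commutators with Dunkl operators are single sums of transpositions. -/
lemma polyRep_induction (n : ℕ) {C : polyRep n → Prop} (hC : ∀ r : ℂ, C (algebraMap ℂ _ r))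
    (hx : ∀ i, C (xTilde n i)) (hadd : ∀ p q, C p → C q → C (p + q))
    (hmul : ∀ p q, C p → C q → C (p * q)) (p : polyRep n) : C p := by
  obtain ⟨p, hp⟩ := p
  have hneg : ∀ p, C p → C (-p) := fun p h => by
    have := hmul _ _ (hC (-1)) h
    have e : algebraMap ℂ (polyRep n) (-1) * p = -p := by
      rw [map_neg, map_one]
      ring
    rwa [e] at this
  induction hp using Algebra.adjoin_induction with
  | mem x hx' =>
    obtain ⟨i, j, rfl⟩ := hx'
    have : C (xDiff n i j) := by
      rw [xDiff_eq, sub_eq_add_neg]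
      exact hadd _ _ (hx i) (hneg _ (hx j))
    exact this
  | algebraMap r => exact hC r
  | add x y hx' hy' h1 h2 => exact hadd ⟨x, hx'⟩ ⟨y, hy'⟩ h1 h2
  | mul x y hx' hy' h1 h2 => exact hmul ⟨x, hx'⟩ ⟨y, hy'⟩ h1 h2

lemma permPoly_coe (n : ℕ) (σ : Equiv.Perm (Fin n)) (p : polyRep n) :
    (permPoly n σ p : MvPolynomial (Fin n) ℂ) =
      MvPolynomial.rename σ (p : MvPolynomial (Fin n) ℂ) := rfl

lemma permPoly_xDiff (n : ℕ) (σ : Equiv.Perm (Fin n)) (i j : Fin n) :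
    permPoly n σ (xDiff n i j) = xDiff n (σ i) (σ j) := by
  apply Subtype.ext
  rw [permPoly_coe]
  simp [xDiff]

lemma permPoly_xTilde (n : ℕ) (σ : Equiv.Perm (Fin n)) (i : Fin n) :
    permPoly n σ (xTilde n i) = xTilde n (σ i) := by
  simp only [xTilde, map_smul, map_sum, permPoly_xDiff]
  rw [Equiv.sum_comp σ (fun j => xDiff n (σ i) j)]

lemma permPoly_permPoly (n : ℕ) (σ τ : Equiv.Perm (Fin n)) (p : polyRep n) :
    permPoly n σ (permPoly n τ p) = permPoly n (σ * τ) p :=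
  Subtype.ext (by
    change MvPolynomial.rename _ (MvPolynomial.rename _ _) = MvPolynomial.rename _ _
    rw [MvPolynomial.rename_rename]; rfl)

lemma permPoly_one (n : ℕ) (p : polyRep n) : permPoly n 1 p = p :=
  Subtype.ext (MvPolynomial.rename_id_apply (p : MvPolynomial (Fin n) ℂ))

/-! ### Divided differences and Dunkl operators on the polynomial representation -/

noncomputable section

/-- The divided difference `(sᵢⱼ - 1) / (xᵢ - xⱼ)` on `polyRep n`. -/
def dd (n : ℕ) (i j : Fin n) : Module.End ℂ (polyRep n) :=
  (divDiff n i j).restrict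
    (p := Subalgebra.toSubmodule (polyRep n)) (q := Subalgebra.toSubmodule (polyRep n))
    (fun _ hp => divDiff_mem_polyRep n i j hp)

end

lemma dd_self (n : ℕ) (i : Fin n) (p : polyRep n) : dd n i i p = 0 :=
  Subtype.ext (by
    change divDiffFun n i i _ = 0
    simp [divDiffFun])

lemma dd_spec (n : ℕ) (i j : Fin n) (p : polyRep n) :
    xDiff n i j * dd n i j p = permPoly n (Equiv.swap i j) p - p := by
  by_cases h : i = j
  · subst h
    rw [dd_self, mul_zero, Equiv.swap_self]
    exact (sub_eq_zero.2 (permPoly_one n p)).symm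
  · exact Subtype.ext (divDiffFun_spec n h p)

lemma dd_eq_of_mul (n : ℕ) {i j : Fin n} (h : i ≠ j) {p q : polyRep n}
    (e : xDiff n i j * q = permPoly n (Equiv.swap i j) p - p) : dd n i j p = q := by
  apply mul_left_cancel₀ (xDiff_ne_zero n h)
  rw [dd_spec, e]

lemma dd_mul (n : ℕ) (i j : Fin n) (p q : polyRep n) :
    dd n i j (p * q) = dd n i j p * q + permPoly n (Equiv.swap i j) p * dd n i j q :=
  Subtype.ext (divDiff_mul n i j p q)

lemma dd_mul' (n : ℕ) (i j : Fin n) (p q : polyRep n) :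
    dd n i j (p * q) = p * dd n i j q + dd n i j p * permPoly n (Equiv.swap i j) q := by
  rw [mul_comm p q, dd_mul]
  ring

lemma dd_swap (n : ℕ) (i j : Fin n) (p : polyRep n) : dd n j i p = -dd n i j p := by
  by_cases h : i = j
  · subst h
    simp [dd_self]
  · apply dd_eq_of_mul n (Ne.symm h)
    rw [xDiff_neg n i j, Equiv.swap_comm, ← dd_spec]
    ring

lemma permPoly_dd (n : ℕ) (σ : Equiv.Perm (Fin n)) (i j : Fin n) (p : polyRep n) :
    permPoly n σ (dd n i j p) = dd n (σ i) (σ j) (permPoly n σ p) := by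
  by_cases h : i = j
  · subst h
    simp [dd_self]
  · symm
    apply dd_eq_of_mul n (σ.injective.ne h)
    rw [← permPoly_xDiff, ← map_mul, dd_spec, map_sub, permPoly_permPoly, permPoly_permPoly,
      Equiv.swap_apply_apply]
    congr 2
    group

lemma dunkl_apply (n : ℕ) (i : Fin n) (p : polyRep n) : dunkl n i p = ∑ j, dd n i j p :=
  Subtype.ext (by
    rw [AddSubmonoidClass.coe_finsetSum]
    change (∑ j, divDiff n i j) (p : MvPolynomial (Fin n) ℂ) = _
    rw [LinearMap.sum_apply]
    rfl)

lemma permPoly_dunkl (n : ℕ) (σ : Equiv.Perm (Fin n)) (i : Fin n) (p : polyRep n) :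
    permPoly n σ (dunkl n i p) = dunkl n (σ i) (permPoly n σ p) := by
  simp only [dunkl_apply, map_sum, permPoly_dd]
  exact Equiv.sum_comp σ (fun j => dd n (σ i) j (permPoly n σ p))

lemma dd_of_invariant (n : ℕ) (i j : Fin n) {p : polyRep n}
    (hp : permPoly n (Equiv.swap i j) p = p) : dd n i j p = 0 := by
  by_cases h : i = j
  · subst h
    exact dd_self n i p
  · apply dd_eq_of_mul n h
    rw [hp, sub_self, mul_zero]

lemma dd_one (n : ℕ) (i j : Fin n) : dd n i j 1 = 0 := dd_of_invariant n i j (map_one _)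

lemma dunkl_one (n : ℕ) (i : Fin n) : dunkl n i 1 = 0 := by simp [dunkl_apply, dd_one]

/-- Divided differences kill invariants, so the twisted Leibniz rule makes them linear over
invariants. -/
lemma dunkl_mul_of_invariant (n : ℕ) (i : Fin n) {r : polyRep n}
    (hr : ∀ σ, permPoly n σ r = r) (p : polyRep n) : dunkl n i (r * p) = r * dunkl n i p := by
  simp only [dunkl_apply, Finset.mul_sum]
  refine Finset.sum_congr rfl fun j _ => ?_
  rw [dd_mul', dd_of_invariant n i j (hr _), zero_mul, add_zero]

lemma dd_xTilde_left (n : ℕ) {i j : Fin n} (h : i ≠ j) : dd n i j (xTilde n i) = -1 := by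
  apply dd_eq_of_mul n h
  rw [permPoly_xTilde, Equiv.swap_apply_left, xDiff_eq]
  ring

lemma dd_xTilde_right (n : ℕ) {i j : Fin n} (h : i ≠ j) : dd n i j (xTilde n j) = 1 := by
  apply dd_eq_of_mul n h
  rw [permPoly_xTilde, Equiv.swap_apply_right, xDiff_eq]
  ring

lemma dd_xTilde_of_ne (n : ℕ) {i j k : Fin n} (h1 : k ≠ i) (h2 : k ≠ j) :
    dd n i j (xTilde n k) = 0 := by
  apply dd_of_invariant
  rw [permPoly_xTilde, Equiv.swap_apply_of_ne_of_ne h1 h2]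

noncomputable section

/-- The transposition `sᵢⱼ` acting on `polyRep n`, as a linear operator. -/
def swapEnd (n : ℕ) (i j : Fin n) : Module.End ℂ (polyRep n) :=
  (permPoly n (Equiv.swap i j)).toLinearMap

/-- Multiplication by `x̃ᵢ`. -/
def mulX (n : ℕ) (i : Fin n) : Module.End ℂ (polyRep n) := LinearMap.mulLeft ℂ (xTilde n i)

end

/-- Among the transpositions that occur in Dᵢ only the one with k moves x̃ₖ. There is no derivative
term in the limiting Dunkl operator, so the commutator is a bare transposition. -/
lemma dunkl_mulX_of_ne (n : ℕ) {i k : Fin n} (h : i ≠ k) :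
    dunkl n i * mulX n k - mulX n k * dunkl n i = swapEnd n i k := by
  refine LinearMap.ext fun p => ?_
  change dunkl n i (xTilde n k * p) - xTilde n k * dunkl n i p = permPoly n (Equiv.swap i k) p
  simp only [dunkl_apply, Finset.mul_sum, ← Finset.sum_sub_distrib]
  rw [Finset.sum_eq_single k]
  · rw [dd_mul', dd_xTilde_right n h]
    ring
  · intro j _ hj
    rw [dd_mul', dd_xTilde_of_ne n (Ne.symm h) (Ne.symm hj)]
    ring
  · simp

lemma dunkl_mulX_self (n : ℕ) (i : Fin n) :
    dunkl n i * mulX n i - mulX n i * dunkl n i = -∑ j ∈ Finset.univ.erase i, swapEnd n i j := by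
  refine LinearMap.ext fun p => ?_
  rw [LinearMap.neg_apply, LinearMap.sum_apply]
  change dunkl n i (xTilde n i * p) - xTilde n i * dunkl n i p = _
  simp only [dunkl_apply, Finset.mul_sum, ← Finset.sum_sub_distrib, ← Finset.sum_neg_distrib]
  rw [← Finset.sum_erase (s := Finset.univ) (a := i)]
  · refine Finset.sum_congr rfl fun j hj => ?_
    rw [dd_mul', dd_xTilde_left n (Finset.ne_of_mem_erase hj).symm]
    change _ = -permPoly n _ p
    ring
  · simp [dd_self]

lemma swapEnd_comm (n : ℕ) (i j : Fin n) : swapEnd n i j = swapEnd n j i := by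
  rw [swapEnd, Equiv.swap_comm, swapEnd]

lemma swapEnd_mul_dunkl (n : ℕ) (i j k : Fin n) :
    swapEnd n i j * dunkl n k = dunkl n (Equiv.swap i j k) * swapEnd n i j :=
  LinearMap.ext fun p => permPoly_dunkl n _ k p

/-- An operator that commutes with all `x̃ₖ` and kills `1` is zero. -/
lemma end_eq_zero (n : ℕ) (T : Module.End ℂ (polyRep n))
    (hT : ∀ k, T * mulX n k = mulX n k * T) (h1 : T 1 = 0) : T = 0 := by
  have key : ∀ p q : polyRep n, T (p * q) = p * T q := by
    intro p
    induction p using polyRep_induction n with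
    | hC r => intro q; simp [← Algebra.smul_def]
    | hx i => intro q; exact LinearMap.congr_fun (hT i) q
    | hadd p q hp hq => intro r; rw [add_mul, map_add, hp, hq, add_mul]
    | hmul p q hp hq => intro r; rw [mul_assoc, hp, hq, mul_assoc]
  refine LinearMap.ext fun p => ?_
  rw [← mul_one p, key, h1, mul_zero, LinearMap.zero_apply]

/-! ### Commutators of Dunkl operators -/

lemma pow_comm_sub {A : Type*} [Ring A] (d x : A) (N : ℕ) :
    d ^ N * x - x * d ^ N =
      ∑ a ∈ Finset.range N, d ^ a * (d * x - x * d) * d ^ (N - 1 - a) := by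
  induction N with
  | zero => simp
  | succ N ih =>
    rw [Finset.sum_range_succ]
    have h : ∀ a ∈ Finset.range N, d ^ a * (d * x - x * d) * d ^ (N + 1 - 1 - a) =
        d ^ a * (d * x - x * d) * d ^ (N - 1 - a) * d := by
      intro a ha
      rw [mul_assoc _ _ d, ← pow_succ]
      congr 2
      have := Finset.mem_range.1 ha
      omega
    rw [Finset.sum_congr rfl h, ← Finset.sum_mul, ← ih, Nat.add_sub_cancel, Nat.sub_self, pow_zero,
      pow_succ]
    noncomm_ring

section Relations

variable {ι M : Type*} [Fintype ι] [DecidableEq ι] [AddCommGroup M] [Module ℂ M]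

/-- Operators `d i`, `x i` and `s i j` with the commutation relations of the Dunkl operators at
`c = ∞`, the multiplications by coordinates and the transpositions. -/
structure DunklRelations (d x : ι → Module.End ℂ M) (s : ι → ι → Module.End ℂ M) : Prop where
  of_ne : ∀ i k, i ≠ k → d i * x k - x k * d i = s i k
  self : ∀ i, d i * x i - x i * d i = -∑ j ∈ Finset.univ.erase i, s i j
  comm : ∀ i j, s i j = s j i
  mul_d : ∀ i j k, s i j * d k = d (Equiv.swap i j k) * s i j

variable {d x : ι → Module.End ℂ M} {s : ι → ι → Module.End ℂ M}

/-- By the Jacobi identity it is enough to commute the d's with the transpositions that arise as [d,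
x]. A transposition disjoint from the index of d commutes with it, and sᵢⱼ commutes with dᵢ + dⱼ. -/
lemma DunklRelations.commutator_commute (h : DunklRelations d x s) {i j : ι} (hij : i ≠ j)
    (k : ι) : (d i * d j - d j * d i) * x k = x k * (d i * d j - d j * d i) := by
  have jac : ∀ a b : Module.End ℂ M, ∀ x,
      (a * b - b * a) * x - x * (a * b - b * a) =
        (a * (b * x - x * b) - (b * x - x * b) * a) -
          (b * (a * x - x * a) - (a * x - x * a) * b) := by
    intro a b x; noncomm_ring
  rw [← sub_eq_zero, jac]
  -- The case where x carries one of the two indices. In the sum over l only l = j survives, and it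
  -- cancels the first commutator.
  have aux : ∀ i j : ι, i ≠ j →
      d i * s j i - s j i * d i -
        (d j * -(∑ l ∈ Finset.univ.erase i, s i l) -
          -(∑ l ∈ Finset.univ.erase i, s i l) * d j) = 0 := by
    intro i j hij
    have hj : j ∈ Finset.univ.erase i := Finset.mem_erase.2 ⟨Ne.symm hij, Finset.mem_univ _⟩
    have h0 : ∀ l ∈ (Finset.univ.erase i).erase j, d j * s i l - s i l * d j = 0 := by
      intro l hl
      rw [h.mul_d, Equiv.swap_apply_of_ne_of_ne (Ne.symm hij)
        (Finset.ne_of_mem_erase hl).symm, sub_self]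
    have h1 := Finset.sum_eq_zero h0
    rw [Finset.sum_sub_distrib, ← Finset.mul_sum, ← Finset.sum_mul] at h1
    rw [← Finset.add_sum_erase _ _ hj, mul_neg, mul_add, neg_mul, add_mul, h.mul_d,
      h.mul_d, Equiv.swap_apply_right, Equiv.swap_apply_right, h.comm j i]
    rw [sub_eq_zero] at h1
    rw [h1]
    abel
  by_cases hi : k = i
  · subst hi
    rw [h.self, h.of_ne _ _ (Ne.symm hij)]
    exact aux _ _ hij
  · by_cases hj : k = j
    · subst hj
      rw [h.self, h.of_ne _ _ hij, ← neg_sub, neg_eq_zero]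
      exact aux _ _ (Ne.symm hij)
    · rw [h.of_ne _ _ (Ne.symm hi), h.of_ne _ _ (Ne.symm hj), h.mul_d,
        h.mul_d, Equiv.swap_apply_of_ne_of_ne hij (Ne.symm hi),
        Equiv.swap_apply_of_ne_of_ne (Ne.symm hij) (Ne.symm hj)]
      abel

lemma DunklRelations.mul_d_pow (h : DunklRelations d x s) (i j k : ι) (N : ℕ) :
    s i j * d k ^ N = d (Equiv.swap i j k) ^ N * s i j := by
  induction N with
  | zero => simp
  | succ N ih => rw [pow_succ, ← mul_assoc, ih, mul_assoc, h.mul_d, ← mul_assoc, pow_succ]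

/-- The commutator of xₖ with dₖ^N and those with the other dᵢ^N both expand into terms dₖ^a sₖᵢ
dₖ^(N-1-a), with opposite signs. The match needs the d's to commute and the summation over a to be
reversed. -/
lemma DunklRelations.powerSum_commute (h : DunklRelations d x s)
    (hd : ∀ i j, Commute (d i) (d j)) (N : ℕ) (k : ι) :
    (∑ i, d i ^ N) * x k = x k * ∑ i, d i ^ N := by
  rw [← sub_eq_zero, Finset.sum_mul, Finset.mul_sum, ← Finset.sum_sub_distrib]
  rw [← Finset.add_sum_erase _ _ (Finset.mem_univ k), pow_comm_sub, h.self]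
  have e : ∀ i ∈ Finset.univ.erase k, d i ^ N * x k - x k * d i ^ N =
      ∑ a ∈ Finset.range N, d k ^ a * s k i * d k ^ (N - 1 - a) := ?_
  · rw [Finset.sum_congr rfl e, Finset.sum_comm, ← Finset.sum_add_distrib]
    refine Finset.sum_eq_zero fun a _ => ?_
    rw [mul_neg, neg_mul, Finset.mul_sum, Finset.sum_mul, neg_add_cancel]
  · intro i hi
    rw [pow_comm_sub, h.of_ne _ _ (Finset.ne_of_mem_erase hi), ← Finset.sum_range_reflect]
    refine Finset.sum_congr rfl fun a ha => ?_
    have ha := Finset.mem_range.1 ha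
    have e : N - 1 - (N - 1 - a) = a := by omega
    rw [e, mul_assoc, mul_assoc, h.mul_d_pow, h.mul_d_pow,
      Equiv.swap_apply_left, Equiv.swap_apply_left, h.comm, ← mul_assoc, ← mul_assoc,
      ((hd i k).pow_pow _ _).eq]

/-- The commutator of `∑ xᵢ dᵢ²` with `d j ^ N`. -/
lemma DunklRelations.quadratic_commutator (h : DunklRelations d x s)
    (hd : ∀ i j, Commute (d i) (d j)) (N : ℕ) (j : ι) :
    (∑ i, x i * d i ^ 2) * d j ^ N - d j ^ N * ∑ i, x i * d i ^ 2 =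
      -∑ i ∈ Finset.univ.erase j, s i j * ((d i + d j) * (d i ^ N - d j ^ N)) := by
  -- The case N = 1 comes directly from [dⱼ, xᵢ]. The general case follows from the Leibniz rule for
  -- powers, where moving sᵢⱼ to the left turns the sum over a into the geometric sum for dᵢ^N -
  -- dⱼ^N.
  have h1 : (∑ i, x i * d i ^ 2) * d j - d j * ∑ i, x i * d i ^ 2 =
      -∑ i ∈ Finset.univ.erase j, s i j * (d i ^ 2 - d j ^ 2) := by
    have e : ∀ i, x i * d i ^ 2 * d j - d j * (x i * d i ^ 2) =
        -((d j * x i - x i * d j) * d i ^ 2) := by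
      intro i
      rw [mul_assoc, ((hd i j).pow_left 2).eq, sub_mul, mul_assoc, mul_assoc]
      abel
    rw [Finset.sum_mul, Finset.mul_sum, ← Finset.sum_sub_distrib]
    simp only [e]
    rw [Finset.sum_neg_distrib, ← Finset.add_sum_erase _ _ (Finset.mem_univ j), h.self, neg_mul,
      Finset.sum_mul, ← Finset.sum_neg_distrib, ← Finset.sum_add_distrib]
    congr 1
    refine Finset.sum_congr rfl fun i hi => ?_
    rw [h.of_ne _ _ (Finset.ne_of_mem_erase hi).symm, h.comm i j, mul_sub]
    abel
  have h2 := pow_comm_sub (d j) (∑ i, x i * d i ^ 2) N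
  rw [← neg_sub (d j ^ N * _), h2, ← neg_sub (_ * d j) (d j * _), h1, neg_neg, neg_inj]
  simp only [Finset.mul_sum, Finset.sum_mul]
  rw [Finset.sum_comm]
  refine Finset.sum_congr rfl fun i _ => ?_
  have e : ∀ a, d j ^ a * (s i j * (d i ^ 2 - d j ^ 2)) * d j ^ (N - 1 - a) =
      s i j * ((d i + d j) * ((d i - d j) * (d i ^ a * d j ^ (N - 1 - a)))) := by
    intro a
    have := h.mul_d_pow i j i a
    rw [Equiv.swap_apply_left] at this
    rw [← mul_assoc (d j ^ a), ← this, (hd i j).sq_sub_sq]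
    have c : Commute (d i ^ a) ((d i + d j) * (d i - d j)) :=
      (((Commute.refl _).add_right (hd i j)).mul_right
        ((Commute.refl _).sub_right (hd i j))).pow_left a
    rw [mul_assoc (s i j), c.eq]
    simp only [mul_assoc]
  simp only [e]
  rw [← Finset.mul_sum, ← Finset.mul_sum, ← Finset.mul_sum, (hd i j).mul_geom_sum₂]

end Relations

lemma dunkl_relations (n : ℕ) : DunklRelations (dunkl n) (mulX n) (swapEnd n) where
  of_ne _ _ h := dunkl_mulX_of_ne n h
  self := dunkl_mulX_self n
  comm := swapEnd_comm n
  mul_d := swapEnd_mul_dunkl n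

/-- The commutator commutes with every x̃ₖ and kills 1, so it vanishes. -/
lemma dunkl_commute (n : ℕ) (i j : Fin n) : Commute (dunkl n i) (dunkl n j) := by
  by_cases hij : i = j
  · subst hij; exact Commute.refl _
  refine sub_eq_zero.1 (end_eq_zero n _ ((dunkl_relations n).commutator_commute hij) ?_)
  rw [LinearMap.sub_apply, Module.End.mul_apply, Module.End.mul_apply, dunkl_one, dunkl_one,
      map_zero, map_zero, sub_zero]

lemma sum_dunkl (n : ℕ) : ∑ i, dunkl n i = 0 := by
  refine LinearMap.ext fun p => ?_
  rw [LinearMap.sum_apply, LinearMap.zero_apply]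
  simp only [dunkl_apply]
  have h : ∑ i, ∑ j, dd n i j p = -∑ i, ∑ j, dd n i j p := by
    conv_lhs => rw [Finset.sum_comm]
    simp only [← Finset.sum_neg_distrib, ← dd_swap]
  exact self_eq_neg.1 h

/-- Power sums of positive degree in the Dunkl operators vanish. -/
lemma sum_dunkl_pow (n N : ℕ) (hN : 1 ≤ N) : ∑ i, dunkl n i ^ N = 0 := by
  apply end_eq_zero
  · exact (dunkl_relations n).powerSum_commute (dunkl_commute n) N
  · rw [LinearMap.sum_apply]
    refine Finset.sum_eq_zero fun i _ => ?_
    obtain ⟨M, rfl⟩ := Nat.exists_eq_add_of_le' hN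
    rw [pow_succ, Module.End.mul_apply, dunkl_one, map_zero]

/-! ## Exterior algebras -/

section Exterior

open CliffordAlgebra (contractLeft involute)

variable {R M : Type*} [CommRing R] [AddCommGroup M] [Module R M]

lemma exterior_induction {C : ExteriorAlgebra R M → Prop}
    (hr : ∀ r : R, C (algebraMap R _ r)) (hadd : ∀ x y, C x → C y → C (x + y))
    (hmul : ∀ m x, C x → C (ExteriorAlgebra.ι R m * x)) (x : ExteriorAlgebra R M) : C x :=
  CliffordAlgebra.left_induction (0 : QuadraticForm R M) hr hadd (fun x m h => hmul m x h) x

lemma involute_ι (m : M) : involute (ExteriorAlgebra.ι R m) = -ExteriorAlgebra.ι R m :=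
  CliffordAlgebra.involute_ι m

lemma contractLeft_ι_mul' (d : Module.Dual R M) (m : M) (x : ExteriorAlgebra R M) :
    contractLeft d (ExteriorAlgebra.ι R m * x) =
      d m • x - ExteriorAlgebra.ι R m * contractLeft d x :=
  CliffordAlgebra.contractLeft_ι_mul d m x

lemma contractLeft_mul (d : Module.Dual R M) (a b : ExteriorAlgebra R M) :
    contractLeft d (a * b) = contractLeft d a * b + involute a * contractLeft d b := by
  induction a using exterior_induction with
  | hr r =>
    rw [CliffordAlgebra.contractLeft_algebraMap_mul, CliffordAlgebra.contractLeft_algebraMap,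
      AlgHom.commutes, zero_mul, zero_add]
  | hadd x y hx hy =>
    rw [add_mul, map_add, hx, hy, map_add, map_add, add_mul, add_mul]
    abel
  | hmul m x hx =>
    rw [mul_assoc, contractLeft_ι_mul', hx, contractLeft_ι_mul', map_mul, involute_ι]
    rw [mul_add, sub_mul, smul_mul_assoc, neg_mul, neg_mul, mul_assoc, mul_assoc]
    abel

lemma ι_mul_ι_comm (m m' : M) :
    ExteriorAlgebra.ι R m * ExteriorAlgebra.ι R m' =
      -(ExteriorAlgebra.ι R m' * ExteriorAlgebra.ι R m) :=
  eq_neg_of_add_eq_zero_left (ExteriorAlgebra.ι_add_mul_swap m m')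

lemma mul_ι_eq (a : ExteriorAlgebra R M) (m : M) :
    a * ExteriorAlgebra.ι R m = ExteriorAlgebra.ι R m * involute a := by
  induction a using exterior_induction with
  | hr r => rw [AlgHom.commutes, Algebra.commutes]
  | hadd x y hx hy => rw [add_mul, hx, hy, map_add, mul_add]
  | hmul m' x hx =>
    rw [mul_assoc, hx, map_mul, involute_ι, ← mul_assoc, ι_mul_ι_comm, neg_mul, neg_mul, mul_neg,
      mul_assoc]

lemma ι_mul_mul_ι (m : M) (a : ExteriorAlgebra R M) :
    ExteriorAlgebra.ι R m * a * ExteriorAlgebra.ι R m = 0 := by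
  rw [mul_assoc, mul_ι_eq, ← mul_assoc, ExteriorAlgebra.ι_sq_zero, zero_mul]

/-- Since m ∧ m = 0, the multiplicative extension of id - d ⊗ m has no terms beyond first order in
m. This is how a transposition acts on exterior forms. -/
lemma map_reflection (f : M →ₗ[R] M) (d : Module.Dual R M) (m : M)
    (hf : ∀ v, f v = v - d v • m) (a : ExteriorAlgebra R M) :
    ExteriorAlgebra.map f a = a - ExteriorAlgebra.ι R m * contractLeft d a := by
  induction a using exterior_induction with
  | hr r => rw [AlgHom.commutes, CliffordAlgebra.contractLeft_algebraMap, mul_zero, sub_zero]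
  | hadd x y hx hy => rw [map_add, map_add, hx, hy, mul_add]; abel
  | hmul v x hx =>
    rw [map_mul, hx, ExteriorAlgebra.map_apply_ι, hf, contractLeft_ι_mul', map_sub, map_smul]
    have h1 : ExteriorAlgebra.ι R m * (ExteriorAlgebra.ι R v * contractLeft d x) =
        -(ExteriorAlgebra.ι R v * (ExteriorAlgebra.ι R m * contractLeft d x)) := by
      rw [← mul_assoc, ι_mul_ι_comm, neg_mul, mul_assoc]
    have h2 : ExteriorAlgebra.ι R m * (ExteriorAlgebra.ι R m * contractLeft d x) = 0 := by
      rw [← mul_assoc, ExteriorAlgebra.ι_sq_zero, zero_mul]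
    rw [sub_mul, mul_sub, mul_sub, mul_sub, smul_mul_assoc, smul_mul_assoc, h1, h2, mul_smul_comm]
    simp only [smul_zero]
    abel

lemma map_contractLeft (f : M →ₗ[R] M) (d d' : Module.Dual R M) (h : ∀ v, d' (f v) = d v)
    (a : ExteriorAlgebra R M) :
    ExteriorAlgebra.map f (contractLeft d a) = contractLeft d' (ExteriorAlgebra.map f a) := by
  induction a using exterior_induction with
  | hr r => rw [CliffordAlgebra.contractLeft_algebraMap, AlgHom.commutes,
      CliffordAlgebra.contractLeft_algebraMap, map_zero]
  | hadd x y hx hy => simp only [map_add, hx, hy]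
  | hmul v x hx =>
    rw [contractLeft_ι_mul', map_sub, map_smul, map_mul, map_mul, hx, ExteriorAlgebra.map_apply_ι,
      contractLeft_ι_mul', h]

lemma map_involute (f : M →ₗ[R] M) (a : ExteriorAlgebra R M) :
    ExteriorAlgebra.map f (involute a) = involute (ExteriorAlgebra.map f a) := by
  induction a using exterior_induction with
  | hr r => simp only [AlgHom.commutes]
  | hadd x y hx hy => simp only [map_add, hx, hy]
  | hmul v x hx =>
    rw [map_mul, map_mul, map_mul, map_mul, hx, involute_ι, map_neg, ExteriorAlgebra.map_apply_ι,
      involute_ι]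

lemma algebraMapInv_ι_mul (m : M) (x : ExteriorAlgebra R M) :
    ExteriorAlgebra.algebraMapInv (ExteriorAlgebra.ι R m * x) = 0 := by
  rw [map_mul]
  simp [ExteriorAlgebra.algebraMapInv]

/-- Converts the grade involution, in which all Leibniz rules below are written, into the sign of
the final statement. -/
lemma involute_of_mem_exteriorPower (p : ℕ) {a : ExteriorAlgebra R M} (ha : a ∈ ⋀[R]^p M) :
    involute a = (-1 : R) ^ p • a := by
  induction p generalizing a with
  | zero =>
    change a ∈ LinearMap.range (ExteriorAlgebra.ι R) ^ 0 at ha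
    rw [pow_zero, Submodule.mem_one] at ha
    obtain ⟨r, rfl⟩ := ha
    rw [AlgHom.commutes, pow_zero, one_smul]
  | succ p ih =>
    change a ∈ LinearMap.range (ExteriorAlgebra.ι R) ^ (p + 1) at ha
    rw [pow_succ'] at ha
    induction ha using Submodule.mul_induction_on' with
    | mem_mul_mem x hx y hy =>
      obtain ⟨m, rfl⟩ := hx
      rw [map_mul, involute_ι, ih hy, pow_succ, mul_smul_comm, neg_mul, mul_smul, neg_smul, one_smul]
    | add x _ y _ hx hy => rw [map_add, hx, hy, smul_add]

end Exterior

/-! ## Permutations of the Cartan subalgebra -/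

lemma coord_permCartan (n : ℕ) (σ : Equiv.Perm (Fin n)) (i : Fin n) (v : cartan n) :
    coord n (σ i) (permCartan n σ v) = coord n i v := by
  change (v : Fin n → ℂ) (σ.symm (σ i)) = _
  rw [Equiv.symm_apply_apply]
  rfl

lemma coord_basisProj (n : ℕ) (i j : Fin n) :
    coord n i (basisProj n j) = (if i = j then 1 else 0) - (n : ℂ)⁻¹ := rfl

lemma cartan_ext (n : ℕ) {v w : cartan n} (h : ∀ i, coord n i v = coord n i w) : v = w :=
  Subtype.ext (funext h)

lemma permCartan_basisProj (n : ℕ) (σ : Equiv.Perm (Fin n)) (i : Fin n) :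
    permCartan n σ (basisProj n i) = basisProj n (σ i) := by
  apply cartan_ext
  intro j
  obtain ⟨j, rfl⟩ := σ.surjective j
  rw [coord_permCartan, coord_basisProj, coord_basisProj]
  simp

lemma sum_coord (n : ℕ) : ∑ i, coord n i = 0 := by
  refine LinearMap.ext fun v => ?_
  rw [LinearMap.sum_apply]
  exact v.2

lemma sum_basisProj (n : ℕ) : ∑ i, basisProj n i = 0 := by
  apply cartan_ext
  intro j
  have hn : (n : ℂ) ≠ 0 := by exact_mod_cast j.pos.ne'
  rw [map_sum, map_zero]
  simp [coord_basisProj, hn]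

lemma sum_coord_smul_basisProj (n : ℕ) (v : cartan n) : ∑ i, coord n i v • basisProj n i = v := by
  apply cartan_ext
  intro j
  rw [map_sum]
  simp only [map_smul, coord_basisProj, smul_eq_mul, mul_sub, Finset.sum_sub_distrib,
    ← Finset.sum_mul]
  have := LinearMap.congr_fun (sum_coord n) v
  rw [LinearMap.sum_apply] at this
  rw [this]
  simp

lemma permCartan_swap (n : ℕ) {i j : Fin n} (h : i ≠ j) (v : cartan n) :
    permCartan n (Equiv.swap i j) v =
      v - (coord n i - coord n j) v • (basisProj n i - basisProj n j) := by
  apply cartan_ext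
  intro k
  obtain ⟨k, rfl⟩ := (Equiv.swap i j).surjective k
  rw [coord_permCartan, map_sub, map_smul, map_sub, coord_basisProj, coord_basisProj,
    LinearMap.sub_apply, smul_eq_mul]
  by_cases h1 : k = i
  · subst h1
    simp [h.symm]
    ring
  · by_cases h2 : k = j
    · subst h2
      simp [h]
    · simp [Equiv.swap_apply_of_ne_of_ne h1 h2, h1, h2]

/-! ## Derivations on invariant superpolynomials -/

section Super

variable {ι A : Type*} [Fintype ι] [DecidableEq ι] [Ring A] [Algebra ℂ A]

/-- The identity behind the Leibniz rule for the operator `∑ xᵢ Dᵢ²`. -/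
lemma sum_cyclic_eq_zero (x θ : ι → A) (f g a b : ι → ι → A)
    (hx : ∀ i y, x i * y = y * x i)
    (hreg : ∀ i j, i ≠ j → ∀ y, (x i - x j) * y = 0 → y = 0)
    (hθ : ∀ i j y, (θ i - θ j) * y * (θ i - θ j) = 0)
    (hf : ∀ i j, (x i - x j) * f i j = -((θ i - θ j) * a i j))
    (hg : ∀ i j, (x i - x j) * g i j = -((θ i - θ j) * b i j))
    (ha : ∀ i j k, a i j + a j k = a i k) (hb : ∀ i j k, b i j + b j k = b i k)
    (hf0 : ∀ i, f i i = 0) (hg0 : ∀ i, g i i = 0)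
    (hf1 : ∀ i j, f j i = -f i j) (hg1 : ∀ i j, g j i = -g i j) :
    ∑ i, ∑ j, ∑ k, x i * (f j k * g i j + f i j * g j k) = 0 := by
  have hx' : ∀ i j y, (x i - x j) * y = y * (x i - x j) := fun i j y => by
    rw [sub_mul, mul_sub, hx, hx]
  -- products with a repeated pair vanish
  have hfg : ∀ i j, f i j * g i j = 0 := by
    intro i j
    by_cases h : i = j
    · subst h; rw [hf0, zero_mul]
    refine hreg i j h _ (hreg i j h _ ?_)
    calc (x i - x j) * ((x i - x j) * (f i j * g i j))
        = ((x i - x j) * f i j) * ((x i - x j) * g i j) := by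
          rw [← mul_assoc (x i - x j) (f i j), hx' i j ((x i - x j) * f i j * g i j), hx' i j (g i j)]
          simp only [mul_assoc]
      _ = (θ i - θ j) * a i j * (θ i - θ j) * b i j := by rw [hf, hg]; noncomm_ring
      _ = 0 := by rw [hθ, zero_mul]
  -- Clearing denominators. The numerator on the right is invariant under cyclic rotation of (i, j,
  -- k), which is the content of `hcyc`.
  have hT : ∀ i j k, (x i - x j) * ((x j - x k) * (f j k * g i j + f i j * g j k)) =
      (θ j - θ k) * a j k * ((θ i - θ j) * b i j) + (θ i - θ j) * a i j * ((θ j - θ k) * b j k) := by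
    intro i j k
    have e1 : (x i - x j) * ((x j - x k) * (f j k * g i j)) =
        ((x j - x k) * f j k) * ((x i - x j) * g i j) := by
      rw [← mul_assoc (x j - x k) (f j k), hx' i j ((x j - x k) * f j k * g i j), hx' i j (g i j)]
      simp only [mul_assoc]
    have e2 : (x i - x j) * ((x j - x k) * (f i j * g j k)) =
        ((x i - x j) * f i j) * ((x j - x k) * g j k) := by
      rw [hx' j k (f i j * g j k), hx' j k (g j k)]
      simp only [mul_assoc]
    rw [mul_add, mul_add, e1, e2, hf, hf, hg, hg]
    noncomm_ring
  have hcyc : ∀ i j k,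
      (θ j - θ k) * a j k * ((θ i - θ j) * b i j) + (θ i - θ j) * a i j * ((θ j - θ k) * b j k) =
      (θ k - θ i) * a k i * ((θ j - θ k) * b j k) +
        (θ j - θ k) * a j k * ((θ k - θ i) * b k i) := by
    intro i j k
    have haa : ∀ i, a i i = 0 := fun i => by simpa using ha i i i
    have hbb : ∀ i, b i i = 0 := fun i => by simpa using hb i i i
    have ea : a k i = -(a i j + a j k) := by
      rw [ha]; exact eq_neg_of_add_eq_zero_left (by rw [ha, haa])
    have eb : b k i = -(b i j + b j k) := by
      rw [hb]; exact eq_neg_of_add_eq_zero_left (by rw [hb, hbb])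
    have et : θ k - θ i = -((θ i - θ j) + (θ j - θ k)) := by abel
    have hp : ∀ y, (θ i - θ j) * y * (θ j - θ k) + (θ j - θ k) * y * (θ i - θ j) = 0 := by
      intro y
      have h1 := hθ i k y
      have e : θ i - θ k = (θ i - θ j) + (θ j - θ k) := by abel
      rw [e, add_mul, add_mul, mul_add, mul_add, hθ, hθ] at h1
      simpa [add_comm] using h1
    rw [ea, eb, et]
    generalize θ i - θ j = u at *
    have hv := hθ j k
    generalize θ j - θ k = v at *
    generalize a i j = p
    generalize a j k = q
    generalize b i j = p'
    generalize b j k = q'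
    have h1 : v * q * (v * (p' + q')) = 0 := by rw [← mul_assoc, hv, zero_mul]
    have h2 : v * q * (v * q') = 0 := by rw [← mul_assoc, hv, zero_mul]
    have h3 : u * q * (v * q') + v * q * (u * q') = 0 := by
      rw [← mul_assoc, ← mul_assoc, ← add_mul, hp, zero_mul]
    have h4 : v * p * (v * q') = 0 := by rw [← mul_assoc, hv, zero_mul]
    have h5 := hp p
    have h6 : v * q * (v * p') = 0 := by rw [← mul_assoc, hv, zero_mul]
    have key : -(u + v) * -(p + q) * (v * q') + v * q * (-(u + v) * -(p' + q')) =
        (v * q * (u * p') + u * p * (v * q')) + (u * q * (v * q') + v * q * (u * q')) +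
          v * p * (v * q') + v * q * (v * q') + v * q * (v * p') + v * q * (v * q') := by
      noncomm_ring
    rw [key, h2, h3, h4, h6]
    simp
  set S : ι → ι → ι → A := fun i j k => f j k * g i j + f i j * g j k with hS
  have hSsymm : ∀ i j k, S k j i = S i j k := by
    intro i j k
    simp only [hS]
    rw [hf1 i j, hg1 j k, hf1 j k, hg1 i j]
    noncomm_ring
  have hS1 : ∀ i k, S i i k = 0 := fun i k => by simp [hS, hf0, hg0]
  have hS2 : ∀ i k, S i k k = 0 := fun i k => by simp [hS, hf0, hg0]
  have hS3 : ∀ i k, S i k i = 0 := fun i k => by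
    simp only [hS]
    rw [hf1 i k, hg1 i k, neg_mul, mul_neg, hfg]; simp
  -- With the common numerator T, the three terms become (xₖ² - xᵢ²) T, (xᵢ² - xⱼ²) T and (xⱼ² -
  -- xₖ²) T after multiplication by all three differences, and these add up to zero.
  have hsum : ∀ i j k, (x i + x k) * S i j k + (x j + x i) * S j k i + (x k + x j) * S k i j = 0 := by
    intro i j k
    by_cases hij : i = j
    · subst hij; rw [hS1, hS2, hS3]; simp
    by_cases hjk : j = k
    · subst hjk; rw [hS1, hS2, hS3]; simp
    by_cases hki : k = i
    · subst hki; rw [hS1, hS2, hS3]; simp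
    refine hreg i j hij _ (hreg j k hjk _ (hreg k i hki _ ?_))
    have hxx : ∀ i j, Commute (x i) (x j) := fun i j => hx i (x j)
    have t1 := hT i j k
    have t2 := hT j k i
    have t3 := hT k i j
    rw [← hcyc i j k] at t2
    rw [hcyc k i j] at t3
    change (x i - x j) * ((x j - x k) * S i j k) = _ at t1
    change (x j - x k) * ((x k - x i) * S j k i) = _ at t2
    change (x k - x i) * ((x i - x j) * S k i j) = _ at t3
    generalize (θ j - θ k) * a j k * ((θ i - θ j) * b i j) +
      (θ i - θ j) * a i j * ((θ j - θ k) * b j k) = T at t1 t2 t3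
    have r1 : (x k - x i) * ((x j - x k) * ((x i - x j) * ((x i + x k) * S i j k))) =
        (x k - x i) * ((x i + x k) * T) := by
      rw [← t1]
      congr 1
      rw [← mul_assoc (x i - x j), hx' i j (x i + x k), mul_assoc (x i + x k),
        ← mul_assoc (x j - x k), hx' j k (x i + x k), mul_assoc (x i + x k)]
      congr 1
      rw [← mul_assoc, ← mul_assoc, hx' i j (x j - x k)]
    have r2 : (x k - x i) * ((x j - x k) * ((x i - x j) * ((x j + x i) * S j k i))) =
        (x i - x j) * ((x j + x i) * T) := by
      rw [← t2]
      generalize S j k i = s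
      rw [← mul_assoc (x i - x j), hx' i j (x j + x i), mul_assoc (x j + x i)]
      rw [← mul_assoc (x j - x k), hx' j k (x j + x i), mul_assoc (x j + x i)]
      rw [← mul_assoc (x k - x i), hx' k i (x j + x i), mul_assoc (x j + x i)]
      rw [← mul_assoc (x i - x j) (x j + x i), hx' i j (x j + x i), mul_assoc (x j + x i)]
      congr 1
      rw [← mul_assoc (x j - x k) (x i - x j), ← hx' i j (x j - x k), mul_assoc (x i - x j),
        ← mul_assoc (x k - x i), ← hx' i j (x k - x i), mul_assoc (x i - x j)]
      congr 1
      rw [← mul_assoc, ← mul_assoc, hx' k i (x j - x k)]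
    have r3 : (x k - x i) * ((x j - x k) * ((x i - x j) * ((x k + x j) * S k i j))) =
        (x j - x k) * ((x k + x j) * T) := by
      rw [← t3]
      generalize S k i j = s
      rw [← mul_assoc (x i - x j), hx' i j (x k + x j), mul_assoc (x k + x j)]
      rw [← mul_assoc (x j - x k), hx' j k (x k + x j), mul_assoc (x k + x j)]
      rw [← mul_assoc (x k - x i), hx' k i (x k + x j), mul_assoc (x k + x j)]
      rw [← mul_assoc (x j - x k) (x k + x j), hx' j k (x k + x j), mul_assoc (x k + x j)]
      congr 1
      rw [← mul_assoc (x k - x i), hx' k i (x j - x k), mul_assoc]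
    rw [mul_add, mul_add, mul_add, mul_add, mul_add, mul_add, r1, r2, r3]
    have hij' := (hxx i j).eq
    have hjk' := (hxx j k).eq
    have hki' := (hxx k i).eq
    have e : (x k - x i) * ((x i + x k) * T) + (x i - x j) * ((x j + x i) * T) +
        (x j - x k) * ((x k + x j) * T) =
        ((x k * x i - x i * x k) + (x i * x j - x j * x i) + (x j * x k - x k * x j)) * T := by
      noncomm_ring
    rw [e, hij', hjk', hki']
    simp
  have h3 : ∀ w : ι → ι → ι → A, (∀ i j k, w i j k + w j k i + w k i j = 0) →
      ∑ i, ∑ j, ∑ k, w i j k = 0 := by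
    intro w hw
    have e1 : ∀ w : ι → ι → ι → A, ∑ i, ∑ j, ∑ k, w j k i = ∑ i, ∑ j, ∑ k, w i j k := by
      intro w
      rw [Finset.sum_comm]
      refine Finset.sum_congr rfl fun j _ => ?_
      rw [Finset.sum_comm]
    have e2 := (e1 fun i j k => w j k i).trans (e1 w)
    have h : ∑ i, ∑ j, ∑ k, (w i j k + w j k i + w k i j) = 0 :=
      Finset.sum_eq_zero fun i _ => Finset.sum_eq_zero fun j _ => Finset.sum_eq_zero fun k _ =>
        hw i j k
    simp only [Finset.sum_add_distrib] at h
    rw [e2, e1 w] at h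
    have h' : (3 : ℂ) • ∑ i, ∑ j, ∑ k, w i j k = 0 := by
      rw [show (3 : ℂ) = 1 + 1 + 1 by norm_num, add_smul, add_smul, one_smul, h]
    exact (smul_eq_zero_iff_right (by norm_num)).1 h'
  -- Since S is symmetric under exchange of its outer indices, the weights xᵢ and xₖ contribute
  -- equally, so the sum is twice the one sought.
  have h4 := h3 (fun i j k => (x i + x k) * S i j k) hsum
  simp only [add_mul, Finset.sum_add_distrib] at h4
  have e : ∑ i, ∑ j, ∑ k, x k * S i j k = ∑ i, ∑ j, ∑ k, x i * S i j k := by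
    have : ∀ i, ∑ j, ∑ k, x k * S i j k = ∑ k, ∑ j, x k * S k j i := by
      intro i
      rw [Finset.sum_comm]
      simp only [hSsymm]
    simp only [this]
    rw [Finset.sum_comm]
    refine Finset.sum_congr rfl fun j _ => ?_
    rw [Finset.sum_comm]
  rw [e] at h4
  have h' : (2 : ℂ) • ∑ i, ∑ j, ∑ k, x i * S i j k = 0 := by
    rw [← h4, show (2 : ℂ) = 1 + 1 by norm_num, add_smul, one_smul]
  exact (smul_eq_zero_iff_right (by norm_num)).1 h'

lemma sum_of_pairs (f : ι → ι → A) (hf : ∀ i j, i ≠ j → f i j + f j i = 0) (hf0 : ∀ i, f i i = 0) :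
    ∑ i, ∑ j, f i j = 0 := by
  have e : ∑ i, ∑ j, (f i j + f j i) = 0 :=
    Finset.sum_eq_zero fun i _ => Finset.sum_eq_zero fun j _ => by
      by_cases hij : i = j
      · subst hij; rw [hf0, add_zero]
      · exact hf i j hij
  simp only [Finset.sum_add_distrib] at e
  rw [Finset.sum_comm (f := fun i j => f j i)] at e
  have h' : (2 : ℂ) • ∑ i, ∑ j, f i j = 0 := by
    rw [← e, show (2 : ℂ) = 1 + 1 by norm_num, add_smul, one_smul]
  exact (smul_eq_zero_iff_right (by norm_num)).1 h'

/-- A superalgebra with coordinates `x i`, odd elements `θ i`, contractions `c i`, divided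
differences `Δ i j` and partial transpositions `s i j`, together with a subalgebra `H` of
invariants. -/
structure SuperDunkl (x θ : ι → A) (hat : A →ₐ[ℂ] A) (c : ι → A →ₗ[ℂ] A)
    (Δ : ι → ι → A →ₗ[ℂ] A) (s : ι → ι → A →ₐ[ℂ] A) (H : Subalgebra ℂ A) : Prop where
  x_comm : ∀ i y, x i * y = y * x i
  regular : ∀ i j, i ≠ j → ∀ y, (x i - x j) * y = 0 → y = 0
  sandwich : ∀ i j y, (θ i - θ j) * y * (θ i - θ j) = 0
  mul_θ : ∀ i y, y * θ i = θ i * hat y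
  hat_θ : ∀ i, hat (θ i) = -θ i
  hat_x : ∀ i, hat (x i) = x i
  Δ_self : ∀ i y, Δ i i y = 0
  Δ_spec : ∀ i j y, (x i - x j) * Δ i j y = s i j y - y
  Δ_neg : ∀ i j y, Δ j i y = -Δ i j y
  Δ_mul : ∀ i j y z, Δ i j (y * z) = Δ i j y * z + s i j y * Δ i j z
  Δ_θ : ∀ i j k y, Δ i j (θ k * y) = θ k * Δ i j y
  Δ_c : ∀ i j k y, Δ i j (c k y) = c k (Δ i j y)
  Δ_hat : ∀ i j y, Δ i j (hat y) = hat (Δ i j y)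
  s_Δ : ∀ i j k y, s i j (Δ i k y) = Δ j (Equiv.swap i j k) (s i j y)
  c_mul : ∀ i y z, c i (y * z) = c i y * z + hat y * c i z
  c_x : ∀ i j y, c i (x j * y) = x j * c i y
  c_θ : ∀ i j, i ≠ j → ∀ y, (c i - c j) ((θ i - θ j) * y) =
    (2 : ℂ) • y - (θ i - θ j) * (c i - c j) y
  c_c : ∀ i j y, c i (c j y) = -c j (c i y)
  invariant : ∀ F ∈ H, ∀ i j, s i j F = F - (θ i - θ j) * (c i - c j) F
  hat_mem : ∀ F ∈ H, hat F ∈ H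

namespace SuperDunkl

variable {x θ : ι → A} {hat : A →ₐ[ℂ] A} {c : ι → A →ₗ[ℂ] A}
    {Δ : ι → ι → A →ₗ[ℂ] A} {s : ι → ι → A →ₐ[ℂ] A} {H : Subalgebra ℂ A}

section

variable (h : SuperDunkl x θ hat c Δ s H)

include h

lemma x_sub_comm (i j : ι) (y : A) : (x i - x j) * y = y * (x i - x j) := by
  rw [sub_mul, mul_sub, h.x_comm, h.x_comm]

lemma spec_invariant {F : A} (hF : F ∈ H) (i j : ι) :
    (x i - x j) * Δ i j F = -((θ i - θ j) * (c i - c j) F) := by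
  rw [h.Δ_spec, h.invariant F hF]
  abel

/-- After multiplication by xᵢ - xⱼ, the divided difference of an invariant starts with θᵢ - θⱼ, and
the sandwich relation applies. This removes the twist from the Leibniz rule of Δᵢⱼ on invariants. -/
lemma θ_mul_Δ {G : A} (hG : G ∈ H) (i j : ι) (y : A) : (θ i - θ j) * y * Δ i j G = 0 := by
  by_cases hij : i = j
  · subst hij; simp
  apply h.regular i j hij
  rw [← mul_assoc, h.x_sub_comm, mul_assoc, h.spec_invariant hG, mul_neg, ← mul_assoc, h.sandwich,
    zero_mul, neg_zero]

lemma Δ_mul_θ {F : A} (hF : F ∈ H) (i j : ι) (y : A) : Δ i j F * ((θ i - θ j) * y) = 0 := by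
  by_cases hij : i = j
  · subst hij; simp
  apply h.regular i j hij
  rw [← mul_assoc, h.spec_invariant hF, neg_mul, ← mul_assoc, h.sandwich, zero_mul, neg_zero]

lemma Δ_mul_invariant {F G : A} (hF : F ∈ H) (i j : ι) :
    Δ i j (F * G) = Δ i j F * G + F * Δ i j G - (θ i - θ j) * (c i - c j) F * Δ i j G := by
  rw [h.Δ_mul, h.invariant F hF, sub_mul, add_sub_assoc]

end

variable (Δ) in
/-- The Dunkl operators. -/
def D (i : ι) : Module.End ℂ A := ∑ j, (Δ i j : Module.End ℂ A)

lemma D_apply (i : ι) (y : A) : D Δ i y = ∑ j, Δ i j y := LinearMap.sum_apply _ _ _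

section

variable (h : SuperDunkl x θ hat c Δ s H)

include h

lemma D_mul {F G : A} (hF : F ∈ H) (hG : G ∈ H) (i : ι) :
    D Δ i (F * G) = D Δ i F * G + F * D Δ i G := by
  simp only [D_apply, Finset.sum_mul, Finset.mul_sum, ← Finset.sum_add_distrib]
  refine Finset.sum_congr rfl fun j _ => ?_
  rw [h.Δ_mul_invariant hF, h.θ_mul_Δ hG, sub_zero]

lemma Δ_sub (i j k l : ι) (y : A) :
    Δ i j ((θ k - θ l) * (c k - c l) y) = (θ k - θ l) * (c k - c l) (Δ i j y) := by
  rw [sub_mul, map_sub, h.Δ_θ, h.Δ_θ, LinearMap.sub_apply, map_sub, h.Δ_c, h.Δ_c, sub_mul,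
    LinearMap.sub_apply]

lemma s_D {F : A} (hF : F ∈ H) (i j : ι) :
    s i j (D Δ i F) = D Δ j F - (θ i - θ j) * (c i - c j) (D Δ j F) := by
  simp only [D_apply, map_sum, h.s_Δ, h.invariant F hF, map_sub, h.Δ_sub, Finset.sum_sub_distrib,
    ← Finset.mul_sum]
  rw [Equiv.sum_comp (Equiv.swap i j) (fun k => Δ j k F),
    Equiv.sum_comp (Equiv.swap i j) (fun k => (c i - c j) (Δ j k F))]

lemma spec_D {F : A} (hF : F ∈ H) (i j : ι) :
    (x i - x j) * Δ i j (D Δ i F) =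
      D Δ j F - D Δ i F - (θ i - θ j) * (c i - c j) (D Δ j F) := by
  rw [h.Δ_spec, h.s_D hF]
  abel

/-- Only the first application of D has invariant arguments; D i F itself is not invariant. What
survives is that the transposition turns D i F into D j F up to a multiple of θᵢ - θⱼ, and such
multiples vanish next to a divided difference of an invariant. -/
lemma Δ_D_mul {F G : A} (hF : F ∈ H) (hG : G ∈ H) (i j : ι) :
    Δ i j (D Δ i F * G) = Δ i j (D Δ i F) * G + D Δ j F * Δ i j G := by
  rw [h.Δ_mul, h.s_D hF, sub_mul, h.θ_mul_Δ hG, sub_zero]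

lemma Δ_mul_D {F G : A} (hF : F ∈ H) (hG : G ∈ H) (i j : ι) :
    Δ i j (F * D Δ i G) = F * Δ i j (D Δ i G) + Δ i j F * D Δ j G := by
  have e : Δ i j (F * D Δ i G) = Δ i j F * D Δ i G + F * Δ i j (D Δ i G) +
      Δ i j F * ((x i - x j) * Δ i j (D Δ i G)) := by
    rw [h.Δ_mul, ← mul_assoc (Δ i j F), ← h.x_sub_comm, h.Δ_spec, sub_mul]
    abel
  rw [e, h.spec_D hG, mul_sub, mul_sub, h.Δ_mul_θ hF]
  abel

/-- `∑ xᵢ Dᵢ²` is a derivation on invariants. -/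
lemma quadratic_mul {F G : A} (hF : F ∈ H) (hG : G ∈ H) :
    ∑ i, x i * D Δ i (D Δ i (F * G)) =
      (∑ i, x i * D Δ i (D Δ i F)) * G + F * ∑ i, x i * D Δ i (D Δ i G) := by
  -- The failure of Dᵢ² to be a derivation is a sum over j. Expanding D j as well makes it the
  -- triple sum of `sum_cyclic_eq_zero` once it is weighted by xᵢ and summed over i.
  have e : ∀ i, D Δ i (D Δ i (F * G)) = D Δ i (D Δ i F) * G + F * D Δ i (D Δ i G) +
      ∑ j, (D Δ j F * Δ i j G + Δ i j F * D Δ j G) := by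
    intro i
    rw [h.D_mul hF hG, map_add]
    conv_lhs => rw [D_apply, D_apply i (F * _)]
    simp only [h.Δ_D_mul hF hG, h.Δ_mul_D hF hG, Finset.sum_add_distrib, ← Finset.sum_mul,
      ← Finset.mul_sum, ← D_apply]
    abel
  have t := sum_cyclic_eq_zero x θ (fun i j => Δ i j F) (fun i j => Δ i j G)
    (fun i j => (c i - c j) F) (fun i j => (c i - c j) G) h.x_comm h.regular h.sandwich
    (h.spec_invariant hF) (h.spec_invariant hG) (fun i j k => by simp) (fun i j k => by simp)
    (fun i => h.Δ_self i F) (fun i => h.Δ_self i G) (fun i j => h.Δ_neg i j F)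
    (fun i j => h.Δ_neg i j G)
  have t' : ∑ i, x i * ∑ j, (D Δ j F * Δ i j G + Δ i j F * D Δ j G) = 0 := by
    rw [← t]
    refine Finset.sum_congr rfl fun i _ => ?_
    rw [Finset.mul_sum]
    refine Finset.sum_congr rfl fun j _ => ?_
    rw [← Finset.mul_sum, Finset.sum_add_distrib, ← Finset.sum_mul, ← Finset.mul_sum, D_apply,
      D_apply]
  simp only [e, mul_add (x _) (_ + _)]
  rw [Finset.sum_add_distrib, t', add_zero]
  simp only [mul_add, Finset.sum_add_distrib]
  rw [Finset.sum_mul, Finset.mul_sum]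
  congr 1
  · exact Finset.sum_congr rfl fun i _ => (mul_assoc _ _ _).symm
  · refine Finset.sum_congr rfl fun i _ => ?_
    rw [← mul_assoc, h.x_comm, mul_assoc]

end

variable (c Δ) in
/-- The contraction with `∑ Dᵢ^N xᵢ*`. -/
def par (N : ℕ) (y : A) : A := ∑ i, c i ((D Δ i ^ N : Module.End ℂ A) y)

section

variable (h : SuperDunkl x θ hat c Δ s H)

include h

lemma hat_D (i : ι) (y : A) : D Δ i (hat y) = hat (D Δ i y) := by
  simp only [D_apply, h.Δ_hat, map_sum]

/-- The D's obey the Leibniz rule on invariants and the contractions obey the odd one, so the only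
obstruction is the mixed sum of hat(Dᵢ F) cᵢ G + cᵢ F Dᵢ G. -/
lemma par_one_mul {F G : A} (hF : F ∈ H) (hG : G ∈ H) :
    par c Δ 1 (F * G) = par c Δ 1 F * G + hat F * par c Δ 1 G := by
  simp only [par, pow_one, h.D_mul hF hG, map_add, h.c_mul, Finset.sum_add_distrib, Finset.sum_mul,
    Finset.mul_sum]
  -- The (i, j) and (j, i) terms together involve only cᵢ - cⱼ. Times xᵢ - xⱼ they become two equal
  -- terms with opposite signs, because moving the odd θᵢ - θⱼ across cF introduces the grade
  -- involution.
  have key : ∑ i, ∑ j, (hat (Δ i j F) * c i G + c i F * Δ i j G) = 0 := by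
    apply sum_of_pairs
    · intro i j hij
      apply h.regular i j hij
      rw [h.Δ_neg i j F, h.Δ_neg i j G, map_neg]
      have e : hat (Δ i j F) * c i G + c i F * Δ i j G + (-hat (Δ i j F) * c j G + c j F * -Δ i j G)
          = hat (Δ i j F) * (c i - c j) G + (c i - c j) F * Δ i j G := by
        rw [LinearMap.sub_apply, LinearMap.sub_apply]
        noncomm_ring
      have hx : (x i - x j) * hat (Δ i j F) = (θ i - θ j) * hat ((c i - c j) F) := by
        have := congrArg hat (h.spec_invariant hF i j)
        rw [map_mul, map_sub, h.hat_x, h.hat_x, map_neg, map_mul, map_sub, h.hat_θ, h.hat_θ] at this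
        rw [this]
        noncomm_ring
      have hθ : ∀ y, y * (θ i - θ j) = (θ i - θ j) * hat y := fun y => by
        rw [mul_sub, sub_mul, h.mul_θ, h.mul_θ]
      rw [e, mul_add, ← mul_assoc, hx, ← mul_assoc, h.x_sub_comm, mul_assoc ((c i - c j) F),
        h.spec_invariant hG, mul_neg, ← mul_assoc, hθ, ← sub_eq_add_neg, sub_self]
    · intro i
      rw [h.Δ_self, h.Δ_self, map_zero]
      simp
  simp only [Finset.sum_add_distrib] at key
  have k2 : ∑ i, hat (D Δ i F) * c i G + ∑ i, c i F * D Δ i G = 0 := by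
    rw [← key]
    congr 1
    · exact Finset.sum_congr rfl fun i _ => by rw [D_apply, map_sum, Finset.sum_mul]
    · exact Finset.sum_congr rfl fun i _ => by rw [D_apply, Finset.mul_sum]
  have : ∀ p q r t : A, q + r = 0 → (p + q) + (r + t) = p + t := by
    intro p q r t e
    rw [add_assoc, ← add_assoc q, e, zero_add]
  exact this _ _ _ _ k2

lemma c_D_pow (i j : ι) (N : ℕ) (y : A) :
    (D Δ i ^ N : Module.End ℂ A) (c j y) = c j ((D Δ i ^ N : Module.End ℂ A) y) := by
  induction N generalizing y with
  | zero => rfl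
  | succ N ih =>
    rw [pow_succ, Module.End.mul_apply, Module.End.mul_apply, ← ih]
    congr 1
    simp only [D_apply, h.Δ_c, map_sum]

/-- The operator cᵢ - cⱼ has square zero and takes the value 2 on θᵢ - θⱼ, so it anti-commutes with
the reflection: applied to sᵢⱼ F it gives the negative of its value on F. -/
lemma c_s {F : A} (hF : F ∈ H) {i j : ι} (hij : i ≠ j) :
    c j (s i j F) - c i (s i j F) = c i F - c j F := by
  have hc : ∀ y, (c i - c j) ((c i - c j) y) = 0 := by
    have h0 : ∀ i y, c i (c i y) = 0 := fun i y => by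
      have := h.c_c i i y
      have h' : (2 : ℂ) • c i (c i y) = 0 := by
        rw [show (2 : ℂ) = 1 + 1 by norm_num, add_smul, one_smul]
        nth_rewrite 1 [this]
        rw [neg_add_cancel]
      exact (smul_eq_zero_iff_right (by norm_num)).1 h'
    intro y
    simp only [LinearMap.sub_apply, map_sub]
    rw [h0, h0, h.c_c i j]
    abel
  have e : (c i - c j) (s i j F) = -((c i - c j) F) := by
    rw [h.invariant F hF, map_sub, h.c_θ i j hij, hc, mul_zero, sub_zero,
      show (2 : ℂ) = 1 + 1 by norm_num, add_smul, one_smul]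
    abel
  rw [← neg_sub (c i (s i j F)), ← LinearMap.sub_apply, e, neg_neg, LinearMap.sub_apply]

variable (hr : DunklRelations (D Δ) (fun i => LinearMap.mulLeft ℂ (x i))
    (fun i j => (s i j).toLinearMap))
  (hD : ∀ i j, Commute (D Δ i : Module.End ℂ A) (D Δ j))
  (hp : ∀ N, 1 ≤ N → ∑ i, (D Δ i ^ N : Module.End ℂ A) = 0)

include hr hD hp

/-- The commutator of the derivation `∑ xᵢ Dᵢ²` with `∂_{-N}` is `n ∂_{-N-1}`. -/
lemma quadratic_par {F : A} (hF : F ∈ H) (N : ℕ) (hN : 1 ≤ N) :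
    ∑ i, x i * D Δ i (D Δ i (par c Δ N F)) - par c Δ N (∑ i, x i * D Δ i (D Δ i F)) =
      (Fintype.card ι : ℂ) • par c Δ (N + 1) F := by
  set Q : Module.End ℂ A := ∑ i, LinearMap.mulLeft ℂ (x i) * D Δ i ^ 2 with hQ
  have hQa : ∀ y, Q y = ∑ i, x i * D Δ i (D Δ i y) := by
    intro y
    rw [hQ, LinearMap.sum_apply]
    exact Finset.sum_congr rfl fun i _ => by
      rw [pow_two, Module.End.mul_apply, Module.End.mul_apply]; rfl
  set Y : ι → ι → Module.End ℂ A := fun i j => (D Δ i + D Δ j) * (D Δ i ^ N - D Δ j ^ N) with hY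
  have hQc : ∀ j y, Q (c j y) = c j (Q y) := by
    intro j y
    rw [hQa, hQa, map_sum]
    refine Finset.sum_congr rfl fun i _ => ?_
    rw [h.c_x]
    congr 1
    have := h.c_D_pow i j 1
    simp only [pow_one] at this
    rw [this, this]
  clear_value Q
  have hYc : ∀ i j k y, Y i j (c k y) = c k (Y i j y) := by
    intro i j k y
    have h1 := h.c_D_pow i k 1
    have h2 := h.c_D_pow j k 1
    simp only [pow_one] at h1 h2
    simp only [hY, Module.End.mul_apply, LinearMap.sub_apply, LinearMap.add_apply, map_sub, h1, h2,
      h.c_D_pow, map_add]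
  have hYs : ∀ i j, Y j i = -Y i j := by
    intro i j
    simp only [hY]
    rw [add_comm (D Δ j), ← neg_sub (D Δ i ^ N)]
    exact LinearMap.ext fun y => map_neg (D Δ i + D Δ j) _
  have hsY : ∀ i j y, s i j (Y i j y) = Y j i (s i j y) := by
    intro i j y
    have e : (s i j).toLinearMap * Y i j = Y j i * (s i j).toLinearMap := by
      have h1 := hr.mul_d_pow i j i
      have h2 := hr.mul_d_pow i j j
      rw [Equiv.swap_apply_left] at h1
      rw [Equiv.swap_apply_right] at h2
      have h1' := h1 1
      have h2' := h2 1
      rw [pow_one, pow_one] at h1' h2'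
      simp only [hY]
      rw [← mul_assoc, mul_add, h1', h2', ← add_mul, mul_assoc, mul_sub, h1, h2, ← sub_mul,
        ← mul_assoc]
    exact LinearMap.congr_fun e y
  rw [← hQa, ← hQa]
  simp only [par, map_sum, ← Finset.sum_sub_distrib, hQc, ← map_sub]
  have e1 : ∀ j, c j (Q ((D Δ j ^ N : Module.End ℂ A) F) - (D Δ j ^ N : Module.End ℂ A) (Q F)) =
      ∑ i ∈ Finset.univ.erase j, Y i j (c j (s i j F)) := by
    intro j
    have := LinearMap.congr_fun (hr.quadratic_commutator hD N j) F
    rw [← hQ, LinearMap.sub_apply, Module.End.mul_apply, Module.End.mul_apply,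
      LinearMap.neg_apply, LinearMap.sum_apply] at this
    rw [this, map_neg, map_sum, ← Finset.sum_neg_distrib]
    refine Finset.sum_congr rfl fun i _ => ?_
    change -c j (s i j (Y i j F)) = _
    rw [hsY, hYs, LinearMap.neg_apply, map_neg, neg_neg, hYc]
  have e2 : ∀ j, ∑ i ∈ Finset.univ.erase j, Y i j (c j (s i j F)) =
      ∑ i, if i = j then 0 else Y i j (c j (s i j F)) := by
    intro j
    rw [← Finset.sum_erase (s := Finset.univ) (a := j) (f := fun i => if i = j then 0 else _)]
    · exact Finset.sum_congr rfl fun i hi => (if_neg (Finset.ne_of_mem_erase hi)).symm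
    · simp
  have hYself : ∀ i, Y i i = 0 := fun i => by simp [hY]
  have hs : ∀ i j, s j i F = s i j F := fun i j => by
    have := LinearMap.congr_fun (hr.comm j i) F
    exact this
  -- Y is antisymmetric in its indices, so in each pair of terms only the difference of cⱼ and cᵢ on
  -- sᵢⱼ F enters, and `c_s` removes the transposition.
  have e3 : ∑ j, ∑ i, ((if i = j then 0 else Y i j (c j (s i j F))) - Y i j (c i F)) = 0 := by
    apply sum_of_pairs
    · intro j i hij
      rw [if_neg (Ne.symm hij), if_neg hij, hYs i j, hs i j, LinearMap.neg_apply,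
        LinearMap.neg_apply]
      have := congrArg (Y i j) (h.c_s hF (Ne.symm hij))
      rw [map_sub, map_sub] at this
      have t : ∀ p q r t : A, p - q = r - t → -q + t + (p - r) = 0 := by
        intro p q r t e
        have : -q + t + (p - r) = (p - q) - (r - t) := by abel
        rw [this, e, sub_self]
      have := t _ _ _ _ this
      rw [← this]
      abel
    · intro i
      rw [if_pos rfl, hYself]
      simp
  simp only [Finset.sum_sub_distrib] at e3
  simp only [e1, e2]
  rw [sub_eq_zero.1 e3, Finset.sum_comm, Finset.smul_sum]
  refine Finset.sum_congr rfl fun i _ => ?_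
  -- Expanding the product and summing over j, every term that contains a power of Dⱼ is a vanishing
  -- power sum; only the one that does not depend on j remains, counted once for each index.
  have e4 : ∑ j, Y i j = (Fintype.card ι : ℂ) • D Δ i ^ (N + 1) := by
    have hY' : ∀ j, Y i j = D Δ i ^ (N + 1) - D Δ i * D Δ j ^ N + D Δ j * D Δ i ^ N -
        D Δ j ^ (N + 1) := by
      intro j
      simp only [hY]
      rw [pow_succ', pow_succ', mul_sub, add_mul, add_mul]
      abel
    simp only [hY', Finset.sum_sub_distrib, Finset.sum_add_distrib, ← Finset.mul_sum,
      ← Finset.sum_mul, hp N hN, hp (N + 1) (by omega)]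
    have h1 := hp 1 le_rfl
    simp only [pow_one] at h1
    rw [h1, Finset.sum_const, Finset.card_univ, ← Nat.cast_smul_eq_nsmul ℂ]
    simp
  simp only [hYc, ← map_sum, ← LinearMap.sum_apply, e4]
  rw [LinearMap.smul_apply, map_smul]

/-- The contraction `∂_{-N}` is an odd derivation on invariants. -/
lemma par_mul [Nonempty ι] (hQm : ∀ F ∈ H, ∑ i, x i * D Δ i (D Δ i F) ∈ H)
    (hpm : ∀ N, ∀ F ∈ H, par c Δ N F ∈ H) (N : ℕ) (hN : 1 ≤ N) {F G : A} (hF : F ∈ H)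
    (hG : G ∈ H) :
    par c Δ N (F * G) = par c Δ N F * G + hat F * par c Δ N G := by
  induction N, hN using Nat.le_induction generalizing F G with
  | base => exact h.par_one_mul hF hG
  | succ N hN ih =>
    have hcard : (Fintype.card ι : ℂ) ≠ 0 := by exact_mod_cast Fintype.card_ne_zero
    have hpadd : ∀ y z, par c Δ N (y + z) = par c Δ N y + par c Δ N z := fun y z => by
      simp only [par, map_add, Finset.sum_add_distrib]
    have hh : hat (∑ i, x i * D Δ i (D Δ i F)) = ∑ i, x i * D Δ i (D Δ i (hat F)) := by
      simp only [map_sum, map_mul, h.hat_x, h.hat_D]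
    -- Both sides are multiplied by n. Then n ∂_{-N-1} is the commutator of the derivation Q with
    -- the odd derivation ∂_{-N}, and such a commutator obeys the odd Leibniz rule.
    have hFh := h.hat_mem F hF
    apply smul_right_injective A hcard
    change (_ : ℂ) • _ = (_ : ℂ) • _
    rw [smul_add, ← smul_mul_assoc, ← mul_smul_comm, ← h.quadratic_par hr hD hp (mul_mem hF hG) N hN,
      ← h.quadratic_par hr hD hp hF N hN, ← h.quadratic_par hr hD hp hG N hN, ih hF hG,
      h.quadratic_mul hF hG, hpadd, ih (hQm F hF) hG, ih hF (hQm G hG), hh]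
    simp only [map_add, mul_add, Finset.sum_add_distrib]
    rw [h.quadratic_mul (hpm N F hF) hG, h.quadratic_mul hFh (hpm N G hG)]
    noncomm_ring

end

end SuperDunkl

end Super

/-! ## Polynomial forms -/

noncomputable section

open CliffordAlgebra (contractLeft involute)

/-- A polynomial, as a form of degree zero. -/
def scal (n : ℕ) : polyRep n →ₐ[ℂ] Forms n := Algebra.TensorProduct.includeRight

/-- A constant one-form. -/
def oneForm (n : ℕ) (v : cartan n) : Forms n := ExteriorAlgebra.ι ℂ v ⊗ₜ 1

/-- The grade involution of forms. -/
def hat (n : ℕ) : Forms n →ₐ[ℂ] Forms n :=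
  Algebra.TensorProduct.map (involute : ExteriorAlgebra ℂ (cartan n) →ₐ[ℂ] _) (AlgHom.id ℂ (polyRep n))

/-- The contraction of forms with a functional on `cartan n`. -/
def ctr (n : ℕ) (d : Module.Dual ℂ (cartan n)) : Forms n →ₗ[ℂ] Forms n :=
  LinearMap.rTensor (polyRep n) (contractLeft d)

/-- An operator on polynomials, acting on the coefficients of forms. -/
def onCoeff (n : ℕ) (T : Module.End ℂ (polyRep n)) : Forms n →ₗ[ℂ] Forms n :=
  LinearMap.lTensor (ExteriorAlgebra ℂ (cartan n)) T

/-- The permutation action on the coefficients of forms. -/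
def permCoeff (n : ℕ) (σ : Equiv.Perm (Fin n)) : Forms n →ₐ[ℂ] Forms n :=
  Algebra.TensorProduct.map (AlgHom.id ℂ _) (permPoly n σ)

/-- The permutation action on the exterior part of forms. -/
def permExt (n : ℕ) (σ : Equiv.Perm (Fin n)) : Forms n →ₐ[ℂ] Forms n :=
  Algebra.TensorProduct.map (ExteriorAlgebra.map (permCartan n σ)) (AlgHom.id ℂ _)

end

lemma scal_apply (n : ℕ) (p : polyRep n) : scal n p = 1 ⊗ₜ p := rfl

lemma scal_mul_tmul (n : ℕ) (p : polyRep n) (a : ExteriorAlgebra ℂ (cartan n)) (q : polyRep n) :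
    scal n p * a ⊗ₜ q = a ⊗ₜ (p * q) := by
  rw [scal_apply, Algebra.TensorProduct.tmul_mul_tmul, one_mul]

lemma tmul_mul_scal (n : ℕ) (p : polyRep n) (a : ExteriorAlgebra ℂ (cartan n)) (q : polyRep n) :
    a ⊗ₜ q * scal n p = a ⊗ₜ (p * q) := by
  rw [scal_apply, Algebra.TensorProduct.tmul_mul_tmul, mul_one, mul_comm]

lemma oneForm_mul_tmul (n : ℕ) (v : cartan n) (a : ExteriorAlgebra ℂ (cartan n)) (q : polyRep n) :
    oneForm n v * a ⊗ₜ q = (ExteriorAlgebra.ι ℂ v * a) ⊗ₜ q := by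
  rw [oneForm, Algebra.TensorProduct.tmul_mul_tmul, one_mul]

lemma tmul_mul_oneForm (n : ℕ) (v : cartan n) (a : ExteriorAlgebra ℂ (cartan n)) (q : polyRep n) :
    a ⊗ₜ q * oneForm n v = (a * ExteriorAlgebra.ι ℂ v) ⊗ₜ q := by
  rw [oneForm, Algebra.TensorProduct.tmul_mul_tmul, mul_one]

lemma hat_tmul (n : ℕ) (a : ExteriorAlgebra ℂ (cartan n)) (q : polyRep n) :
    hat n (a ⊗ₜ q) = CliffordAlgebra.involute a ⊗ₜ q := rfl

lemma ctr_tmul (n : ℕ) (d : Module.Dual ℂ (cartan n)) (a : ExteriorAlgebra ℂ (cartan n))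
    (q : polyRep n) : ctr n d (a ⊗ₜ q) = CliffordAlgebra.contractLeft d a ⊗ₜ q := rfl

lemma onCoeff_tmul (n : ℕ) (T : Module.End ℂ (polyRep n)) (a : ExteriorAlgebra ℂ (cartan n))
    (q : polyRep n) : onCoeff n T (a ⊗ₜ q) = a ⊗ₜ T q := rfl

lemma permCoeff_tmul (n : ℕ) (σ : Equiv.Perm (Fin n)) (a : ExteriorAlgebra ℂ (cartan n))
    (q : polyRep n) : permCoeff n σ (a ⊗ₜ q) = a ⊗ₜ permPoly n σ q := rfl

lemma permExt_tmul (n : ℕ) (σ : Equiv.Perm (Fin n)) (a : ExteriorAlgebra ℂ (cartan n))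
    (q : polyRep n) : permExt n σ (a ⊗ₜ q) = ExteriorAlgebra.map (permCartan n σ) a ⊗ₜ q := rfl

lemma permForms_tmul (n : ℕ) (σ : Equiv.Perm (Fin n)) (a : ExteriorAlgebra ℂ (cartan n))
    (q : polyRep n) :
    permForms n σ (a ⊗ₜ q) = ExteriorAlgebra.map (permCartan n σ) a ⊗ₜ permPoly n σ q := rfl

lemma onCoeff_sub (n : ℕ) (S T : Module.End ℂ (polyRep n)) (y : Forms n) :
    onCoeff n (S - T) y = onCoeff n S y - onCoeff n T y := by
  rw [onCoeff, LinearMap.lTensor_sub]; rfl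

lemma onCoeff_neg (n : ℕ) (T : Module.End ℂ (polyRep n)) (y : Forms n) :
    onCoeff n (-T) y = -onCoeff n T y := by
  rw [onCoeff, LinearMap.lTensor_neg]; rfl

lemma onCoeff_mul (n : ℕ) (S T : Module.End ℂ (polyRep n)) (y : Forms n) :
    onCoeff n (S * T) y = onCoeff n S (onCoeff n T y) :=
  LinearMap.lTensor_comp_apply _ _ _ _

lemma onCoeff_sum (n : ℕ) {ι : Type*} (s : Finset ι) (T : ι → Module.End ℂ (polyRep n)) (y : Forms n) :
    onCoeff n (∑ i ∈ s, T i) y = ∑ i ∈ s, onCoeff n (T i) y := by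
  induction y using TensorProduct.induction_on with
  | zero => simp
  | tmul a p => simp only [onCoeff_tmul, LinearMap.sum_apply, TensorProduct.tmul_sum]
  | add y z hy hz => simp only [map_add, hy, hz, Finset.sum_add_distrib]

lemma onCoeff_pow (n : ℕ) (T : Module.End ℂ (polyRep n)) (N : ℕ) (y : Forms n) :
    onCoeff n (T ^ N) y = ((onCoeff n T : Module.End ℂ (Forms n)) ^ N) y := by
  induction N generalizing y with
  | zero => exact LinearMap.congr_fun (LinearMap.lTensor_id _ _) y
  | succ N ih => rw [pow_succ, onCoeff_mul, ih, pow_succ]; rfl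

lemma onCoeff_mulLeft (n : ℕ) (p : polyRep n) (y : Forms n) :
    onCoeff n (LinearMap.mulLeft ℂ p) y = scal n p * y := by
  induction y using TensorProduct.induction_on with
  | zero => simp
  | tmul a q => rw [onCoeff_tmul, scal_mul_tmul]; rfl
  | add y z hy hz => simp only [map_add, hy, hz, mul_add]

lemma onCoeff_permPoly (n : ℕ) (σ : Equiv.Perm (Fin n)) (y : Forms n) :
    onCoeff n (permPoly n σ).toLinearMap y = permCoeff n σ y := by
  induction y using TensorProduct.induction_on with
  | zero => simp
  | tmul a q => rfl
  | add y z hy hz => simp only [map_add, hy, hz]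

lemma scal_comm (n : ℕ) (p : polyRep n) (y : Forms n) : scal n p * y = y * scal n p := by
  induction y using TensorProduct.induction_on with
  | zero => simp
  | tmul a q => rw [scal_mul_tmul, tmul_mul_scal]
  | add y z hy hz => simp only [mul_add, add_mul, hy, hz]

/-- Multiplication by p is injective on the domain L, and tensoring with the flat ℂ-module of
exterior forms preserves injectivity. -/
lemma scal_mul_eq_zero (n : ℕ) {p : polyRep n} (hp : p ≠ 0) {y : Forms n} (h : scal n p * y = 0) :
    y = 0 := by
  rw [← onCoeff_mulLeft] at h
  have inj : Function.Injective (LinearMap.mulLeft ℂ p) := fun a b e => mul_left_cancel₀ hp e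
  have := Module.Flat.lTensor_preserves_injective_linearMap
    (M := ExteriorAlgebra ℂ (cartan n)) (LinearMap.mulLeft ℂ p) inj
  apply this
  rw [map_zero]
  exact h

lemma oneForm_sandwich (n : ℕ) (v : cartan n) (y : Forms n) :
    oneForm n v * y * oneForm n v = 0 := by
  induction y using TensorProduct.induction_on with
  | zero => simp
  | tmul a q => rw [oneForm_mul_tmul, tmul_mul_oneForm, ι_mul_mul_ι, TensorProduct.zero_tmul]
  | add y z hy hz => simp only [mul_add, add_mul, hy, hz, add_zero]

lemma oneForm_sub (n : ℕ) (v w : cartan n) : oneForm n (v - w) = oneForm n v - oneForm n w := by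
  rw [oneForm, map_sub, TensorProduct.sub_tmul]; rfl

lemma oneForm_smul (n : ℕ) (c : ℂ) (v : cartan n) : oneForm n (c • v) = c • oneForm n v := by
  rw [oneForm, map_smul, ← TensorProduct.smul_tmul']; rfl

lemma mul_oneForm (n : ℕ) (v : cartan n) (y : Forms n) :
    y * oneForm n v = oneForm n v * hat n y := by
  induction y using TensorProduct.induction_on with
  | zero => simp
  | tmul a q => rw [tmul_mul_oneForm, hat_tmul, oneForm_mul_tmul, mul_ι_eq]
  | add y z hy hz => simp only [mul_add, add_mul, map_add, hy, hz]

lemma hat_oneForm (n : ℕ) (v : cartan n) : hat n (oneForm n v) = -oneForm n v := by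
  rw [oneForm, hat_tmul, involute_ι, TensorProduct.neg_tmul]

lemma hat_scal (n : ℕ) (p : polyRep n) : hat n (scal n p) = scal n p := by
  rw [scal_apply, hat_tmul, map_one]

lemma onCoeff_oneForm_mul (n : ℕ) (T : Module.End ℂ (polyRep n)) (v : cartan n) (y : Forms n) :
    onCoeff n T (oneForm n v * y) = oneForm n v * onCoeff n T y := by
  induction y using TensorProduct.induction_on with
  | zero => simp
  | tmul a q => simp only [oneForm_mul_tmul, onCoeff_tmul]
  | add y z hy hz => simp only [mul_add, map_add, hy, hz]

lemma onCoeff_ctr (n : ℕ) (T : Module.End ℂ (polyRep n)) (d : Module.Dual ℂ (cartan n))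
    (y : Forms n) : onCoeff n T (ctr n d y) = ctr n d (onCoeff n T y) := by
  induction y using TensorProduct.induction_on with
  | zero => simp
  | tmul a q => rfl
  | add y z hy hz => simp only [map_add, hy, hz]

lemma onCoeff_hat (n : ℕ) (T : Module.End ℂ (polyRep n)) (y : Forms n) :
    onCoeff n T (hat n y) = hat n (onCoeff n T y) := by
  induction y using TensorProduct.induction_on with
  | zero => simp
  | tmul a q => rfl
  | add y z hy hz => simp only [map_add, hy, hz]

lemma ctr_mul (n : ℕ) (d : Module.Dual ℂ (cartan n)) (y z : Forms n) :
    ctr n d (y * z) = ctr n d y * z + hat n y * ctr n d z := by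
  induction y using TensorProduct.induction_on with
  | zero => simp
  | add y y' hy hy' => simp only [add_mul, map_add, hy, hy']; abel
  | tmul a p =>
    induction z using TensorProduct.induction_on with
    | zero => simp
    | add z z' hz hz' => simp only [mul_add, map_add, hz, hz']; abel
    | tmul b q =>
      simp only [Algebra.TensorProduct.tmul_mul_tmul, ctr_tmul, hat_tmul, contractLeft_mul,
        TensorProduct.add_tmul]

lemma ctr_scal_mul (n : ℕ) (d : Module.Dual ℂ (cartan n)) (p : polyRep n) (y : Forms n) :
    ctr n d (scal n p * y) = scal n p * ctr n d y := by
  rw [← onCoeff_mulLeft, ← onCoeff_mulLeft, onCoeff_ctr]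

lemma ctr_scal (n : ℕ) (d : Module.Dual ℂ (cartan n)) (p : polyRep n) :
    ctr n d (scal n p) = 0 := by
  rw [scal_apply, ctr_tmul, CliffordAlgebra.contractLeft_one, TensorProduct.zero_tmul]

lemma ctr_oneForm_mul (n : ℕ) (d : Module.Dual ℂ (cartan n)) (v : cartan n) (y : Forms n) :
    ctr n d (oneForm n v * y) = d v • y - oneForm n v * ctr n d y := by
  induction y using TensorProduct.induction_on with
  | zero => simp
  | tmul a q =>
    rw [oneForm_mul_tmul, ctr_tmul, contractLeft_ι_mul', TensorProduct.sub_tmul, ctr_tmul,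
      oneForm_mul_tmul, TensorProduct.smul_tmul']
  | add y z hy hz => simp only [mul_add, map_add, hy, hz, smul_add]; abel

lemma ctr_sub (n : ℕ) (d d' : Module.Dual ℂ (cartan n)) (y : Forms n) :
    ctr n (d - d') y = ctr n d y - ctr n d' y := by
  rw [ctr, map_sub, LinearMap.rTensor_sub]; rfl

lemma ctr_anticomm (n : ℕ) (d d' : Module.Dual ℂ (cartan n)) (y : Forms n) :
    ctr n d (ctr n d' y) = -ctr n d' (ctr n d y) := by
  induction y using TensorProduct.induction_on with
  | zero => simp
  | tmul a q =>
    rw [ctr_tmul, ctr_tmul, CliffordAlgebra.contractLeft_comm, TensorProduct.neg_tmul]; rfl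
  | add y z hy hz => simp only [map_add, hy, hz, neg_add]

/-! ### Permutations of forms -/

lemma permForms_eq (n : ℕ) (σ : Equiv.Perm (Fin n)) (y : Forms n) :
    permForms n σ y = permExt n σ (permCoeff n σ y) := by
  induction y using TensorProduct.induction_on with
  | zero => simp
  | tmul a q => rfl
  | add y z hy hz => simp only [map_add, hy, hz]

lemma permExt_swap (n : ℕ) {i j : Fin n} (h : i ≠ j) (y : Forms n) :
    permExt n (Equiv.swap i j) y =
      y - oneForm n (basisProj n i - basisProj n j) * ctr n (coord n i - coord n j) y := by
  induction y using TensorProduct.induction_on with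
  | zero => simp
  | tmul a q =>
    rw [permExt_tmul, map_reflection _ _ _ (permCartan_swap n h), TensorProduct.sub_tmul, ctr_tmul,
      oneForm_mul_tmul]
  | add y z hy hz => simp only [map_add, hy, hz, mul_add]; abel

lemma map_permCartan_mul (n : ℕ) (σ τ : Equiv.Perm (Fin n)) (a : ExteriorAlgebra ℂ (cartan n)) :
    ExteriorAlgebra.map (permCartan n σ) (ExteriorAlgebra.map (permCartan n τ) a) =
      ExteriorAlgebra.map (permCartan n (σ * τ)) a := by
  rw [← AlgHom.comp_apply, ExteriorAlgebra.map_comp_map]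
  rfl

lemma map_permCartan_one (n : ℕ) (a : ExteriorAlgebra ℂ (cartan n)) :
    ExteriorAlgebra.map (permCartan n 1) a = a := by
  have : permCartan n 1 = LinearMap.id := rfl
  rw [this, ExteriorAlgebra.map_id]
  rfl

lemma permForms_mul (n : ℕ) (σ τ : Equiv.Perm (Fin n)) (y : Forms n) :
    permForms n σ (permForms n τ y) = permForms n (σ * τ) y := by
  induction y using TensorProduct.induction_on with
  | zero => simp
  | tmul a q => simp only [permForms_tmul, map_permCartan_mul, permPoly_permPoly]
  | add y z hy hz => simp only [map_add, hy, hz]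

lemma permExt_swap_swap (n : ℕ) (i j : Fin n) (y : Forms n) :
    permExt n (Equiv.swap i j) (permExt n (Equiv.swap i j) y) = y := by
  induction y using TensorProduct.induction_on with
  | zero => simp
  | tmul a q => rw [permExt_tmul, permExt_tmul, map_permCartan_mul, Equiv.swap_mul_self,
      map_permCartan_one]
  | add y z hy hz => simp only [map_add, hy, hz]

lemma permExt_refl (n : ℕ) (y : Forms n) : permExt n (Equiv.refl _) y = y := by
  induction y using TensorProduct.induction_on with
  | zero => simp
  | tmul a q => rw [permExt_tmul]; congr 1; exact map_permCartan_one n a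
  | add y z hy hz => simp only [map_add, hy, hz]

lemma mem_stableH (n : ℕ) (y : Forms n) : y ∈ stableH n ↔ ∀ σ, permForms n σ y = y := by
  rw [stableH, Algebra.mem_iInf]
  rfl

lemma permForms_hat (n : ℕ) (σ : Equiv.Perm (Fin n)) (y : Forms n) :
    permForms n σ (hat n y) = hat n (permForms n σ y) := by
  induction y using TensorProduct.induction_on with
  | zero => simp
  | tmul a q => rw [hat_tmul, permForms_tmul, map_involute, permForms_tmul, hat_tmul]
  | add y z hy hz => simp only [map_add, hy, hz]

lemma permForms_ctr (n : ℕ) (σ : Equiv.Perm (Fin n)) (i : Fin n) (y : Forms n) :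
    permForms n σ (ctr n (coord n i) y) = ctr n (coord n (σ i)) (permForms n σ y) := by
  induction y using TensorProduct.induction_on with
  | zero => simp
  | tmul a q => rw [ctr_tmul, permForms_tmul,
      map_contractLeft _ _ (coord n (σ i)) (coord_permCartan n σ i), permForms_tmul, ctr_tmul]
  | add y z hy hz => simp only [map_add, hy, hz]

lemma permForms_onCoeff (n : ℕ) (σ : Equiv.Perm (Fin n)) (S T : Module.End ℂ (polyRep n))
    (h : ∀ p, permPoly n σ (S p) = T (permPoly n σ p)) (y : Forms n) :
    permForms n σ (onCoeff n S y) = onCoeff n T (permForms n σ y) := by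
  induction y using TensorProduct.induction_on with
  | zero => simp
  | tmul a q => rw [onCoeff_tmul, permForms_tmul, h, permForms_tmul, onCoeff_tmul]
  | add y z hy hz => simp only [map_add, hy, hz]

/-- On an invariant form the action on coefficients is inverse to the action on the exterior factor,
and a transposition is its own inverse. It turns divided differences of coefficients into exterior
algebra. -/
lemma permCoeff_of_mem (n : ℕ) {y : Forms n} (hy : y ∈ stableH n) (i j : Fin n) :
    permCoeff n (Equiv.swap i j) y = permExt n (Equiv.swap i j) y := by
  have := (mem_stableH n y).1 hy (Equiv.swap i j)
  rw [permForms_eq] at this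
  conv_rhs => rw [← this]
  rw [permExt_swap_swap]

lemma onCoeff_dd_mul (n : ℕ) (i j : Fin n) (y z : Forms n) :
    onCoeff n (dd n i j) (y * z) = onCoeff n (dd n i j) y * z +
      permCoeff n (Equiv.swap i j) y * onCoeff n (dd n i j) z := by
  induction y using TensorProduct.induction_on with
  | zero => simp
  | add y y' hy hy' => simp only [add_mul, map_add, hy, hy']; abel
  | tmul a p =>
    induction z using TensorProduct.induction_on with
    | zero => simp
    | add z z' hz hz' => simp only [mul_add, map_add, hz, hz']; abel
    | tmul b q =>
      simp only [Algebra.TensorProduct.tmul_mul_tmul, onCoeff_tmul, permCoeff_tmul, dd_mul,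
        TensorProduct.tmul_add]

lemma onCoeff_dd_spec (n : ℕ) (i j : Fin n) (y : Forms n) :
    scal n (xTilde n i - xTilde n j) * onCoeff n (dd n i j) y =
      permCoeff n (Equiv.swap i j) y - y := by
  rw [← xDiff_eq]
  induction y using TensorProduct.induction_on with
  | zero => simp
  | tmul a q => rw [onCoeff_tmul, scal_mul_tmul, dd_spec, TensorProduct.tmul_sub]; rfl
  | add y z hy hz => simp only [map_add, mul_add, hy, hz]; abel

lemma permCoeff_onCoeff_dd (n : ℕ) (i j k : Fin n) (y : Forms n) :
    permCoeff n (Equiv.swap i j) (onCoeff n (dd n i k) y) =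
      onCoeff n (dd n j (Equiv.swap i j k)) (permCoeff n (Equiv.swap i j) y) := by
  induction y using TensorProduct.induction_on with
  | zero => simp
  | tmul a q => rw [onCoeff_tmul, permCoeff_tmul, permPoly_dd, Equiv.swap_apply_left]; rfl
  | add y z hy hz => simp only [map_add, hy, hz]

lemma ctr_oneForm_mul_swap (n : ℕ) {i j : Fin n} (h : i ≠ j) (y : Forms n) :
    (ctr n (coord n i) - ctr n (coord n j))
        ((oneForm n (basisProj n i) - oneForm n (basisProj n j)) * y) =
      (2 : ℂ) • y - (oneForm n (basisProj n i) - oneForm n (basisProj n j)) *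
        (ctr n (coord n i) - ctr n (coord n j)) y := by
  rw [LinearMap.sub_apply, LinearMap.sub_apply, ← ctr_sub, ← ctr_sub, ← oneForm_sub,
    ctr_oneForm_mul]
  congr 2
  rw [map_sub, LinearMap.sub_apply, LinearMap.sub_apply, coord_basisProj, coord_basisProj,
    coord_basisProj, coord_basisProj, if_pos rfl, if_pos rfl, if_neg h, if_neg (Ne.symm h)]
  ring

theorem superDunkl (n : ℕ) : SuperDunkl (fun i => scal n (xTilde n i))
    (fun i => oneForm n (basisProj n i)) (hat n) (fun i => ctr n (coord n i))
    (fun i j => onCoeff n (dd n i j)) (fun i j => permCoeff n (Equiv.swap i j)) (stableH n) where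
  x_comm i y := scal_comm n _ y
  regular i j h y hy := by
    rw [← map_sub, ← xDiff_eq] at hy
    exact scal_mul_eq_zero n (xDiff_ne_zero n h) hy
  sandwich i j y := by
    rw [← oneForm_sub]
    exact oneForm_sandwich n _ y
  mul_θ i y := mul_oneForm n _ y
  hat_θ i := hat_oneForm n _
  hat_x i := hat_scal n _
  Δ_self i y := by
    have : dd n i i = 0 := LinearMap.ext (dd_self n i)
    rw [this, onCoeff, LinearMap.lTensor_zero]; rfl
  Δ_spec i j y := by
    rw [← map_sub]
    exact onCoeff_dd_spec n i j y
  Δ_neg i j y := by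
    have : dd n j i = -dd n i j := LinearMap.ext (dd_swap n i j)
    rw [this, onCoeff_neg]
  Δ_mul i j y z := onCoeff_dd_mul n i j y z
  Δ_θ i j k y := onCoeff_oneForm_mul n _ _ y
  Δ_c i j k y := onCoeff_ctr n _ _ y
  Δ_hat i j y := onCoeff_hat n _ y
  s_Δ i j k y := permCoeff_onCoeff_dd n i j k y
  c_mul i y z := ctr_mul n _ y z
  c_x i j y := ctr_scal_mul n _ _ y
  c_θ i j h y := ctr_oneForm_mul_swap n h y
  c_c i j y := ctr_anticomm n _ _ y
  invariant F hF i j := by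
    rw [permCoeff_of_mem n hF, ← oneForm_sub, LinearMap.sub_apply, ← ctr_sub]
    by_cases h : i = j
    · subst h
      rw [Equiv.swap_self, sub_self, sub_self]
      have e : oneForm n 0 = 0 := by rw [oneForm, map_zero, TensorProduct.zero_tmul]
      rw [e]
      rw [permExt_refl]
      simp
    · exact permExt_swap n h F
  hat_mem F hF := by
    rw [mem_stableH] at hF ⊢
    intro σ
    rw [permForms_hat, hF]

/-! ## The contractions -/

lemma D_eq (n : ℕ) (i : Fin n) :
    SuperDunkl.D (fun i j => onCoeff n (dd n i j)) i = onCoeff n (dunkl n i) := by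
  refine LinearMap.ext fun y => ?_
  have : dunkl n i = ∑ j, dd n i j := LinearMap.ext fun p => by
    rw [dunkl_apply, LinearMap.sum_apply]
  rw [this, onCoeff_sum]
  exact SuperDunkl.D_apply _ _

lemma sum_indicator_sub_smul {ι M : Type*} [Fintype ι] [DecidableEq ι] [AddCommGroup M]
    [Module ℂ M] (f : ι → M) (i : ι) (c : ℂ) :
    ∑ j, ((if j = i then 1 else 0) - c) • f j = f i - c • ∑ j, f j := by
  simp [sub_smul, Finset.smul_sum]

/-- The value at eᵢ is f i minus the mean of the f's. The mean drops out because the coordinate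
functionals sum to zero on 𝔥, so the projection to 𝔥 can be forgotten. -/
lemma sum_basisProj_alpha (n : ℕ) (f : Fin n → Module.End ℂ (polyRep n)) (y : Forms n) :
    (∑ i, TensorProduct.map (CliffordAlgebra.contractLeft (coord n i))
      ((∑ j, (coord n j).smulRight (f j) : cartan n →ₗ[ℂ] Module.End ℂ (polyRep n))
        (basisProj n i)) : Module.End ℂ (Forms n)) y =
      ∑ i, ctr n (coord n i) (onCoeff n (f i) y) := by
  have e : ∀ i, (∑ j, (coord n j).smulRight (f j) : cartan n →ₗ[ℂ] Module.End ℂ (polyRep n))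
      (basisProj n i) = f i - (n : ℂ)⁻¹ • ∑ j, f j := by
    intro i
    rw [LinearMap.sum_apply]
    refine (Finset.sum_congr rfl fun j _ => ?_).trans
      (sum_indicator_sub_smul (M := Module.End ℂ (polyRep n)) f i (n : ℂ)⁻¹)
    rw [LinearMap.smulRight_apply, coord_basisProj]
  simp only [e]
  have h0 : ∀ z : Forms n, ∑ i, ctr n (coord n i) z = 0 := by
    intro z
    induction z using TensorProduct.induction_on with
    | zero => simp
    | tmul a q =>
      simp only [ctr_tmul, ← TensorProduct.sum_tmul, ← LinearMap.sum_apply, ← map_sum, sum_coord,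
        map_zero]
      simp
    | add y z hy hz => simp only [map_add, Finset.sum_add_distrib, hy, hz, add_zero]
  have e2 : ∀ i, TensorProduct.map (CliffordAlgebra.contractLeft (coord n i))
      (f i - (n : ℂ)⁻¹ • ∑ j, f j) y = ctr n (coord n i) (onCoeff n (f i) y) -
        ctr n (coord n i) (onCoeff n ((n : ℂ)⁻¹ • ∑ j, f j) y) := by
    intro i
    rw [← map_sub, ← onCoeff_sub]
    induction y using TensorProduct.induction_on with
    | zero => simp
    | tmul a q => rfl
    | add y z hy hz => simp only [map_add, hy, hz]
  rw [LinearMap.sum_apply]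
  refine (Finset.sum_congr rfl fun i _ => e2 i).trans ?_
  rw [Finset.sum_sub_distrib, h0, sub_zero]

lemma partialNeg_apply (n N : ℕ) (y : Forms n) :
    partialNeg n N y = ∑ i, ctr n (coord n i) (onCoeff n (dunkl n i ^ N) y) :=
  sum_basisProj_alpha n (fun i => dunkl n i ^ N) y

lemma partialPos_apply (n N : ℕ) (y : Forms n) :
    partialPos n N y = ∑ i, scal n (xTilde n i ^ N) * ctr n (coord n i) y := by
  refine (sum_basisProj_alpha n (fun i => LinearMap.mulLeft ℂ (xTilde n i ^ N)) y).trans ?_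
  exact Finset.sum_congr rfl fun i _ => by rw [onCoeff_mulLeft, ctr_scal_mul]

lemma partialNeg_eq_par (n N : ℕ) (y : Forms n) :
    partialNeg n N y =
      SuperDunkl.par (fun i => ctr n (coord n i)) (fun i j => onCoeff n (dd n i j)) N y := by
  rw [partialNeg_apply, SuperDunkl.par]
  exact Finset.sum_congr rfl fun i _ => by rw [D_eq, onCoeff_pow]

lemma partialNeg_mem (n N : ℕ) {y : Forms n} (hy : y ∈ stableH n) :
    partialNeg n N y ∈ stableH n := by
  rw [mem_stableH] at hy ⊢
  intro σ
  rw [partialNeg_apply, map_sum]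
  have e : ∀ i, permForms n σ (ctr n (coord n i) (onCoeff n (dunkl n i ^ N) y)) =
      ctr n (coord n (σ i)) (onCoeff n (dunkl n (σ i) ^ N) y) := by
    intro i
    rw [permForms_ctr, permForms_onCoeff n σ _ (dunkl n (σ i) ^ N), hy]
    intro p
    induction N with
    | zero => rfl
    | succ N ih => rw [pow_succ', pow_succ', Module.End.mul_apply, permPoly_dunkl, ih]; rfl
  simp only [e]
  exact Equiv.sum_comp σ (fun i => ctr n (coord n i) (onCoeff n (dunkl n i ^ N) y))

lemma partialPos_mem (n N : ℕ) {y : Forms n} (hy : y ∈ stableH n) :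
    partialPos n N y ∈ stableH n := by
  rw [mem_stableH] at hy ⊢
  intro σ
  rw [partialPos_apply, map_sum]
  have e : ∀ i, permForms n σ (scal n (xTilde n i ^ N) * ctr n (coord n i) y) =
      scal n (xTilde n (σ i) ^ N) * ctr n (coord n (σ i)) y := by
    intro i
    rw [map_mul, permForms_ctr, hy]
    congr 1
    rw [scal_apply, permForms_tmul, map_one, map_pow, permPoly_xTilde]
    rfl
  simp only [e]
  exact Equiv.sum_comp σ (fun i => scal n (xTilde n i ^ N) * ctr n (coord n i) y)

lemma partialPos_mul (n N : ℕ) (y z : Forms n) :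
    partialPos n N (y * z) = partialPos n N y * z + hat n y * partialPos n N z := by
  simp only [partialPos_apply, ctr_mul, mul_add, Finset.sum_add_distrib, Finset.sum_mul,
    Finset.mul_sum]
  congr 1
  · exact Finset.sum_congr rfl fun i _ => (mul_assoc _ _ _).symm
  · exact Finset.sum_congr rfl fun i _ => by rw [← mul_assoc, scal_comm, mul_assoc]

lemma partialPos_scal (n N : ℕ) (p : polyRep n) : partialPos n N (scal n p) = 0 := by
  rw [partialPos_apply]
  exact Finset.sum_eq_zero fun i _ => by rw [ctr_scal, mul_zero]

/-- On invariant forms the contraction `∂_{-N}` is an odd derivation. -/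
theorem partialNeg_mul (n : ℕ) (hn : 1 ≤ n) (N : ℕ) (hN : 1 ≤ N) {y z : Forms n}
    (hy : y ∈ stableH n) (hz : z ∈ stableH n) :
    partialNeg n N (y * z) = partialNeg n N y * z + hat n y * partialNeg n N z := by
  have : Nonempty (Fin n) := ⟨⟨0, hn⟩⟩
  simp only [partialNeg_eq_par]
  have toEnd : ∀ S T U : Module.End ℂ (polyRep n), S * T - T * S = U → ∀ y,
      onCoeff n S (onCoeff n T y) - onCoeff n T (onCoeff n S y) = onCoeff n U y := by
    rintro S T _ rfl y
    rw [onCoeff_sub, onCoeff_mul, onCoeff_mul]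
  have rel := dunkl_relations n
  refine (superDunkl n).par_mul ?_ ?_ ?_ ?_ ?_ N hN hy hz
  · refine ⟨fun i k h => ?_, fun i => ?_, fun i j => ?_, fun i j k => ?_⟩
    · refine LinearMap.ext fun y => ?_
      have := toEnd _ _ _ (rel.of_ne i k h) y
      rw [D_eq]
      simp only [mulX, onCoeff_mulLeft] at this
      exact this.trans (onCoeff_permPoly n _ y)
    · refine LinearMap.ext fun y => ?_
      have := toEnd _ _ _ (rel.self i) y
      rw [D_eq]
      simp only [mulX, onCoeff_mulLeft] at this
      refine this.trans ?_
      rw [onCoeff_neg, onCoeff_sum, LinearMap.neg_apply, LinearMap.sum_apply]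
      congr 1
    · rw [Equiv.swap_comm]
    · refine LinearMap.ext fun y => ?_
      have := congrArg (fun T => onCoeff n T y) (rel.mul_d i j k)
      simp only [onCoeff_mul, swapEnd, onCoeff_permPoly] at this
      rw [D_eq, D_eq]
      exact this
  · intro i j
    rw [D_eq, D_eq]
    refine LinearMap.ext fun y => ?_
    have := congrArg (fun T => onCoeff n T y) (dunkl_commute n i j).eq
    simp only [onCoeff_mul] at this
    exact this
  · intro M hM
    refine LinearMap.ext fun y => ?_
    have := congrArg (fun T => onCoeff n T y) (sum_dunkl_pow n M hM)
    simp only [onCoeff_sum, onCoeff_pow] at this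
    rw [LinearMap.sum_apply]
    simp only [D_eq]
    refine this.trans ?_
    rw [onCoeff, LinearMap.lTensor_zero]
  · intro F hF
    rw [mem_stableH] at hF ⊢
    intro σ
    rw [map_sum]
    have e : ∀ i, permForms n σ (scal n (xTilde n i) * onCoeff n (dunkl n i) (onCoeff n (dunkl n i) F)) =
        scal n (xTilde n (σ i)) * onCoeff n (dunkl n (σ i)) (onCoeff n (dunkl n (σ i)) F) := by
      intro i
      rw [map_mul, permForms_onCoeff n σ _ _ (permPoly_dunkl n σ i),
        permForms_onCoeff n σ _ _ (permPoly_dunkl n σ i), hF]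
      congr 1
      rw [scal_apply, permForms_tmul, map_one, permPoly_xTilde]
      rfl
    simp only [D_eq, e]
    exact Equiv.sum_comp σ (fun i => scal n (xTilde n i) * onCoeff n (dunkl n i) (onCoeff n (dunkl n i) F))
  · intro M F hF
    rw [← partialNeg_eq_par]
    exact partialNeg_mem n M hF

/-- Contractions with functionals anticommute, and the Dunkl operators commute with each other and
with the contractions. -/
lemma partialNeg_anticomm (n M N : ℕ) (y : Forms n) :
    partialNeg n M (partialNeg n N y) = -partialNeg n N (partialNeg n M y) := by
  simp only [partialNeg_apply, map_sum, onCoeff_ctr, ← onCoeff_mul]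
  rw [Finset.sum_comm, ← Finset.sum_neg_distrib]
  refine Finset.sum_congr rfl fun i _ => ?_
  rw [← Finset.sum_neg_distrib]
  refine Finset.sum_congr rfl fun j _ => ?_
  rw [ctr_anticomm, ((dunkl_commute n i j).pow_pow M N).eq]

lemma eq_zero_of_eq_neg_self {n : ℕ} {y : Forms n} (h : y = -y) : y = 0 := by
  have h' : (2 : ℂ) • y = 0 := by
    rw [show (2 : ℂ) = 1 + 1 by norm_num, add_smul, one_smul]
    exact add_eq_zero_iff_eq_neg.2 h
  exact (smul_eq_zero_iff_right (by norm_num)).1 h'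

lemma partialNeg_scal (n N : ℕ) (p : polyRep n) : partialNeg n N (scal n p) = 0 := by
  rw [partialNeg_apply]
  refine Finset.sum_eq_zero fun i _ => ?_
  rw [scal_apply, onCoeff_tmul, ctr_tmul, CliffordAlgebra.contractLeft_one, TensorProduct.zero_tmul]

lemma scal_mem (n : ℕ) {p : polyRep n} (hp : ∀ σ, permPoly n σ p = p) : scal n p ∈ stableH n := by
  rw [mem_stableH]
  intro σ
  rw [scal_apply, permForms_tmul, map_one, hp]

lemma partialNeg_scal_mul (n N : ℕ) {p : polyRep n} (hp : ∀ σ, permPoly n σ p = p) (y : Forms n) :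
    partialNeg n N (scal n p * y) = scal n p * partialNeg n N y := by
  have hd : ∀ i, dunkl n i ^ N * LinearMap.mulLeft ℂ p = LinearMap.mulLeft ℂ p * dunkl n i ^ N := by
    intro i
    have : Commute (dunkl n i) (LinearMap.mulLeft ℂ p) :=
      LinearMap.ext fun q => dunkl_mul_of_invariant n i hp q
    exact (this.pow_left N).eq
  rw [partialNeg_apply, partialNeg_apply, Finset.mul_sum]
  refine Finset.sum_congr rfl fun i _ => ?_
  rw [← onCoeff_mulLeft, ← onCoeff_mulLeft, onCoeff_ctr, ← onCoeff_mul, hd, onCoeff_mul]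

open Polynomial

/-! ## Polynomials with roots `x̃ᵢ` -/

/-- The product of `X - x̃ⱼ` over `j ∈ S`. -/
noncomputable def rootPoly (n : ℕ) (S : Finset (Fin n)) : (polyRep n)[X] :=
  ∏ j ∈ S, (X - C (xTilde n j))

lemma map_rootPoly (n : ℕ) (σ : Equiv.Perm (Fin n)) (S : Finset (Fin n)) :
    (rootPoly n S).map (permPoly n σ : polyRep n →+* polyRep n) =
      rootPoly n (S.map σ.toEmbedding) := by
  rw [rootPoly, rootPoly, Polynomial.map_prod, Finset.prod_map]
  refine Finset.prod_congr rfl fun j _ => ?_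
  rw [Polynomial.map_sub, map_X, map_C]
  have : (permPoly n σ : polyRep n →+* polyRep n) (xTilde n j) = xTilde n (σ j) :=
    permPoly_xTilde n σ j
  rw [this]
  rfl

lemma permPoly_coeff_rootPoly (n : ℕ) (σ : Equiv.Perm (Fin n)) (S : Finset (Fin n)) (m : ℕ) :
    permPoly n σ ((rootPoly n S).coeff m) = (rootPoly n (S.map σ.toEmbedding)).coeff m := by
  rw [← map_rootPoly, coeff_map]
  rfl

lemma natDegree_rootPoly (n : ℕ) (S : Finset (Fin n)) : (rootPoly n S).natDegree = S.card := by
  rw [rootPoly, natDegree_prod_of_monic _ _ fun _ _ => monic_X_sub_C _]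
  simp

lemma monic_rootPoly (n : ℕ) (S : Finset (Fin n)) : (rootPoly n S).Monic :=
  monic_prod_of_monic _ _ fun j _ => monic_X_sub_C _

lemma swap_map_erase (n : ℕ) {i j : Fin n} (S : Finset (Fin n)) (hi : i ∉ S) :
    (S.erase j).map (Equiv.swap i j).toEmbedding = S.erase j := by
  ext k
  simp only [Finset.mem_map_equiv, Equiv.symm_swap]
  by_cases h1 : k = i
  · subst h1; simp [hi]
  · by_cases h2 : k = j
    · subst h2; simp [hi]
    · rw [Equiv.swap_apply_of_ne_of_ne h1 h2]

lemma rootPoly_erase (n : ℕ) {j : Fin n} {S : Finset (Fin n)} (hj : j ∈ S) :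
    rootPoly n S = (X - C (xTilde n j)) * rootPoly n (S.erase j) :=
  (Finset.mul_prod_erase S _ hj).symm

/-- The swap replaces the root x̃ⱼ by x̃ᵢ and keeps the other factors, so the difference is linear
in x̃ⱼ - x̃ᵢ and the division is explicit. -/
lemma dd_coeff_rootPoly (n : ℕ) {i j : Fin n} {S : Finset (Fin n)} (hi : i ∉ S) (hj : j ∈ S)
    (m : ℕ) : dd n i j ((rootPoly n S).coeff m) = -(rootPoly n (S.erase j)).coeff m := by
  have hij : i ≠ j := fun h => hi (h ▸ hj)
  apply dd_eq_of_mul n hij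
  have h1 : (rootPoly n S).map (permPoly n (Equiv.swap i j) : polyRep n →+* polyRep n) =
      (X - C (xTilde n i)) * rootPoly n (S.erase j) := by
    rw [rootPoly_erase n hj, Polynomial.map_mul, map_rootPoly, swap_map_erase n S hi,
      Polynomial.map_sub, map_X, map_C]
    congr 3
    exact (permPoly_xTilde n _ j).trans (by rw [Equiv.swap_apply_right])
  have h2 : permPoly n (Equiv.swap i j) ((rootPoly n S).coeff m) =
      ((X - C (xTilde n i)) * rootPoly n (S.erase j)).coeff m := by
    rw [← h1, coeff_map]; rfl
  rw [h2, xDiff_eq]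
  rw [rootPoly_erase n hj]
  rw [← coeff_sub, ← sub_mul]
  have : (X - C (xTilde n i) - (X - C (xTilde n j)) : (polyRep n)[X]) =
    C (xTilde n j - xTilde n i) := by rw [C_sub]; ring
  rw [this, coeff_C_mul]
  ring

lemma derivative_rootPoly (n : ℕ) (S : Finset (Fin n)) :
    derivative (rootPoly n S) = ∑ j ∈ S, rootPoly n (S.erase j) := by
  rw [rootPoly, derivative_prod_finset]
  refine Finset.sum_congr rfl fun j _ => ?_
  simp [rootPoly]

/-- Each divided difference deletes one root from ∏_{j ≠ i} (t - x̃ⱼ) with a minus sign, and the sum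
of all deletions is the derivative in t. -/
lemma dunkl_coeff (n : ℕ) (i : Fin n) (m : ℕ) :
    dunkl n i ((rootPoly n (Finset.univ.erase i)).coeff m) =
      -(derivative (rootPoly n (Finset.univ.erase i))).coeff m := by
  rw [dunkl_apply, derivative_rootPoly, finsetSum_coeff, ← Finset.sum_neg_distrib,
    ← Finset.add_sum_erase _ _ (Finset.mem_univ i), dd_self, zero_add]
  exact Finset.sum_congr rfl fun j hj => dd_coeff_rootPoly n (Finset.notMem_erase _ _) hj m

lemma dunkl_pow_coeff (n : ℕ) (i : Fin n) (N m : ℕ) :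
    (dunkl n i ^ N) ((rootPoly n (Finset.univ.erase i)).coeff m) =
      (-1) ^ N * (derivative^[N] (rootPoly n (Finset.univ.erase i))).coeff m := by
  induction N generalizing m with
  | zero => simp
  | succ N ih =>
    rw [pow_succ, Module.End.mul_apply, dunkl_coeff, coeff_derivative, map_neg]
    have : (rootPoly n (Finset.univ.erase i)).coeff (m + 1) * ((m : polyRep n) + 1) =
        (m + 1) • (rootPoly n (Finset.univ.erase i)).coeff (m + 1) := by
      rw [nsmul_eq_mul, mul_comm]; push_cast; rfl
    rw [this, map_nsmul, ih, Function.iterate_succ_apply', coeff_derivative, nsmul_eq_mul]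
    push_cast
    ring

lemma derivative_rootPoly_univ (n N : ℕ) :
    derivative^[N + 1] (rootPoly n Finset.univ) =
      ∑ i, derivative^[N] (rootPoly n (Finset.univ.erase i)) := by
  rw [Function.iterate_succ_apply, derivative_rootPoly]
  exact Polynomial.iterate_derivative_sum N _ _

/-! ## The one-forms dual to the contractions -/

/-- The coefficient of `t^m` in the one-form `∑ᵢ eᵢ ∏_{j ≠ i} (t - x̃ⱼ)`. -/
noncomputable def genForm (n m : ℕ) : Forms n :=
  ∑ i, scal n ((rootPoly n (Finset.univ.erase i)).coeff m) * oneForm n (basisProj n i)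

lemma genForm_mem (n m : ℕ) : genForm n m ∈ stableH n := by
  rw [mem_stableH]
  intro σ
  rw [genForm, map_sum]
  have e : ∀ i, permForms n σ
      (scal n ((rootPoly n (Finset.univ.erase i)).coeff m) * oneForm n (basisProj n i)) =
      scal n ((rootPoly n (Finset.univ.erase (σ i))).coeff m) * oneForm n (basisProj n (σ i)) := by
    intro i
    have : (Finset.univ.erase i).map σ.toEmbedding = Finset.univ.erase (σ i) := by
      ext k
      simp
    rw [map_mul, scal_apply, permForms_tmul, map_one, permPoly_coeff_rootPoly, this, oneForm,
      permForms_tmul, map_one, ExteriorAlgebra.map_apply_ι, permCartan_basisProj]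
    rfl
  simp only [e]
  exact Equiv.sum_comp σ (fun i =>
    scal n ((rootPoly n (Finset.univ.erase i)).coeff m) * oneForm n (basisProj n i))

/-- The polynomials are monic of degree n - 1, so the coefficient of t^(n-1) is ∑ eᵢ, which is zero
in 𝔥. This leaves exactly n - 1 one-forms. -/
lemma genForm_eq_zero (n m : ℕ) (h : n ≤ m + 1) : genForm n m = 0 := by
  rw [genForm]
  have hd : ∀ i, (rootPoly n (Finset.univ.erase i)).natDegree = n - 1 := fun i => by
    rw [natDegree_rootPoly, Finset.card_erase_of_mem (Finset.mem_univ i), Finset.card_univ,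
      Fintype.card_fin]
  by_cases hm : m = n - 1
  · have : ∀ i, (rootPoly n (Finset.univ.erase i)).coeff m = 1 := fun i => by
      rw [hm, ← hd i]
      exact monic_rootPoly n _
    simp only [this, map_one, one_mul]
    have e : ∑ i, oneForm n (basisProj n i) = 0 := by
      simp only [oneForm, ← TensorProduct.sum_tmul, ← map_sum, sum_basisProj, map_zero,
        TensorProduct.zero_tmul]
    exact e
  · refine Finset.sum_eq_zero fun i _ => ?_
    rw [coeff_eq_zero_of_natDegree_lt, map_zero, zero_mul]
    rw [hd i]
    have := i.pos
    omega

lemma ctr_scal_mul_oneForm (n : ℕ) (d : Module.Dual ℂ (cartan n)) (p : polyRep n) (v : cartan n) :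
    ctr n d (scal n p * oneForm n v) = d v • scal n p := by
  rw [ctr_scal_mul]
  have := ctr_oneForm_mul n d v 1
  rw [mul_one, ← map_one (scal n), ctr_scal, mul_zero, sub_zero, map_one] at this
  rw [this, mul_smul_comm, mul_one]

/-- The correction from projecting eᵢ to 𝔥 is a power sum of Dunkl operators, which vanishes. What
remains is ∑ᵢ Dᵢ^N on the coefficient with root i deleted, that is, a derivative of order N of P'.
-/
lemma partialNeg_genForm (n N m : ℕ) (hN : 1 ≤ N) :
    partialNeg n N (genForm n m) =
      scal n ((-1) ^ N * (derivative^[N + 1] (rootPoly n Finset.univ)).coeff m) := by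
  have h1 : ∀ k i, ctr n (coord n k) (onCoeff n (dunkl n k ^ N)
      (scal n ((rootPoly n (Finset.univ.erase i)).coeff m) * oneForm n (basisProj n i))) =
      ((if k = i then (1 : ℂ) else 0) - (n : ℂ)⁻¹) •
        scal n ((dunkl n k ^ N) ((rootPoly n (Finset.univ.erase i)).coeff m)) := by
    intro k i
    rw [scal_comm, onCoeff_oneForm_mul, scal_apply, onCoeff_tmul, ← scal_apply, ← scal_comm,
      ctr_scal_mul_oneForm, coord_basisProj]
  rw [partialNeg_apply]
  simp only [genForm, map_sum, h1]
  rw [Finset.sum_comm]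
  have h2 : ∀ i, ∑ k, ((if k = i then (1 : ℂ) else 0) - (n : ℂ)⁻¹) •
        scal n ((dunkl n k ^ N) ((rootPoly n (Finset.univ.erase i)).coeff m)) =
      scal n ((dunkl n i ^ N) ((rootPoly n (Finset.univ.erase i)).coeff m)) := by
    intro i
    rw [sum_indicator_sub_smul (fun k =>
      scal n ((dunkl n k ^ N) ((rootPoly n (Finset.univ.erase i)).coeff m))), ← map_sum,
      ← LinearMap.sum_apply, sum_dunkl_pow n N hN]
    simp
  simp only [h2, dunkl_pow_coeff]
  rw [derivative_rootPoly_univ, finsetSum_coeff, Finset.mul_sum, map_sum]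

lemma form_mul_neg {n : ℕ} (y z : Forms n) : y * -z = -(y * z) :=
  eq_neg_of_add_eq_zero_left (by rw [← mul_add, neg_add_cancel, mul_zero])

lemma form_sum_neg {n : ℕ} {ι : Type*} (s : Finset ι) (f : ι → Forms n) :
    ∑ i ∈ s, -f i = -∑ i ∈ s, f i :=
  eq_neg_of_add_eq_zero_left (by
    rw [← Finset.sum_add_distrib]
    exact Finset.sum_eq_zero fun i _ => neg_add_cancel (f i))

lemma natDegree_rootPoly_univ (n : ℕ) : (rootPoly n Finset.univ).natDegree = n := by
  rw [natDegree_rootPoly, Finset.card_univ, Fintype.card_fin]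

/-- The coefficients of the derivatives of the polynomial with roots `x̃ᵢ`. -/
noncomputable def derivMatrix (n : ℕ) : Matrix (Fin (n - 1)) (Fin (n - 1)) (polyRep n) :=
  Matrix.of fun a b => (derivative^[(b : ℕ) + 2] (rootPoly n Finset.univ)).coeff (n - 2 - a)

/-- The derivative of order b + 2 has degree n - 2 - b, so the entries with a < b vanish. The
diagonal entries are leading coefficients, nonzero integers because P is monic. -/
lemma isUnit_det_derivMatrix (n : ℕ) : IsUnit (derivMatrix n).det := by
  rw [Matrix.det_of_isLowerTriangular]
  · rw [IsUnit.prod_univ_iff]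
    intro a
    have h : n - 2 - (a : ℕ) + (a + 2) = n := by omega
    rw [derivMatrix, Matrix.of_apply, coeff_iterate_derivative, h]
    have h1 : (rootPoly n Finset.univ).coeff n = 1 := by
      have := monic_rootPoly n Finset.univ
      rwa [Monic, leadingCoeff, natDegree_rootPoly_univ] at this
    rw [h1, nsmul_one]
    have h2 : ((n.descFactorial ((a : ℕ) + 2) : ℕ) : polyRep n) =
        algebraMap ℂ _ ((n.descFactorial ((a : ℕ) + 2) : ℕ) : ℂ) := by simp
    rw [h2]
    apply IsUnit.map
    rw [isUnit_iff_ne_zero, Nat.cast_ne_zero, Ne, Nat.descFactorial_eq_zero_iff_lt]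
    omega
  · intro a b hab
    have hab : (a : ℕ) < b := hab
    rw [derivMatrix, Matrix.of_apply, coeff_iterate_derivative, coeff_eq_zero_of_natDegree_lt,
      smul_zero]
    rw [natDegree_rootPoly_univ]
    omega

lemma permPoly_coeff_derivative (n : ℕ) (σ : Equiv.Perm (Fin n)) (N m : ℕ) :
    permPoly n σ ((derivative^[N] (rootPoly n Finset.univ)).coeff m) =
      (derivative^[N] (rootPoly n Finset.univ)).coeff m := by
  rw [coeff_iterate_derivative, map_nsmul, permPoly_coeff_rootPoly, Finset.map_univ_equiv]

lemma map_nonsing_inv_of_map_eq {ι R : Type*} [Fintype ι] [DecidableEq ι] [CommRing R] (f : R →+* R)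
    {M : Matrix ι ι R} (hM : IsUnit M.det) (hf : M.map f = M) : M⁻¹.map f = M⁻¹ := by
  have h2 : M⁻¹.map f * M = 1 := by
    nth_rewrite 2 [← hf]
    rw [← Matrix.map_mul, Matrix.nonsing_inv_mul _ hM]
    exact Matrix.map_one _ (map_zero _) (map_one _)
  calc _ = M⁻¹.map f * (M * M⁻¹) := by rw [Matrix.mul_nonsing_inv _ hM, mul_one]
    _ = _ := by rw [← mul_assoc, h2, one_mul]

/-- The matrix has symmetric entries, hence so has its inverse. Thus the dual forms are invariant,
and δ is linear over these coefficients. -/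
lemma permPoly_inv_derivMatrix (n : ℕ) (σ : Equiv.Perm (Fin n)) (a b : Fin (n - 1)) :
    permPoly n σ ((derivMatrix n)⁻¹ a b) = (derivMatrix n)⁻¹ a b := by
  have h : ∀ a b, permPoly n σ (derivMatrix n a b) = derivMatrix n a b := fun a b => by
    rw [derivMatrix, Matrix.of_apply, permPoly_coeff_derivative]
  have h2 : (derivMatrix n).map (permPoly n σ : polyRep n →+* polyRep n) = derivMatrix n :=
    Matrix.ext fun a b => by rw [Matrix.map_apply, RingHom.coe_coe, h]
  have h3 := map_nonsing_inv_of_map_eq _ (isUnit_det_derivMatrix n) h2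
  have h4 := congrFun (congrFun h3 a) b
  rwa [Matrix.map_apply, RingHom.coe_coe] at h4

/-- The one-forms dual to the contractions `∂_{-1}, …, ∂_{-(n-1)}` (up to signs). -/
noncomputable def dualForm (n : ℕ) (k : Fin (n - 1)) : Forms n :=
  ∑ a : Fin (n - 1), scal n ((derivMatrix n)⁻¹ k a) * genForm n (n - 2 - a)

/-- The contraction `(-1)^k ∂_{-k}`, with `k + 1` in place of `k`. -/
noncomputable def delta (n : ℕ) (k : Fin (n - 1)) : Module.End ℂ (Forms n) :=
  (-1 : ℂ) ^ ((k : ℕ) + 1) • partialNeg n (k + 1)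

lemma delta_apply (n : ℕ) (k : Fin (n - 1)) (y : Forms n) :
    delta n k y = (-1 : ℂ) ^ ((k : ℕ) + 1) • partialNeg n (k + 1) y := rfl

lemma delta_mem (n : ℕ) (k : Fin (n - 1)) {y : Forms n} (hy : y ∈ stableH n) :
    delta n k y ∈ stableH n :=
  (stableH n).smul_mem (partialNeg_mem n _ hy) _

lemma delta_mul (n : ℕ) (k : Fin (n - 1)) {y z : Forms n} (hy : y ∈ stableH n)
    (hz : z ∈ stableH n) : delta n k (y * z) = delta n k y * z + hat n y * delta n k z := by
  simp only [delta_apply]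
  rw [partialNeg_mul n (by have := k.pos; omega) _ (by omega) hy hz, smul_add, smul_mul_assoc,
    mul_smul_comm]

lemma delta_anticomm (n : ℕ) (j k : Fin (n - 1)) (y : Forms n) :
    delta n j (delta n k y) = -delta n k (delta n j y) := by
  simp only [delta_apply, map_smul]
  rw [partialNeg_anticomm, smul_neg, smul_neg, smul_comm]

lemma delta_delta (n : ℕ) (k : Fin (n - 1)) (y : Forms n) : delta n k (delta n k y) = 0 :=
  eq_zero_of_eq_neg_self (delta_anticomm n k k y)

lemma delta_scal (n : ℕ) (k : Fin (n - 1)) (p : polyRep n) : delta n k (scal n p) = 0 := by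
  rw [delta_apply, partialNeg_scal, smul_zero]

lemma delta_scal_mul (n : ℕ) (k : Fin (n - 1)) {p : polyRep n} (hp : ∀ σ, permPoly n σ p = p)
    (y : Forms n) : delta n k (scal n p * y) = scal n p * delta n k y := by
  rw [delta_apply, delta_apply, partialNeg_scal_mul n _ hp, mul_smul_comm]

lemma delta_genForm (n : ℕ) (a k : Fin (n - 1)) :
    delta n k (genForm n (n - 2 - a)) = scal n (derivMatrix n a k) := by
  rw [delta_apply, partialNeg_genForm n _ _ (by omega), ← map_smul]
  congr 1
  rw [derivMatrix, Matrix.of_apply, Algebra.smul_def, ← mul_assoc]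
  have : algebraMap ℂ (polyRep n) ((-1) ^ ((k : ℕ) + 1)) * (-1) ^ ((k : ℕ) + 1) = 1 := by
    rw [map_pow, ← mul_pow, map_neg, map_one]
    have : (-1 : polyRep n) * -1 = 1 := by ring
    rw [this, one_pow]
  rw [this, one_mul]

lemma dualForm_mem (n : ℕ) (k : Fin (n - 1)) : dualForm n k ∈ stableH n :=
  sum_mem fun a _ => mul_mem (scal_mem n fun σ => permPoly_inv_derivMatrix n σ k a)
    (genForm_mem n _)

lemma delta_dualForm (n : ℕ) (j k : Fin (n - 1)) :
    delta n j (dualForm n k) = if j = k then 1 else 0 := by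
  rw [dualForm, map_sum]
  have e : ∀ a : Fin (n - 1),
      delta n j (scal n ((derivMatrix n)⁻¹ k a) * genForm n (n - 2 - a)) =
        scal n ((derivMatrix n)⁻¹ k a * derivMatrix n a j) := fun a => by
    rw [delta_scal_mul n j (fun σ => permPoly_inv_derivMatrix n σ k a), delta_genForm, map_mul]
  simp only [e]
  rw [← map_sum, ← Matrix.mul_apply, Matrix.nonsing_inv_mul _ (isUnit_det_derivMatrix n),
    Matrix.one_apply, apply_ite (scal n), map_one, map_zero]
  simp only [eq_comm]

lemma genForm_eq (n : ℕ) (a : Fin (n - 1)) :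
    genForm n (n - 2 - a) = ∑ k, scal n (derivMatrix n a k) * dualForm n k := by
  simp only [dualForm, Finset.mul_sum]
  rw [Finset.sum_comm]
  have e : ∀ b : Fin (n - 1), ∑ k, scal n (derivMatrix n a k) *
      (scal n ((derivMatrix n)⁻¹ k b) * genForm n (n - 2 - b)) =
      scal n ((1 : Matrix (Fin (n - 1)) (Fin (n - 1)) (polyRep n)) a b) * genForm n (n - 2 - b) := by
    intro b
    rw [← Matrix.mul_nonsing_inv _ (isUnit_det_derivMatrix n), Matrix.mul_apply, map_sum,
      Finset.sum_mul]
    exact Finset.sum_congr rfl fun k _ => by rw [map_mul, mul_assoc]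
  simp only [e]
  rw [Finset.sum_eq_single a]
  · rw [Matrix.one_apply_eq, map_one, one_mul]
  · intro b _ hb
    rw [Matrix.one_apply_ne hb.symm, map_zero, zero_mul]
  · simp

lemma mul_scal_oneForm (n : ℕ) (p : polyRep n) (v : cartan n) (y : Forms n) :
    y * (scal n p * oneForm n v) = scal n p * oneForm n v * hat n y := by
  rw [← mul_assoc, ← scal_comm, mul_assoc, mul_oneForm, mul_assoc]

lemma mul_dualForm (n : ℕ) (k : Fin (n - 1)) (y : Forms n) :
    y * dualForm n k = dualForm n k * hat n y := by
  simp only [dualForm, genForm, Finset.mul_sum, Finset.sum_mul]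
  refine Finset.sum_congr rfl fun a _ => Finset.sum_congr rfl fun i _ => ?_
  rw [← mul_assoc (scal n _), ← map_mul, mul_scal_oneForm]

lemma hat_dualForm (n : ℕ) (k : Fin (n - 1)) : hat n (dualForm n k) = -dualForm n k := by
  simp only [dualForm, genForm, map_sum, map_mul, hat_scal, hat_oneForm, form_mul_neg,
    form_sum_neg]

lemma ctr_dualForm (n : ℕ) (d : Module.Dual ℂ (cartan n)) (k : Fin (n - 1)) :
    ∃ p, ctr n d (dualForm n k) = scal n p := by
  have : ctr n d (dualForm n k) ∈ (scal n).range := by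
    simp only [dualForm, genForm, map_sum, Finset.mul_sum]
    refine sum_mem fun a _ => sum_mem fun i _ => ?_
    rw [← mul_assoc, ← map_mul, ctr_scal_mul_oneForm]
    exact Subalgebra.smul_mem _ ((AlgHom.mem_range _).2 ⟨_, rfl⟩) _
  obtain ⟨p, hp⟩ := this
  exact ⟨p, hp.symm⟩

/-- The expansion in the `dualForm`s of the one-form `∑ᵢ eᵢ ∏_{j ≠ i} (t - x̃ⱼ)`, at `t = w`. -/
lemma sum_eval_oneForm (n : ℕ) (w : polyRep n) :
    ∑ i, scal n ((rootPoly n (Finset.univ.erase i)).eval w) * oneForm n (basisProj n i) =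
      ∑ k : Fin (n - 1), scal n ((derivative^[(k : ℕ) + 2] (rootPoly n Finset.univ)).eval w) *
        dualForm n k := by
  have hd : ∀ i, (rootPoly n (Finset.univ.erase i)).natDegree < n := fun i => by
    rw [natDegree_rootPoly, Finset.card_erase_of_mem (Finset.mem_univ i), Finset.card_univ,
      Fintype.card_fin]
    have := i.pos
    omega
  have hP : ∀ k : Fin (n - 1),
      (derivative^[(k : ℕ) + 2] (rootPoly n Finset.univ)).natDegree < n - 1 := fun k => by
    have := natDegree_iterate_derivative (rootPoly n Finset.univ) ((k : ℕ) + 2)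
    rw [natDegree_rootPoly_univ] at this
    omega
  calc _ = ∑ m ∈ Finset.range n, scal n (w ^ m) * genForm n m := by
        have : ∀ i, (rootPoly n (Finset.univ.erase i)).eval w =
            ∑ m ∈ Finset.range n, (rootPoly n (Finset.univ.erase i)).coeff m * w ^ m :=
          fun i => eval_eq_sum_range' (hd i) w
        simp only [this, genForm, map_sum, Finset.sum_mul, Finset.mul_sum]
        rw [Finset.sum_comm]
        refine Finset.sum_congr rfl fun m _ => Finset.sum_congr rfl fun i _ => ?_
        rw [← mul_assoc, ← map_mul, mul_comm (w ^ m)]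
    _ = ∑ m ∈ Finset.range (n - 1), scal n (w ^ m) * genForm n m := by
        symm
        apply Finset.sum_subset (Finset.range_subset_range.2 (Nat.sub_le _ _))
        intro m _ hm
        rw [genForm_eq_zero, mul_zero]
        rw [Finset.mem_range] at hm
        omega
    _ = ∑ a : Fin (n - 1), scal n (w ^ (n - 2 - (a : ℕ))) * genForm n (n - 2 - a) := by
        rw [← Finset.sum_range_reflect, Finset.sum_range]
        refine Finset.sum_congr rfl fun a _ => ?_
        rw [show n - 1 - 1 - (a : ℕ) = n - 2 - a by omega]
    _ = _ := by
        simp only [genForm_eq, Finset.mul_sum]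
        rw [Finset.sum_comm]
        refine Finset.sum_congr rfl fun k _ => ?_
        rw [eval_eq_sum_range' (hP k) w, ← Finset.sum_range_reflect, Finset.sum_range, map_sum,
          Finset.sum_mul]
        refine Finset.sum_congr rfl fun a _ => ?_
        rw [← mul_assoc, ← map_mul, show n - 1 - 1 - (a : ℕ) = n - 2 - a by omega, derivMatrix,
          Matrix.of_apply, mul_comm (w ^ _)]

/-! ## Invariant polynomials and averaging -/

noncomputable section

/-- The `Sₙ`-invariant elements of `polyRep n`. -/
def invPoly (n : ℕ) : Subalgebra ℂ (polyRep n) :=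
  ⨅ σ : Equiv.Perm (Fin n), AlgHom.equalizer (permPoly n σ) (AlgHom.id ℂ (polyRep n))

/-- Averaging over `Sₙ`. -/
def avgPoly (n : ℕ) : polyRep n →ₗ[ℂ] polyRep n :=
  ((n.factorial : ℂ)⁻¹) • ∑ σ : Equiv.Perm (Fin n), (permPoly n σ).toLinearMap

/-- Averaging of forms over `Sₙ`. -/
def avgForms (n : ℕ) : Forms n →ₗ[ℂ] Forms n :=
  ((n.factorial : ℂ)⁻¹) • ∑ σ : Equiv.Perm (Fin n), (permForms n σ).toLinearMap

end

lemma mem_invPoly (n : ℕ) (p : polyRep n) : p ∈ invPoly n ↔ ∀ σ, permPoly n σ p = p := by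
  rw [invPoly, Algebra.mem_iInf]
  rfl

lemma avgPoly_apply (n : ℕ) (p : polyRep n) :
    avgPoly n p = ((n.factorial : ℂ)⁻¹) • ∑ σ, permPoly n σ p := by
  rw [avgPoly, LinearMap.smul_apply, LinearMap.sum_apply]
  rfl

lemma avgForms_apply (n : ℕ) (y : Forms n) :
    avgForms n y = ((n.factorial : ℂ)⁻¹) • ∑ σ, permForms n σ y := by
  rw [avgForms, LinearMap.smul_apply, LinearMap.sum_apply]
  rfl

lemma avg_const {M : Type*} [AddCommGroup M] [Module ℂ M] (n : ℕ) (x : M) :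
    ((n.factorial : ℂ)⁻¹) • ∑ _σ : Equiv.Perm (Fin n), x = x := by
  rw [Finset.sum_const, Finset.card_univ, Fintype.card_perm, Fintype.card_fin,
    ← Nat.cast_smul_eq_nsmul ℂ, inv_smul_smul₀]
  exact_mod_cast n.factorial_ne_zero

lemma avgPoly_mem (n : ℕ) (p : polyRep n) : avgPoly n p ∈ invPoly n := by
  rw [mem_invPoly]
  intro σ
  rw [avgPoly_apply, map_smul, map_sum]
  congr 1
  simp only [permPoly_permPoly]
  exact Equiv.sum_comp (Equiv.mulLeft σ) (fun τ => permPoly n τ p)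

lemma avgPoly_of_mem (n : ℕ) {p : polyRep n} (hp : p ∈ invPoly n) : avgPoly n p = p := by
  rw [avgPoly_apply]
  simp only [(mem_invPoly n p).1 hp]
  exact avg_const n p

lemma avgPoly_mul (n : ℕ) {p : polyRep n} (hp : p ∈ invPoly n) (q : polyRep n) :
    avgPoly n (p * q) = p * avgPoly n q := by
  rw [avgPoly_apply, avgPoly_apply, mul_smul_comm, Finset.mul_sum]
  congr 1
  exact Finset.sum_congr rfl fun σ _ => by rw [map_mul, (mem_invPoly n p).1 hp]

lemma permForms_scal (n : ℕ) (σ : Equiv.Perm (Fin n)) (p : polyRep n) :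
    permForms n σ (scal n p) = scal n (permPoly n σ p) := by
  rw [scal_apply, permForms_tmul, map_one, scal_apply]

lemma avgForms_of_mem (n : ℕ) {y : Forms n} (hy : y ∈ stableH n) : avgForms n y = y := by
  rw [avgForms_apply]
  simp only [(mem_stableH n y).1 hy]
  exact avg_const n y

lemma avgForms_scal_mul (n : ℕ) (p : polyRep n) {y : Forms n} (hy : y ∈ stableH n) :
    avgForms n (scal n p * y) = scal n (avgPoly n p) * y := by
  rw [avgForms_apply, avgPoly_apply, map_smul, smul_mul_assoc, map_sum, Finset.sum_mul]
  congr 1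
  exact Finset.sum_congr rfl fun σ _ => by
    rw [map_mul, permForms_scal, (mem_stableH n y).1 hy]

lemma scal_mem_stableH (n : ℕ) {p : polyRep n} (hp : p ∈ invPoly n) : scal n p ∈ stableH n :=
  scal_mem n ((mem_invPoly n p).1 hp)

/-! ## Inverting the discriminant -/

/-- The discriminant, up to sign. -/
noncomputable def disc (n : ℕ) : polyRep n :=
  ∏ j, ∏ i ∈ Finset.univ.erase j, (xTilde n j - xTilde n i)

lemma disc_ne_zero (n : ℕ) : disc n ≠ 0 :=
  Finset.prod_ne_zero_iff.2 fun j _ => Finset.prod_ne_zero_iff.2 fun i hi => by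
    rw [← xDiff_eq]
    exact xDiff_ne_zero n (Finset.ne_of_mem_erase hi).symm

lemma disc_mem (n : ℕ) : disc n ∈ invPoly n := by
  rw [mem_invPoly]
  intro σ
  rw [disc, map_prod]
  have e : ∀ j, permPoly n σ (∏ i ∈ Finset.univ.erase j, (xTilde n j - xTilde n i)) =
      ∏ i ∈ Finset.univ.erase (σ j), (xTilde n (σ j) - xTilde n i) := by
    intro j
    rw [map_prod]
    refine Finset.prod_bij (fun i _ => σ i) ?_ ?_ ?_ ?_
    · intro i hi
      simpa using hi
    · intro i _ k _ h
      exact σ.injective h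
    · intro i hi
      refine ⟨σ.symm i, ?_, by simp⟩
      rw [Finset.mem_erase] at hi ⊢
      refine ⟨fun h => hi.1 ?_, Finset.mem_univ _⟩
      rw [← h, Equiv.apply_symm_apply]
    · intro i _
      rw [map_sub, permPoly_xTilde, permPoly_xTilde]
  simp only [e]
  exact Equiv.prod_comp σ (fun j => ∏ i ∈ Finset.univ.erase j, (xTilde n j - xTilde n i))

lemma eval_rootPoly (n : ℕ) (S : Finset (Fin n)) (w : polyRep n) :
    (rootPoly n S).eval w = ∏ j ∈ S, (w - xTilde n j) := by
  rw [rootPoly, eval_prod]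
  exact Finset.prod_congr rfl fun j _ => by rw [eval_sub, eval_X, eval_C]

/-- The subalgebra of forms which is generated by the `dualForm`s. -/
noncomputable def dualSubalg (n : ℕ) : Subalgebra ℂ (Forms n) :=
  Algebra.adjoin ℂ (Set.range (dualForm n))

lemma dualSubalg_le (n : ℕ) : dualSubalg n ≤ stableH n :=
  Algebra.adjoin_le (by rintro _ ⟨k, rfl⟩; exact dualForm_mem n k)

/-- The span of the products `p b` with `p` in `S` and `b` in `dualSubalg n`. -/
noncomputable def dualSpan (n : ℕ) (S : Subalgebra ℂ (polyRep n)) : Submodule ℂ (Forms n) :=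
  Submodule.span ℂ {y | ∃ p ∈ S, ∃ b ∈ dualSubalg n, y = scal n p * b}

lemma dualSpan_mul (n : ℕ) (S : Subalgebra ℂ (polyRep n)) {y z : Forms n} (hy : y ∈ dualSpan n S)
    (hz : z ∈ dualSpan n S) : y * z ∈ dualSpan n S := by
  induction hy using Submodule.span_induction with
  | zero => rw [zero_mul]; exact zero_mem _
  | add a b _ _ ha hb => rw [add_mul]; exact add_mem ha hb
  | smul c a _ ha => rw [smul_mul_assoc]; exact Submodule.smul_mem _ _ ha
  | mem y hy =>
    obtain ⟨p, hp, b, hb, rfl⟩ := hy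
    induction hz using Submodule.span_induction with
    | zero => rw [mul_zero]; exact zero_mem _
    | add a b _ _ ha hb => rw [mul_add]; exact add_mem ha hb
    | smul c a _ ha => rw [mul_smul_comm]; exact Submodule.smul_mem _ _ ha
    | mem z hz =>
      obtain ⟨q, hq, c, hc, rfl⟩ := hz
      refine Submodule.subset_span ⟨p * q, mul_mem hp hq, b * c, mul_mem hb hc, ?_⟩
      rw [map_mul, mul_assoc, ← mul_assoc b, ← scal_comm, mul_assoc, mul_assoc]

lemma scal_mem_dualSpan (n : ℕ) (S : Subalgebra ℂ (polyRep n)) {p : polyRep n} (hp : p ∈ S) :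
    scal n p ∈ dualSpan n S :=
  Submodule.subset_span ⟨p, hp, 1, one_mem _, (mul_one _).symm⟩

/-- At t = x̃ⱼ all summands of the coframe identity vanish except the j-th, whose coefficient is
∏_{i ≠ j} (x̃ⱼ - x̃ᵢ), a factor of the discriminant. -/
lemma disc_oneForm_mem (n : ℕ) (v : cartan n) : scal n (disc n) * oneForm n v ∈ dualSpan n ⊤ := by
  have h1 : ∀ j, scal n (disc n) * oneForm n (basisProj n j) ∈ dualSpan n ⊤ := by
    intro j
    have h2 := sum_eval_oneForm n (xTilde n j)
    rw [Finset.sum_eq_single j] at h2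
    · rw [disc, ← Finset.mul_prod_erase _ _ (Finset.mem_univ j), mul_comm, map_mul, mul_assoc,
        ← eval_rootPoly, h2]
      refine dualSpan_mul n ⊤ (scal_mem_dualSpan n ⊤ Algebra.mem_top) (sum_mem fun k _ => ?_)
      exact Submodule.subset_span ⟨_, Algebra.mem_top, _, Algebra.subset_adjoin ⟨k, rfl⟩, rfl⟩
    · intro i _ hij
      rw [eval_rootPoly, Finset.prod_eq_zero (Finset.mem_erase.2 ⟨hij.symm, Finset.mem_univ _⟩)
        (sub_self _), map_zero, zero_mul]
    · simp
  rw [← sum_coord_smul_basisProj n v]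
  have h3 : oneForm n (∑ i, coord n i v • basisProj n i) =
      ∑ i, coord n i v • oneForm n (basisProj n i) := by
    simp only [← oneForm_smul]
    simp only [oneForm, map_sum, TensorProduct.sum_tmul]
  rw [h3, Finset.mul_sum]
  refine sum_mem fun i _ => ?_
  rw [mul_smul_comm]
  exact Submodule.smul_mem _ _ (h1 i)

lemma exists_disc_mul_mem (n : ℕ) (y : Forms n) :
    ∃ N : ℕ, scal n (disc n ^ N) * y ∈ dualSpan n ⊤ := by
  have top : ∀ p, scal n p ∈ dualSpan n ⊤ := fun p => scal_mem_dualSpan n ⊤ Algebra.mem_top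
  have hadd : ∀ y z : Forms n, (∃ N : ℕ, scal n (disc n ^ N) * y ∈ dualSpan n ⊤) →
      (∃ N : ℕ, scal n (disc n ^ N) * z ∈ dualSpan n ⊤) →
      ∃ N : ℕ, scal n (disc n ^ N) * (y + z) ∈ dualSpan n ⊤ := by
    rintro y z ⟨M, hM⟩ ⟨N, hN⟩
    refine ⟨M + N, ?_⟩
    rw [mul_add, pow_add]
    refine add_mem ?_ ?_
    · rw [mul_comm, map_mul, mul_assoc]
      exact dualSpan_mul n ⊤ (top _) hM
    · rw [map_mul, mul_assoc]
      exact dualSpan_mul n ⊤ (top _) hN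
  induction y using TensorProduct.induction_on with
  | zero => exact ⟨0, by rw [mul_zero]; exact zero_mem _⟩
  | add y z hy hz => exact hadd y z hy hz
  | tmul a p =>
    induction a using exterior_induction with
    | hr r =>
      refine ⟨0, ?_⟩
      rw [scal_mul_tmul, Algebra.algebraMap_eq_smul_one, TensorProduct.smul_tmul, ← scal_apply]
      exact top _
    | hadd a b ha hb => rw [TensorProduct.add_tmul]; exact hadd _ _ ha hb
    | hmul v a ha =>
      obtain ⟨N, hN⟩ := ha
      refine ⟨1 + N, ?_⟩
      rw [← oneForm_mul_tmul, pow_add, pow_one, map_mul, mul_assoc, ← mul_assoc (scal n (disc n ^ N)),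
        scal_comm n (disc n ^ N), mul_assoc (oneForm n v), ← mul_assoc]
      exact dualSpan_mul n ⊤ (disc_oneForm_mem n v) hN

/-- The discriminant and products of dual forms are invariant, so averaging fixes the left side and
only replaces the coefficients by their averages. -/
lemma exists_disc_mul_mem_invariant (n : ℕ) {y : Forms n} (hy : y ∈ stableH n) :
    ∃ N : ℕ, scal n (disc n ^ N) * y ∈ dualSpan n (invPoly n) := by
  obtain ⟨N, hN⟩ := exists_disc_mul_mem n y
  refine ⟨N, ?_⟩
  have h1 : scal n (disc n ^ N) * y ∈ stableH n :=
    mul_mem (scal_mem_stableH n (pow_mem (disc_mem n) N)) hy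
  rw [← avgForms_of_mem n h1]
  have h2 : ∀ z ∈ dualSpan n ⊤, avgForms n z ∈ dualSpan n (invPoly n) := by
    intro z hz
    induction hz using Submodule.span_induction with
    | zero => rw [map_zero]; exact zero_mem _
    | add a b _ _ ha hb => rw [map_add]; exact add_mem ha hb
    | smul c a _ ha => rw [map_smul]; exact Submodule.smul_mem _ _ ha
    | mem z hz =>
      obtain ⟨p, -, b, hb, rfl⟩ := hz
      rw [avgForms_scal_mul n p (dualSubalg_le n hb)]
      exact Submodule.subset_span ⟨_, avgPoly_mem n p, b, hb, rfl⟩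
  exact h2 _ hN

/-! ## Contractions of invariant forms -/

/-- Both sides are odd derivations on the subalgebra, since the coefficients `ctr n d (dualForm n
k)` are functions and hence central. They agree on the generators by duality. -/
lemma ctr_dualSubalg (n : ℕ) (d : Module.Dual ℂ (cartan n)) {b : Forms n} (hb : b ∈ dualSubalg n) :
    ctr n d b = ∑ k, ctr n d (dualForm n k) * delta n k b := by
  induction hb using Algebra.adjoin_induction with
  | mem b hb =>
    obtain ⟨j, rfl⟩ := hb
    simp only [delta_dualForm, mul_ite, mul_one, mul_zero, Finset.sum_ite_eq', Finset.mem_univ,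
      if_true]
  | algebraMap r =>
    have : algebraMap ℂ (Forms n) r = scal n (algebraMap ℂ _ r) := ((scal n).commutes r).symm
    rw [this, ctr_scal]
    simp only [delta_scal, mul_zero, Finset.sum_const_zero]
  | add b c _ _ hb hc => simp only [map_add, hb, hc, mul_add, Finset.sum_add_distrib]
  | mul b c hb' hc' hb hc =>
    rw [ctr_mul, hb, hc, Finset.sum_mul, Finset.mul_sum, ← Finset.sum_add_distrib]
    refine Finset.sum_congr rfl fun k _ => ?_
    obtain ⟨p, hp⟩ := ctr_dualForm n d k
    rw [delta_mul n k (dualSubalg_le n hb') (dualSubalg_le n hc'), hp, mul_add, mul_assoc,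
      ← mul_assoc (hat n b), ← scal_comm, mul_assoc]

/-- On invariant forms, contractions with functionals are combinations of the `delta`s. -/
theorem ctr_eq_sum (n : ℕ) (d : Module.Dual ℂ (cartan n)) {y : Forms n} (hy : y ∈ stableH n) :
    ctr n d y = ∑ k, ctr n d (dualForm n k) * delta n k y := by
  have h1 : ∀ z ∈ dualSpan n (invPoly n),
      ctr n d z = ∑ k, ctr n d (dualForm n k) * delta n k z := by
    intro z hz
    induction hz using Submodule.span_induction with
    | zero => simp only [map_zero, mul_zero, Finset.sum_const_zero]
    | add a b _ _ ha hb => simp only [map_add, ha, hb, mul_add, Finset.sum_add_distrib]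
    | smul c a _ ha => simp only [map_smul, ha, mul_smul_comm, Finset.smul_sum]
    | mem z hz =>
      obtain ⟨p, hp, b, hb, rfl⟩ := hz
      rw [ctr_scal_mul, ctr_dualSubalg n d hb, Finset.mul_sum]
      refine Finset.sum_congr rfl fun k _ => ?_
      rw [delta_scal_mul n k ((mem_invPoly n p).1 hp), ← mul_assoc, ← mul_assoc, scal_comm]
  -- The identity holds after multiplication by a power of the discriminant. Both sides are linear
  -- over invariants and forms have no torsion, so the power cancels.
  obtain ⟨N, hN⟩ := exists_disc_mul_mem_invariant n hy
  have h2 := h1 _ hN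
  rw [← sub_eq_zero]
  apply scal_mul_eq_zero n (pow_ne_zero N (disc_ne_zero n))
  have h3 : ∀ a b c : Forms n, c * (a - b) = c * a - c * b := fun a b c => mul_sub c a b
  rw [h3, sub_eq_zero, ← ctr_scal_mul, h2, Finset.mul_sum]
  refine Finset.sum_congr rfl fun k _ => ?_
  rw [delta_scal_mul n k ((mem_invPoly n _).1 (pow_mem (disc_mem n) N)), ← mul_assoc, ← mul_assoc,
    scal_comm]

/-! ### Forms killed by all contractions -/

section Exterior

variable {K M L ι : Type*} [Field K] [AddCommGroup M] [Module K M] [AddCommGroup L] [Module K L]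

lemma map_zero_exterior (a : ExteriorAlgebra K M) :
    ExteriorAlgebra.map (0 : M →ₗ[K] M) a =
      algebraMap K _ (ExteriorAlgebra.algebraMapInv a) := by
  induction a using exterior_induction with
  | hr r => rw [AlgHom.commutes, AlgHom.commutes]; rfl
  | hadd x y hx hy => simp only [map_add, hx, hy]
  | hmul m x hx =>
    rw [algebraMapInv_ι_mul, map_mul, ExteriorAlgebra.map_apply_ι, LinearMap.zero_apply, map_zero,
      zero_mul, map_zero]

/-- A form which is killed by all contractions has degree zero. -/
theorem exists_one_tmul_of_contractLeft_eq_zero [Finite ι] (b : Module.Basis ι K M)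
    (z : ExteriorAlgebra K M ⊗[K] L)
    (hz : ∀ i, LinearMap.rTensor L (CliffordAlgebra.contractLeft (Q := (0 : QuadraticForm K M))
      (b.coord i)) z = 0) :
    ∃ p : L, z = 1 ⊗ₜ p := by
  classical
  have := Fintype.ofFinite ι
  let f : Finset ι → M →ₗ[K] M := fun S => LinearMap.id - ∑ i ∈ S, (b.coord i).smulRight (b i)
  have hf : ∀ S v, f S v = v - ∑ i ∈ S, b.coord i v • b i := fun S v => by
    simp [f, LinearMap.sum_apply]
  -- The map f S kills the basis vectors in S. Adding one vector composes it with f {i}, which acts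
  -- on forms as the identity minus a term through the contraction with the i-th coordinate, and so
  -- fixes z. For S everything f S is zero, which projects forms to degree zero.
  have h1 : ∀ S, LinearMap.rTensor L (ExteriorAlgebra.map (f S)).toLinearMap z = z := by
    intro S
    induction S using Finset.induction_on with
    | empty =>
      have : f ∅ = LinearMap.id := by simp [f]
      rw [this, ExteriorAlgebra.map_id]
      exact LinearMap.congr_fun (LinearMap.rTensor_id _ _) z
    | insert i S hi ih =>
      have e1 : f (insert i S) = f {i} ∘ₗ f S := by
        refine LinearMap.ext fun v => ?_
        have e2 : b.coord i (f S v) = b.coord i v := by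
          rw [hf, map_sub, map_sum, Finset.sum_eq_zero, sub_zero]
          intro j hj
          rw [map_smul, b.coord_apply i (b j), b.repr_self, Finsupp.single_apply, if_neg, smul_zero]
          rintro rfl
          exact hi hj
        rw [LinearMap.comp_apply, hf {i}, Finset.sum_singleton, e2, hf, hf, Finset.sum_insert hi]
        abel
      have e3 : ∀ w : ExteriorAlgebra K M ⊗[K] L,
          LinearMap.rTensor L (ExteriorAlgebra.map (f {i})).toLinearMap w =
          w - LinearMap.rTensor L (LinearMap.mulLeft K (ExteriorAlgebra.ι K (b i)))
            (LinearMap.rTensor L (CliffordAlgebra.contractLeft (Q := (0 : QuadraticForm K M))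
              (b.coord i)) w) := by
        intro w
        induction w using TensorProduct.induction_on with
        | zero => simp
        | add x y hx hy => simp only [map_add, hx, hy]; abel
        | tmul a p =>
          have := map_reflection (f {i}) (b.coord i) (b i)
            (fun v => by rw [hf, Finset.sum_singleton]) a
          simp only [LinearMap.rTensor_tmul, AlgHom.toLinearMap_apply, this, TensorProduct.sub_tmul,
            LinearMap.mulLeft_apply]
      have e4 : LinearMap.rTensor L (ExteriorAlgebra.map (f {i} ∘ₗ f S)).toLinearMap z =
          LinearMap.rTensor L (ExteriorAlgebra.map (f {i})).toLinearMap
            (LinearMap.rTensor L (ExteriorAlgebra.map (f S)).toLinearMap z) := by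
        rw [← ExteriorAlgebra.map_comp_map, ← LinearMap.comp_apply, ← LinearMap.rTensor_comp]
        rfl
      rw [e1, e4, ih, e3, hz, map_zero, sub_zero]
  have h2 := h1 Finset.univ
  have h3 : f Finset.univ = 0 := LinearMap.ext fun v => by
    rw [hf, LinearMap.zero_apply, sub_eq_zero]
    exact (b.sum_repr v).symm
  rw [h3] at h2
  rw [← h2]
  generalize z = w
  induction w using TensorProduct.induction_on with
  | zero => exact ⟨0, by simp⟩
  | add x y hx hy =>
    obtain ⟨p, hp⟩ := hx
    obtain ⟨q, hq⟩ := hy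
    exact ⟨p + q, by rw [map_add, hp, hq, TensorProduct.tmul_add]⟩
  | tmul a p =>
    refine ⟨ExteriorAlgebra.algebraMapInv a • p, ?_⟩
    rw [LinearMap.rTensor_tmul, AlgHom.toLinearMap_apply, map_zero_exterior,
      Algebra.algebraMap_eq_smul_one, TensorProduct.smul_tmul]

end Exterior

lemma functionPart_tmul (n : ℕ) (a : ExteriorAlgebra ℂ (cartan n)) (p : polyRep n) :
    functionPart n (a ⊗ₜ p) = ExteriorAlgebra.algebraMapInv a • p := rfl

lemma functionPart_scal (n : ℕ) (p : polyRep n) : functionPart n (scal n p) = p := by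
  rw [scal_apply, functionPart_tmul, map_one, one_smul]

lemma scal_injective (n : ℕ) : Function.Injective (scal n) :=
  Function.LeftInverse.injective (functionPart_scal n)

lemma mem_invPoly_of_scal_mem (n : ℕ) {p : polyRep n} (h : scal n p ∈ stableH n) :
    p ∈ invPoly n := by
  rw [mem_stableH] at h
  rw [mem_invPoly]
  intro σ
  apply scal_injective
  rw [← permForms_scal, h]

/-- An invariant form which is killed by all `delta`s is an invariant polynomial. -/
theorem exists_scal_of_delta_eq_zero (n : ℕ) {y : Forms n} (hy : y ∈ stableH n)
    (h : ∀ k, delta n k y = 0) : ∃ p ∈ invPoly n, y = scal n p := by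
  obtain ⟨p, hp⟩ := exists_one_tmul_of_contractLeft_eq_zero (Module.finBasis ℂ (cartan n)) y
    (fun i => by
      refine (ctr_eq_sum n _ hy).trans (Finset.sum_eq_zero fun k _ => ?_)
      rw [h, mul_zero])
  refine ⟨p, mem_invPoly_of_scal_mem n ?_, hp⟩
  rw [scal_apply, ← hp]
  exact hy

/-- The homotopy formula for the odd derivation δₖ, whose value on ωₖ is 1. -/
lemma dualForm_mul_delta (n : ℕ) (k : Fin (n - 1)) {y : Forms n} (hy : y ∈ stableH n) :
    dualForm n k * delta n k y + delta n k (dualForm n k * y) = y := by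
  rw [delta_mul n k (dualForm_mem n k) hy, delta_dualForm, if_pos rfl, one_mul, hat_dualForm]
  have : ∀ a b : Forms n, a * b + (y + -a * b) = y := fun a b => by
    have : -a * b = -(a * b) := neg_mul a b
    rw [this]
    abel
  exact this _ _

theorem stableH_induction (n : ℕ) {C : Forms n → Prop} (hs : ∀ p ∈ invPoly n, C (scal n p))
    (hadd : ∀ y z, C y → C z → C (y + z))
    (hmul : ∀ k, ∀ y ∈ stableH n, C y → C (dualForm n k * y)) {y : Forms n}
    (hy : y ∈ stableH n) : C y := by
  -- Induction on the set of δ's that may act nontrivially. Both δₖ y and δₖ(ωₖ y) are killed by δₖ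
  -- and still by the δ's outside the set.
  have key : ∀ (S : Finset (Fin (n - 1))) (y : Forms n), y ∈ stableH n →
      (∀ k ∉ S, delta n k y = 0) → C y := by
    intro S
    induction S using Finset.induction_on with
    | empty =>
      intro y hy h
      obtain ⟨p, hp, rfl⟩ := exists_scal_of_delta_eq_zero n hy fun k => h k (Finset.notMem_empty k)
      exact hs p hp
    | insert k S hk ih =>
      intro y hy h
      rw [← dualForm_mul_delta n k hy]
      have e : ∀ j, j ∉ S → delta n j (delta n k y) = 0 := by
        intro j hj
        by_cases hjk : j = k
        · rw [hjk, delta_delta]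
        · rw [delta_anticomm, h j (by simp [hjk, hj]), map_zero, neg_zero]
      refine hadd _ _ (hmul k _ (delta_mem n k hy) (ih _ (delta_mem n k hy) e)) ?_
      refine ih _ (delta_mem n k (mul_mem (dualForm_mem n k) hy)) fun j hj => ?_
      by_cases hjk : j = k
      · rw [hjk, delta_delta]
      · rw [delta_anticomm, delta_mul n j (dualForm_mem n k) hy, delta_dualForm, if_neg hjk,
          h j (by simp [hjk, hj]), mul_zero, zero_mul, add_zero, map_zero, neg_zero]
  exact key Finset.univ y hy fun k hk => absurd (Finset.mem_univ k) hk

/-! ## Dunkl operators applied to the Vandermonde determinant -/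

/-- A swap does not raise the degree and division by a linear form lowers it by one. Truncated
subtraction is harmless: in degree zero the divided difference is constant. -/
lemma totalDegree_dd_le (n : ℕ) (i j : Fin n) (p : polyRep n) :
    (dd n i j p : MvPolynomial (Fin n) ℂ).totalDegree ≤
      (p : MvPolynomial (Fin n) ℂ).totalDegree - 1 := by
  by_cases h0 : dd n i j p = 0
  · rw [h0]
    simp
  have hij : i ≠ j := by
    rintro rfl
    exact h0 (dd_self n i p)
  have h1 := congrArg (Subtype.val) (dd_spec n i j p)
  have h2 : (MvPolynomial.X i - MvPolynomial.X j) * (dd n i j p : MvPolynomial (Fin n) ℂ) =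
      MvPolynomial.rename (Equiv.swap i j) (p : MvPolynomial (Fin n) ℂ) -
        (p : MvPolynomial (Fin n) ℂ) := h1
  have h3 := congrArg MvPolynomial.totalDegree h2
  rw [MvPolynomial.totalDegree_mul_of_isDomain (X_sub_X_ne_zero n hij)
    (fun h => h0 (Subtype.ext h))] at h3
  have h4 := MvPolynomial.totalDegree_sub
    (MvPolynomial.rename (Equiv.swap i j) (p : MvPolynomial (Fin n) ℂ)) p
  have h5 := MvPolynomial.totalDegree_rename_le (Equiv.swap i j) (p : MvPolynomial (Fin n) ℂ)
  have h6 : (MvPolynomial.X i - MvPolynomial.X j : MvPolynomial (Fin n) ℂ).totalDegree ≠ 0 := by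
    rw [Ne, MvPolynomial.totalDegree_eq_zero_iff_eq_C]
    intro h
    have h7 := congrArg (MvPolynomial.eval (Pi.single i (1 : ℂ))) h
    have h8 := congrArg (MvPolynomial.eval (0 : Fin n → ℂ)) h
    simp only [map_sub, MvPolynomial.eval_X, MvPolynomial.eval_C, Pi.single_eq_same,
      Pi.single_eq_of_ne hij.symm, Pi.zero_apply, sub_zero] at h7 h8
    exact one_ne_zero (h7.trans h8.symm)
  rw [max_eq_right h5] at h4
  omega

lemma totalDegree_dunkl_le (n : ℕ) (i : Fin n) (p : polyRep n) :
    (dunkl n i p : MvPolynomial (Fin n) ℂ).totalDegree ≤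
      (p : MvPolynomial (Fin n) ℂ).totalDegree - 1 := by
  rw [dunkl_apply, AddSubmonoidClass.coe_finsetSum]
  exact MvPolynomial.totalDegree_finsetSum_le fun j _ => totalDegree_dd_le n i j p

lemma totalDegree_vandermonde_le (n : ℕ) :
    (vandermonde n : MvPolynomial (Fin n) ℂ).totalDegree ≤ n.choose 2 := by
  have e : (vandermonde n : MvPolynomial (Fin n) ℂ) =
      ∏ i, ∏ j ∈ Finset.Ioi i, (MvPolynomial.X i - MvPolynomial.X j) := by
    rw [vandermonde, SubmonoidClass.coe_finsetProd]
    refine Finset.prod_congr rfl fun i _ => ?_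
    rw [SubmonoidClass.coe_finsetProd]
    rfl
  rw [e]
  refine (MvPolynomial.totalDegree_finsetProd _ _).trans ?_
  have h1 : ∀ i : Fin n, (∏ j ∈ Finset.Ioi i,
      (MvPolynomial.X i - MvPolynomial.X j : MvPolynomial (Fin n) ℂ)).totalDegree ≤
      n - 1 - i := by
    intro i
    refine (MvPolynomial.totalDegree_finsetProd _ _).trans ?_
    rw [← Fin.card_Ioi, Finset.card_eq_sum_ones]
    refine Finset.sum_le_sum fun j _ => ?_
    refine (MvPolynomial.totalDegree_sub _ _).trans ?_
    simp [MvPolynomial.totalDegree_X]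
  refine (Finset.sum_le_sum fun i _ => h1 i).trans ?_
  rw [Fin.sum_univ_eq_sum_range (fun i => n - 1 - i) n, Finset.sum_range_reflect (fun i => i) n,
    Finset.sum_range_id, Nat.choose_two_right]

/-- Up to a sign W is a Vandermonde determinant in the x̃ᵢ, where a swap exchanges two rows. -/
lemma permPoly_swap_vandermonde (n : ℕ) {i j : Fin n} (h : i ≠ j) :
    permPoly n (Equiv.swap i j) (vandermonde n) = -vandermonde n := by
  have e : vandermonde n = (∏ i : Fin n, ∏ j ∈ Finset.Ioi i, (-1 : polyRep n)) *
      (Matrix.vandermonde (xTilde n)).det := by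
    rw [Matrix.det_vandermonde, vandermonde, ← Finset.prod_mul_distrib]
    refine Finset.prod_congr rfl fun i _ => ?_
    rw [← Finset.prod_mul_distrib]
    refine Finset.prod_congr rfl fun j _ => ?_
    rw [xDiff_eq]
    ring
  have h1 : permPoly n (Equiv.swap i j) (Matrix.vandermonde (xTilde n)).det =
      -(Matrix.vandermonde (xTilde n)).det := by
    rw [AlgHom.map_det]
    have : (permPoly n (Equiv.swap i j)).mapMatrix (Matrix.vandermonde (xTilde n)) =
        (Matrix.vandermonde (xTilde n)).submatrix (Equiv.swap i j) id := by
      refine Matrix.ext fun a b => ?_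
      rw [AlgHom.mapMatrix_apply, Matrix.map_apply, Matrix.vandermonde_apply, map_pow,
        permPoly_xTilde]
      rfl
    rw [this, Matrix.det_permute, Equiv.Perm.sign_swap h]
    simp only [Units.val_neg, Units.val_one, Int.cast_neg, Int.cast_one]
    ring
  rw [e, map_mul, h1, map_prod]
  simp only [map_prod, map_neg, map_one]
  ring

lemma vandermonde_ne_zero (n : ℕ) : vandermonde n ≠ 0 :=
  Finset.prod_ne_zero_iff.2 fun _ _ => Finset.prod_ne_zero_iff.2 fun _ hj =>
    xDiff_ne_zero n (Finset.mem_Ioi.1 hj).ne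

/-- The span of the results of applying `k` Dunkl operators to the Vandermonde determinant. -/
noncomputable def wordSpan (n k : ℕ) : Submodule ℂ (polyRep n) :=
  Submodule.span ℂ {p | ∃ l : List (Fin n), l.length = k ∧
    p = (l.map (dunkl n)).prod (vandermonde n)}

lemma dunkl_wordSpan (n k : ℕ) (i : Fin n) {p : polyRep n} (hp : p ∈ wordSpan n k) :
    dunkl n i p ∈ wordSpan n (k + 1) := by
  induction hp using Submodule.span_induction with
  | zero => rw [map_zero]; exact zero_mem _
  | add a b _ _ ha hb => rw [map_add]; exact add_mem ha hb
  | smul c a _ ha => rw [map_smul]; exact Submodule.smul_mem _ _ ha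
  | mem p hp =>
    obtain ⟨l, rfl, rfl⟩ := hp
    exact Submodule.subset_span ⟨i :: l, by simp, by simp⟩

lemma totalDegree_word_le (n : ℕ) (l : List (Fin n)) :
    ((l.map (dunkl n)).prod (vandermonde n) : MvPolynomial (Fin n) ℂ).totalDegree ≤
      n.choose 2 - l.length := by
  induction l with
  | nil => simpa using totalDegree_vandermonde_le n
  | cons i l ih =>
    rw [List.map_cons, List.prod_cons, Module.End.mul_apply, List.length_cons]
    have := totalDegree_dunkl_le n i ((l.map (dunkl n)).prod (vandermonde n))
    omega

lemma exists_algebraMap_of_totalDegree (n : ℕ) {p : polyRep n}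
    (h : (p : MvPolynomial (Fin n) ℂ).totalDegree = 0) : ∃ c : ℂ, p = algebraMap ℂ _ c :=
  ⟨_, Subtype.ext (MvPolynomial.totalDegree_eq_zero_iff_eq_C.1 h)⟩

lemma exists_algebraMap_of_mem_wordSpan (n k : ℕ) (hk : n.choose 2 ≤ k) {p : polyRep n}
    (hp : p ∈ wordSpan n k) : ∃ c : ℂ, p = algebraMap ℂ _ c := by
  induction hp using Submodule.span_induction with
  | zero => exact ⟨0, (map_zero _).symm⟩
  | add a b _ _ ha hb =>
    obtain ⟨c, rfl⟩ := ha
    obtain ⟨d, rfl⟩ := hb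
    exact ⟨c + d, (map_add _ _ _).symm⟩
  | smul r a _ ha =>
    obtain ⟨c, rfl⟩ := ha
    exact ⟨r * c, by rw [map_mul, Algebra.smul_def]⟩
  | mem p hp =>
    obtain ⟨l, rfl, rfl⟩ := hp
    apply exists_algebraMap_of_totalDegree
    have := totalDegree_word_le n l
    omega

/-- Distinct natural numbers sum to at least 0 + 1 + ⋯ + (n - 1). -/
lemma choose_two_le_sum {n : ℕ} {f : Fin n → ℕ} (hf : Function.Injective f) :
    n.choose 2 ≤ ∑ i, f i := by
  have hf' : Function.Injective fun i => (f i : ℤ) := Nat.cast_injective.comp hf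
  have h1 := Finset.sum_range_le_sum (s := Finset.univ.map ⟨_, hf'⟩) (c := 0) (by
    intro x hx
    simp only [Finset.mem_map, Finset.mem_univ, Function.Embedding.coeFn_mk, true_and] at hx
    obtain ⟨i, rfl⟩ := hx
    positivity)
  rw [Finset.card_map, Finset.card_univ, Fintype.card_fin, Finset.sum_map] at h1
  simp only [zero_add, Function.Embedding.coeFn_mk] at h1
  rw [Nat.choose_two_right, ← Finset.sum_range_id]
  rw [← Nat.cast_le (α := ℤ)]
  push_cast
  exact h1

lemma permPoly_word (n : ℕ) (σ : Equiv.Perm (Fin n)) (l : List (Fin n)) (p : polyRep n) :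
    permPoly n σ ((l.map (dunkl n)).prod p) =
      ((l.map σ).map (dunkl n)).prod (permPoly n σ p) := by
  induction l with
  | nil => rfl
  | cons i l ih =>
    simp only [List.map_cons, List.prod_cons, Module.End.mul_apply] at ih ⊢
    rw [permPoly_dunkl, ih]

lemma word_perm (n : ℕ) {l l' : List (Fin n)} (h : l.Perm l') :
    (l.map (dunkl n)).prod = (l'.map (dunkl n)).prod := by
  apply (h.map (dunkl n)).prod_eq'
  rw [List.pairwise_map]
  exact List.pairwise_of_forall fun i j => dunkl_commute n i j

/-- In a word shorter than n(n-1)/2 two indices occur equally often. Swapping them preserves the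
word, because Dunkl operators commute, and negates W, so the average is its own negative. -/
lemma avgPoly_word (n : ℕ) (l : List (Fin n)) (hl : l.length < n.choose 2) :
    avgPoly n ((l.map (dunkl n)).prod (vandermonde n)) = 0 := by
  obtain ⟨i, j, hc, hij⟩ : ∃ i j, l.count i = l.count j ∧ i ≠ j := by
    by_contra h
    push Not at h
    have h1 := choose_two_le_sum (f := fun i => l.count i) fun i j e => h i j e
    have h2 : ∑ i, l.count i = l.length := by
      have := Multiset.sum_count_eq_card (s := Finset.univ) (m := (l : Multiset (Fin n)))
        fun a _ => Finset.mem_univ a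
      simpa using this
    omega
  have h1 : permPoly n (Equiv.swap i j) ((l.map (dunkl n)).prod (vandermonde n)) =
      -(l.map (dunkl n)).prod (vandermonde n) := by
    rw [permPoly_word, permPoly_swap_vandermonde n hij, map_neg]
    have : (l.map (Equiv.swap i j)).Perm l := by
      rw [List.perm_iff_count]
      intro k
      have e : (l.map (Equiv.swap i j)).count k = l.count (Equiv.swap i j k) := by
        have := List.count_map_of_injective l _ (Equiv.swap i j).injective (Equiv.swap i j k)
        rwa [Equiv.swap_apply_self] at this
      rw [e]
      by_cases h1 : k = i
      · rw [h1, Equiv.swap_apply_left, hc]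
      · by_cases h2 : k = j
        · rw [h2, Equiv.swap_apply_right, hc]
        · rw [Equiv.swap_apply_of_ne_of_ne h1 h2]
    rw [word_perm n this]
  generalize (l.map (dunkl n)).prod (vandermonde n) = p at h1
  have h2 : avgPoly n (permPoly n (Equiv.swap i j) p) = avgPoly n p := by
    rw [avgPoly_apply, avgPoly_apply]
    congr 1
    simp only [permPoly_permPoly]
    exact Equiv.sum_comp (Equiv.mulRight (Equiv.swap i j)) (fun τ => permPoly n τ p)
  rw [h1, map_neg] at h2
  have h3 : (2 : ℂ) • avgPoly n p = 0 := by
    rw [show (2 : ℂ) = 1 + 1 by norm_num, add_smul, one_smul]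
    nth_rewrite 1 [← h2]
    exact neg_add_cancel _
  exact (smul_eq_zero_iff_right (by norm_num)).1 h3

lemma dunklVec_basisProj (n : ℕ) (i : Fin n) : dunklVec n (basisProj n i) = dunkl n i := by
  rw [dunklVec]
  simp only [coord_basisProj]
  rw [sum_indicator_sub_smul (M := Module.End ℂ (polyRep n)) (dunkl n) i, sum_dunkl, smul_zero]
  exact sub_zero (dunkl n i)

lemma dunklVec_word_mem (n : ℕ) (w : List (cartan n)) :
    (w.map (dunklVec n)).prod (vandermonde n) ∈ wordSpan n w.length := by
  induction w with
  | nil => exact Submodule.subset_span ⟨[], rfl, rfl⟩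
  | cons v w ih =>
    rw [List.map_cons, List.prod_cons, Module.End.mul_apply, dunklVec, LinearMap.sum_apply]
    exact sum_mem fun i _ => Submodule.smul_mem _ _ (dunkl_wordSpan n _ i ih)

lemma form_neg_mul {n : ℕ} (y z : Forms n) : -y * z = -(y * z) :=
  eq_neg_of_add_eq_zero_left (by rw [← add_mul, neg_add_cancel, zero_mul])

/-! ## Forms with coefficients in a subspace -/

/-- Forms with coefficients in the subspace `S`. -/
noncomputable abbrev formsIn (n : ℕ) (S : Submodule ℂ (polyRep n)) : Submodule ℂ (Forms n) :=
  LinearMap.range (LinearMap.lTensor (ExteriorAlgebra ℂ (cartan n)) S.subtype)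

lemma tmul_mem_formsIn (n : ℕ) (S : Submodule ℂ (polyRep n)) (a : ExteriorAlgebra ℂ (cartan n))
    {p : polyRep n} (hp : p ∈ S) : a ⊗ₜ p ∈ formsIn n S :=
  ⟨a ⊗ₜ ⟨p, hp⟩, rfl⟩

lemma formsIn_le (n : ℕ) {S : Submodule ℂ (polyRep n)} {M : Submodule ℂ (Forms n)}
    (h : ∀ a, ∀ p ∈ S, a ⊗ₜ p ∈ M) : formsIn n S ≤ M := by
  rintro _ ⟨z, rfl⟩
  induction z using TensorProduct.induction_on with
  | zero => rw [map_zero]; exact zero_mem _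
  | add x y hx hy => rw [map_add]; exact add_mem hx hy
  | tmul a p => exact h a p p.2

lemma formsIn_mono (n : ℕ) {S T : Submodule ℂ (polyRep n)} (h : S ≤ T) :
    formsIn n S ≤ formsIn n T :=
  formsIn_le n fun a _ hp => tmul_mem_formsIn n T a (h hp)

lemma onCoeff_mem_formsIn (n : ℕ) {S T : Submodule ℂ (polyRep n)} (f : Module.End ℂ (polyRep n))
    (h : ∀ p ∈ S, f p ∈ T) {y : Forms n} (hy : y ∈ formsIn n S) : onCoeff n f y ∈ formsIn n T :=
  formsIn_le n (M := (formsIn n T).comap (onCoeff n f))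
    (fun a p hp => tmul_mem_formsIn n T a (h p hp)) hy

lemma ctr_mem_formsIn (n : ℕ) {S : Submodule ℂ (polyRep n)} (d : Module.Dual ℂ (cartan n))
    {y : Forms n} (hy : y ∈ formsIn n S) : ctr n d y ∈ formsIn n S :=
  formsIn_le n (M := (formsIn n S).comap (ctr n d))
    (fun _ _ hp => tmul_mem_formsIn n S _ hp) hy

lemma functionPart_mem (n : ℕ) {S : Submodule ℂ (polyRep n)} {y : Forms n}
    (hy : y ∈ formsIn n S) : functionPart n y ∈ S :=
  formsIn_le n (M := S.comap (functionPart n)) (fun _ _ hp => S.smul_mem _ hp) hy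

lemma partialNeg_mem_formsIn (n N : ℕ) {S : ℕ → Submodule ℂ (polyRep n)}
    (h : ∀ k i, ∀ p ∈ S k, dunkl n i p ∈ S (k + 1)) (k : ℕ) {y : Forms n}
    (hy : y ∈ formsIn n (S k)) : partialNeg n N y ∈ formsIn n (S (k + N)) := by
  have h1 : ∀ i, ∀ p ∈ S k, (dunkl n i ^ N) p ∈ S (k + N) := by
    intro i p hp
    induction N with
    | zero => exact hp
    | succ N ih =>
      rw [pow_succ', Module.End.mul_apply, ← add_assoc]
      exact h _ i _ ih
  rw [partialNeg_apply]
  exact sum_mem fun i _ => ctr_mem_formsIn n _ (onCoeff_mem_formsIn n _ (h1 i) hy)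

lemma delta_mem_formsIn (n : ℕ) (j : Fin (n - 1)) {S : ℕ → Submodule ℂ (polyRep n)}
    (h : ∀ k i, ∀ p ∈ S k, dunkl n i p ∈ S (k + 1)) (k : ℕ) {y : Forms n}
    (hy : y ∈ formsIn n (S k)) : delta n j y ∈ formsIn n (S (k + (j + 1))) :=
  Submodule.smul_mem _ _ (partialNeg_mem_formsIn n _ h k hy)

/-! ## The Vandermonde form -/

lemma ι_mul_prod_eq_zero {R M : Type*} [CommRing R] [AddCommGroup M] [Module R M] {l : List M}
    {m : M} (h : m ∈ l) :
    ExteriorAlgebra.ι R m * (l.map (ExteriorAlgebra.ι R)).prod = 0 := by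
  induction l with
  | nil => simp at h
  | cons v l ih =>
    rw [List.map_cons, List.prod_cons, ← mul_assoc]
    rcases List.mem_cons.1 h with rfl | h
    · rw [ExteriorAlgebra.ι_sq_zero, zero_mul]
    · rw [ι_mul_ι_comm, neg_mul, mul_assoc, ih h, mul_zero, neg_zero]

lemma finRange_tail_spec (n : ℕ) (i : Fin n) (h : (i : ℕ) ≠ 0) : i ∈ (List.finRange n).tail := by
  obtain ⟨m, rfl⟩ : ∃ m, n = m + 1 := ⟨n - 1, by have := i.pos; omega⟩
  rw [List.finRange_succ, List.tail_cons]
  exact List.mem_map.2 ⟨i.pred (fun e => h (by rw [e]; rfl)), List.mem_finRange _, by simp⟩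

lemma ne_zero_of_mem_finRange_tail (n : ℕ) (i : Fin n) (h : i ∈ (List.finRange n).tail) :
    (i : ℕ) ≠ 0 := by
  obtain ⟨m, rfl⟩ : ∃ m, n = m + 1 := ⟨n - 1, by have := i.pos; omega⟩
  rw [List.finRange_succ, List.tail_cons] at h
  obtain ⟨j, -, rfl⟩ := List.mem_map.1 h
  simp

lemma ι_mul_top (n : ℕ) (v : cartan n) : ExteriorAlgebra.ι ℂ v *
    ((List.finRange n).tail.map fun i => ExteriorAlgebra.ι ℂ (basisProj n i)).prod = 0 := by
  have h0 : ((List.finRange n).tail.map fun i => ExteriorAlgebra.ι ℂ (basisProj n i)) =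
      ((List.finRange n).tail.map (basisProj n)).map (ExteriorAlgebra.ι ℂ) := by
    rw [List.map_map]
    rfl
  have h1 : ∀ i : Fin n, (i : ℕ) ≠ 0 → ExteriorAlgebra.ι ℂ (basisProj n i) *
      ((List.finRange n).tail.map fun i => ExteriorAlgebra.ι ℂ (basisProj n i)).prod = 0 := by
    intro i hi
    rw [h0]
    exact ι_mul_prod_eq_zero (List.mem_map.2 ⟨i, finRange_tail_spec n i hi, rfl⟩)
  have h2 : ∀ i : Fin n, ExteriorAlgebra.ι ℂ (basisProj n i) *
      ((List.finRange n).tail.map fun i => ExteriorAlgebra.ι ℂ (basisProj n i)).prod = 0 := by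
    intro i
    by_cases hi : (i : ℕ) = 0
    · have e : basisProj n i = -∑ j ∈ Finset.univ.erase i, basisProj n j := by
        rw [eq_neg_iff_add_eq_zero, Finset.add_sum_erase _ _ (Finset.mem_univ i), sum_basisProj]
      rw [e, map_neg, map_sum, neg_mul, Finset.sum_mul, Finset.sum_eq_zero, neg_zero]
      intro j hj
      apply h1
      intro h
      exact Finset.ne_of_mem_erase hj (Fin.ext (h.trans hi.symm))
    · exact h1 i hi
  rw [← sum_coord_smul_basisProj n v, map_sum, Finset.sum_mul]
  refine Finset.sum_eq_zero fun i _ => ?_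
  rw [map_smul, smul_mul_assoc, h2, smul_zero]

lemma oneForm_mul_vandermondeForm (n : ℕ) (v : cartan n) : oneForm n v * vandermondeForm n = 0 := by
  rw [vandermondeForm, oneForm_mul_tmul, ι_mul_top, TensorProduct.zero_tmul]

lemma dualForm_mul_vandermondeForm (n : ℕ) (k : Fin (n - 1)) :
    dualForm n k * vandermondeForm n = 0 := by
  simp only [dualForm, genForm, Finset.sum_mul, Finset.mul_sum, mul_assoc,
    oneForm_mul_vandermondeForm, mul_zero, Finset.sum_const_zero]

/-- A reflection acts on a top form by -1: contracting the relation (eᵢ - eⱼ) ∧ a = 0 evaluates the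
correction term as 2a. -/
lemma map_swap_top (n : ℕ) {i j : Fin n} (h : i ≠ j) {a : ExteriorAlgebra ℂ (cartan n)}
    (ha : ∀ v, ExteriorAlgebra.ι ℂ v * a = 0) :
    ExteriorAlgebra.map (permCartan n (Equiv.swap i j)) a = -a := by
  rw [map_reflection _ _ _ (permCartan_swap n h)]
  have h1 := congrArg (CliffordAlgebra.contractLeft (coord n i - coord n j))
    (ha (basisProj n i - basisProj n j))
  rw [contractLeft_ι_mul', map_zero, sub_eq_zero] at h1
  rw [← h1]
  have h2 : (coord n i - coord n j) (basisProj n i - basisProj n j) = 2 := by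
    simp only [LinearMap.sub_apply, map_sub, coord_basisProj, if_neg h, if_neg h.symm, if_true]
    ring
  rw [h2, two_smul]
  abel

lemma vandermondeForm_mem (n : ℕ) : vandermondeForm n ∈ stableH n := by
  rw [mem_stableH]
  intro σ
  induction σ using Equiv.Perm.swap_induction_on with
  | one => rw [vandermondeForm, permForms_tmul, map_permCartan_one, permPoly_one]
  | swap_mul σ i j h ih =>
    rw [← permForms_mul, ih, vandermondeForm, permForms_tmul, map_swap_top n h (ι_mul_top n),
      permPoly_swap_vandermonde n h, TensorProduct.neg_tmul, TensorProduct.tmul_neg, neg_neg]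

lemma ctr_prod_oneForm_mul_scal (n : ℕ) (d : Module.Dual ℂ (cartan n)) (p : polyRep n)
    (l : List (cartan n)) (h : ∀ v ∈ l, d v = 0) :
    ctr n d ((l.map (oneForm n)).prod * scal n p) = 0 := by
  induction l with
  | nil => rw [List.map_nil, List.prod_nil, one_mul, ctr_scal]
  | cons v l ih =>
    rw [List.map_cons, List.prod_cons, mul_assoc, ctr_oneForm_mul, h v (by simp), zero_smul,
      ih fun w hw => h w (by simp [hw]), mul_zero, sub_zero]

/-- The functionals `coord i - coord 0` are dual to the vectors eᵢ with i ≠ 0, so contraction with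
them strips the factors one by one. -/
lemma prod_oneForm_mul_scal_ne_zero (n : ℕ) (hn : 0 < n) {p : polyRep n} (hp : p ≠ 0)
    (l : List (Fin n)) (hl : l.Nodup) (h : ∀ i ∈ l, (i : ℕ) ≠ 0) :
    ((l.map (basisProj n)).map (oneForm n)).prod * scal n p ≠ 0 := by
  induction l with
  | nil =>
    rw [List.map_nil, List.map_nil, List.prod_nil, one_mul]
    intro e
    exact hp (scal_injective n (e.trans (map_zero _).symm))
  | cons i l ih =>
    intro e
    apply ih (List.nodup_cons.1 hl).2 fun j hj => h j (by simp [hj])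
    rw [List.map_cons, List.map_cons, List.prod_cons, mul_assoc] at e
    have h0 : ∀ j : Fin n, (j : ℕ) ≠ 0 → j ≠ ⟨0, hn⟩ := fun j hj e => hj (by rw [e])
    have hi := h0 i (h i (by simp))
    have e' := congrArg (ctr n (coord n i - coord n ⟨0, hn⟩)) e
    rw [ctr_oneForm_mul, ctr_prod_oneForm_mul_scal, mul_zero, sub_zero, map_zero] at e'
    · have h1 : (coord n i - coord n ⟨0, hn⟩) (basisProj n i) = 1 := by
        simp only [LinearMap.sub_apply, coord_basisProj, if_true, if_neg hi.symm]
        ring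
      rwa [h1, one_smul] at e'
    · intro v hv
      obtain ⟨j, hj, rfl⟩ := List.mem_map.1 hv
      have h1 : i ≠ j := by
        rintro rfl
        exact (List.nodup_cons.1 hl).1 hj
      have h2 := h0 j (h j (by simp [hj]))
      simp only [LinearMap.sub_apply, coord_basisProj, if_neg h1, if_neg h2.symm]
      ring

lemma vandermondeForm_ne_zero (n : ℕ) (hn : 1 ≤ n) : vandermondeForm n ≠ 0 := by
  have h1 : ∀ l : List (Fin n), (l.map fun i => ExteriorAlgebra.ι ℂ (basisProj n i)).prod ⊗ₜ[ℂ]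
      vandermonde n = ((l.map (basisProj n)).map (oneForm n)).prod * scal n (vandermonde n) := by
    intro l
    induction l with
    | nil => rw [List.map_nil, List.map_nil, List.map_nil, List.prod_nil, List.prod_nil, one_mul]; rfl
    | cons i l ih =>
      simp only [List.map_cons, List.prod_cons]
      rw [mul_assoc, ← ih, oneForm_mul_tmul]
  rw [vandermondeForm, h1]
  exact prod_oneForm_mul_scal_ne_zero n hn (vandermonde_ne_zero n) _ (List.nodup_finRange n).tail
    (fun i hi => ne_zero_of_mem_finRange_tail n i hi)

lemma vandermondeForm_mem_formsIn (n : ℕ) : vandermondeForm n ∈ formsIn n (wordSpan n 0) :=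
  tmul_mem_formsIn n _ _ (Submodule.subset_span ⟨[], rfl, rfl⟩)

/-! ## Products of the dual forms -/

lemma deltaList_mem (n : ℕ) (l : List (Fin (n - 1))) {y : Forms n} (hy : y ∈ stableH n) :
    (l.map (delta n)).prod y ∈ stableH n := by
  induction l with
  | nil => exact hy
  | cons k l ih => exact delta_mem n k ih

lemma deltaList_mem_formsIn (n : ℕ) (l : List (Fin (n - 1))) {S : ℕ → Submodule ℂ (polyRep n)}
    (h : ∀ k i, ∀ p ∈ S k, dunkl n i p ∈ S (k + 1)) (k : ℕ) {y : Forms n}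
    (hy : y ∈ formsIn n (S k)) :
    (l.map (delta n)).prod y ∈ formsIn n (S (k + (l.map fun j : Fin (n - 1) => (j : ℕ) + 1).sum)) := by
  induction l with
  | nil => exact hy
  | cons j l ih =>
    have := delta_mem_formsIn n j h _ ih
    rw [List.map_cons (f := fun j : Fin (n - 1) => (j : ℕ) + 1), List.sum_cons,
      add_comm ((j : ℕ) + 1), ← add_assoc]
    exact this

lemma delta_deltaList (n : ℕ) (l : List (Fin (n - 1))) (k : Fin (n - 1)) (y : Forms n)
    (h : delta n k y = 0 ∨ k ∈ l) : delta n k ((l.map (delta n)).prod y) = 0 := by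
  induction l with
  | nil => simpa using h
  | cons j l ih =>
    rw [List.map_cons, List.prod_cons, Module.End.mul_apply]
    by_cases hjk : k = j
    · rw [hjk, delta_delta]
    · rw [delta_anticomm, ih, map_zero, neg_zero]
      rcases h with h | h
      · exact Or.inl h
      · exact Or.inr ((List.mem_cons.1 h).resolve_left hjk)

lemma delta_dualForm_mul_of_ne (n : ℕ) {j k : Fin (n - 1)} (h : j ≠ k) {y : Forms n}
    (hy : y ∈ stableH n) : delta n j (dualForm n k * y) = -(dualForm n k * delta n j y) := by
  rw [delta_mul n j (dualForm_mem n k) hy, delta_dualForm, if_neg h, zero_mul, zero_add,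
    hat_dualForm]
  exact form_neg_mul _ _

/-- Multiplication by ωₖ anticommutes with every δⱼ for j ≠ k, so it passes through the list to y.
-/
lemma dualForm_mul_deltaList (n : ℕ) (l : List (Fin (n - 1))) {k : Fin (n - 1)} (hk : k ∉ l)
    {y : Forms n} (hy : y ∈ stableH n) (h : dualForm n k * y = 0) :
    dualForm n k * (l.map (delta n)).prod y = 0 := by
  induction l with
  | nil => exact h
  | cons j l ih =>
    rw [List.map_cons, List.prod_cons, Module.End.mul_apply]
    have h1 := delta_dualForm_mul_of_ne n (j := j) (k := k)
      (fun e => hk (by rw [e]; exact List.mem_cons_self)) (deltaList_mem n l hy)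
    rw [ih fun h => hk (List.mem_cons_of_mem _ h), map_zero] at h1
    exact neg_eq_zero.1 h1.symm

/-- The product of the dual forms of a list. -/
noncomputable def dualProd (n : ℕ) (l : List (Fin (n - 1))) : Forms n := (l.map (dualForm n)).prod

lemma dualProd_mem (n : ℕ) (l : List (Fin (n - 1))) : dualProd n l ∈ stableH n :=
  list_prod_mem fun y hy => by
    obtain ⟨k, -, rfl⟩ := List.mem_map.1 hy
    exact dualForm_mem n k

lemma dualProd_reverse_cons (n : ℕ) (l : List (Fin (n - 1))) (j : Fin (n - 1)) :
    dualProd n (j :: l).reverse = dualProd n l.reverse * dualForm n j := by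
  rw [dualProd, List.reverse_cons, List.map_append, List.prod_append, List.map_cons, List.map_nil,
    List.prod_singleton]
  rfl

/-- In the homotopy formula the second term vanishes as long as ωⱼ kills what precedes, so y = ωⱼ δⱼ
y repeatedly. The reversal puts each ωⱼ next to its δⱼ. -/
lemma eq_dualProd_mul (n : ℕ) (l : List (Fin (n - 1))) (hl : l.Nodup) {y : Forms n}
    (hy : y ∈ stableH n) (h : ∀ k, dualForm n k * y = 0) :
    dualProd n l.reverse * (l.map (delta n)).prod y = y := by
  induction l with
  | nil => rw [dualProd, List.reverse_nil, List.map_nil, List.prod_nil, one_mul]; rfl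
  | cons j l ih =>
    rw [List.nodup_cons] at hl
    have h1 := dualForm_mul_delta n j (deltaList_mem n l hy)
    rw [dualForm_mul_deltaList n l hl.1 hy (h j), map_zero, add_zero] at h1
    rw [dualProd_reverse_cons, List.map_cons, List.prod_cons, Module.End.mul_apply, mul_assoc,
      h1]
    exact ih hl.2

lemma delta_dualProd_mul (n : ℕ) (l : List (Fin (n - 1))) {k : Fin (n - 1)} (hk : k ∉ l)
    {y : Forms n} (hy : y ∈ stableH n) (h : delta n k y = 0) : delta n k (dualProd n l * y) = 0 := by
  induction l with
  | nil => rwa [dualProd, List.map_nil, List.prod_nil, one_mul]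
  | cons j l ih =>
    have h1 : dualProd n (j :: l) * y = dualForm n j * (dualProd n l * y) := by
      rw [dualProd, List.map_cons, List.prod_cons, mul_assoc]
      rfl
    rw [h1, delta_dualForm_mul_of_ne n (fun e => hk (by rw [e]; exact List.mem_cons_self))
      (mul_mem (dualProd_mem n l) hy), ih fun h => hk (List.mem_cons_of_mem _ h), mul_zero, neg_zero]

lemma deltaList_dualProd_mul (n : ℕ) (l : List (Fin (n - 1))) (hl : l.Nodup) {y : Forms n}
    (hy : y ∈ stableH n) (h : ∀ k ∈ l, delta n k y = 0) :
    (l.map (delta n)).prod (dualProd n l.reverse * y) = y := by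
  induction l generalizing y with
  | nil => rw [dualProd, List.reverse_nil, List.map_nil, List.map_nil, List.prod_nil, List.prod_nil, one_mul]; rfl
  | cons j l ih =>
    rw [List.nodup_cons] at hl
    rw [dualProd_reverse_cons, List.map_cons, List.prod_cons, Module.End.mul_apply, mul_assoc]
    have h1 := ih hl.2 (mul_mem (dualForm_mem n j) hy) fun k hk => by
      rw [delta_dualForm_mul_of_ne n (fun e => hl.1 (by rw [← e]; exact hk)) hy, h k (by simp [hk]),
        mul_zero, neg_zero]
    have h2 := dualForm_mul_delta n j hy
    rw [h j (by simp), mul_zero, zero_add] at h2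
    rw [h1, h2]

lemma sum_finRange_succ (n : ℕ) : ((List.finRange (n - 1)).map fun j : Fin (n - 1) => (j : ℕ) + 1).sum =
    n.choose 2 := by
  have h1 : ((List.finRange (n - 1)).map fun j : Fin (n - 1) => (j : ℕ) + 1).sum =
      ∑ j : Fin (n - 1), ((j : ℕ) + 1) := by
    rw [← List.sum_ofFn, List.ofFn_eq_map]
  rw [h1, Fin.sum_univ_eq_sum_range (fun j => j + 1), Nat.choose_two_right, ← Finset.sum_range_id]
  cases n with
  | zero => rfl
  | succ n => rw [Finset.sum_range_succ' (fun i => i)]; rfl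

/-- All δ's together leave an invariant function, obtained from W by 1 + 2 + ⋯ + (n-1) = n(n-1)/2
Dunkl operators, hence a constant. It is nonzero, since W is that constant times the product of all
ω's. -/
lemma exists_deltaList_vandermondeForm (n : ℕ) (hn : 1 ≤ n) (l : List (Fin (n - 1)))
    (hl : l.Perm (List.finRange (n - 1))) :
    ∃ c : ℂ, c ≠ 0 ∧ (l.map (delta n)).prod (vandermondeForm n) = algebraMap ℂ _ c := by
  have hV := vandermondeForm_mem n
  obtain ⟨p, hp, h1⟩ := exists_scal_of_delta_eq_zero n (deltaList_mem n l hV) fun k =>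
    delta_deltaList n l k _ (Or.inr (hl.mem_iff.2 (List.mem_finRange k)))
  have h2 := deltaList_mem_formsIn n l (S := wordSpan n)
    (fun k i p hp => dunkl_wordSpan n k i hp) 0 (vandermondeForm_mem_formsIn n)
  rw [zero_add, (hl.map _).sum_eq, sum_finRange_succ, h1] at h2
  have h3 := functionPart_mem n h2
  rw [functionPart_scal] at h3
  obtain ⟨c, rfl⟩ := exists_algebraMap_of_mem_wordSpan n _ le_rfl h3
  refine ⟨c, ?_, h1.trans ((scal n).commutes c)⟩
  rintro rfl
  apply vandermondeForm_ne_zero n hn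
  rw [← eq_dualProd_mul n l (hl.nodup_iff.2 (List.nodup_finRange _)) hV
    (dualForm_mul_vandermondeForm n), h1, map_zero, map_zero, mul_zero]

/-- W is a constant times the ω's of m followed by those of l. The δ's of m strip the former and
kill the latter. -/
lemma exists_deltaList_eq_smul_dualProd (n : ℕ) (hn : 1 ≤ n) (l m : List (Fin (n - 1)))
    (hlm : (l ++ m).Perm (List.finRange (n - 1))) :
    ∃ c : ℂ, c ≠ 0 ∧ (m.map (delta n)).prod (vandermondeForm n) = c • dualProd n l := by
  have hp : (l.reverse ++ m).Perm (List.finRange (n - 1)) :=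
    ((List.reverse_perm l).append_right m).trans hlm
  have hnd := hp.nodup_iff.2 (List.nodup_finRange _)
  obtain ⟨c, hc, h1⟩ := exists_deltaList_vandermondeForm n hn _ hp
  refine ⟨c, hc, ?_⟩
  have h2 := eq_dualProd_mul n _ hnd (vandermondeForm_mem n) (dualForm_mul_vandermondeForm n)
  rw [h1, List.reverse_append, List.reverse_reverse] at h2
  have h3 : dualProd n (m.reverse ++ l) = dualProd n m.reverse * dualProd n l := by
    rw [dualProd, List.map_append, List.prod_append]
    rfl
  rw [h3, mul_assoc] at h2
  rw [← h2, deltaList_dualProd_mul n m (List.nodup_append.1 hnd).2.1]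
  · rw [← Algebra.commutes]
    exact (Algebra.smul_def c _).symm
  · exact mul_mem (dualProd_mem n l) (Subalgebra.algebraMap_mem _ c)
  · intro k hk
    apply delta_dualProd_mul n l _ (Subalgebra.algebraMap_mem _ c)
    · have : algebraMap ℂ (Forms n) c = scal n (algebraMap ℂ _ c) := ((scal n).commutes c).symm
      rw [this, delta_scal]
    · intro hkl
      exact (List.nodup_append.1 hnd).2.2 k (List.mem_reverse.2 hkl) k hk rfl

lemma exists_compl_list {m : ℕ} (l : List (Fin m)) (hl : l.Nodup) :
    ∃ l', (l ++ l').Perm (List.finRange m) := by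
  refine ⟨(List.finRange m).filter (· ∉ l), ?_⟩
  rw [List.perm_ext_iff_of_nodup _ (List.nodup_finRange m)]
  · intro a
    simp [em]
  · rw [List.nodup_append]
    refine ⟨hl, (List.nodup_finRange m).filter _, ?_⟩
    rintro a ha b hb rfl
    simp [ha] at hb

/-- Written as W hit by the δ's of the complementary list, the product has coefficients that use a
known number of Dunkl operators. This bounds its filtration degree. -/
lemma dualProd_mem_formsIn (n : ℕ) (hn : 1 ≤ n) (l : List (Fin (n - 1))) (hl : l.Nodup) :
    ∃ k, k + (l.map fun j : Fin (n - 1) => (j : ℕ) + 1).sum = n.choose 2 ∧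
      dualProd n l ∈ formsIn n (wordSpan n k) := by
  obtain ⟨m, hm⟩ := exists_compl_list l hl
  refine ⟨(m.map fun j : Fin (n - 1) => (j : ℕ) + 1).sum, ?_, ?_⟩
  · rw [← sum_finRange_succ, ← (hm.map _).sum_eq, List.map_append, List.sum_append, add_comm]
  · obtain ⟨c, hc, h⟩ := exists_deltaList_eq_smul_dualProd n hn l m hm
    have h2 := deltaList_mem_formsIn n m (S := wordSpan n)
      (fun k i p hp => dunkl_wordSpan n k i hp) 0 (vandermondeForm_mem_formsIn n)
    rw [zero_add, h] at h2
    have h3 := Submodule.smul_mem _ c⁻¹ h2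
    rwa [inv_smul_smul₀ hc] at h3

/-! ## The generators -/

lemma map_prod_anticomm {ι M : Type*} [DecidableEq ι] [AddCommGroup M] [Module ℂ M]
    (T : ι → Module.End ℂ M) (hT : ∀ i j y, T i (T j y) = -T j (T i y)) (l : List ι) {k : ι}
    (hk : k ∈ l) (y : M) :
    (l.map T).prod y = (-1 : ℂ) ^ l.idxOf k • T k (((l.erase k).map T).prod y) := by
  induction l with
  | nil => simp at hk
  | cons j l ih =>
    by_cases hjk : j = k
    · subst hjk
      simp
    · have hk' : k ∈ l := (List.mem_cons.1 hk).resolve_left (Ne.symm hjk)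
      rw [List.map_cons, List.prod_cons, Module.End.mul_apply, ih hk', List.idxOf_cons_ne _ hjk,
        List.erase_cons_tail (by simpa using hjk), List.map_cons, List.prod_cons,
        Module.End.mul_apply, map_smul, hT j k, pow_succ, mul_neg_one, smul_neg, neg_smul]

lemma range'_eq_map_finRange (m : ℕ) :
    List.range' 1 m = (List.finRange m).map fun j : Fin m => (j : ℕ) + 1 := by
  have h : (List.finRange m).map (fun j : Fin m => (j : ℕ)) = List.range m := by simp
  rw [List.range'_eq_map_range, ← h, List.map_map]
  exact List.map_congr_left fun j _ => add_comm _ _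

lemma map_partialNeg_prod (n : ℕ) (l : List (Fin (n - 1))) (y : Forms n) :
    ∃ s : ℂ, s ≠ 0 ∧ ((l.map fun j : Fin (n - 1) => (j : ℕ) + 1).map (partialNeg n)).prod y =
      s • (l.map (delta n)).prod y := by
  induction l with
  | nil => exact ⟨1, one_ne_zero, by rw [one_smul]; rfl⟩
  | cons k l ih =>
    obtain ⟨s, hs, h⟩ := ih
    refine ⟨(-1) ^ ((k : ℕ) + 1) * s, mul_ne_zero (pow_ne_zero _ (by norm_num)) hs, ?_⟩
    simp only [List.map_cons, List.prod_cons, Module.End.mul_apply]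
    rw [h, map_smul, delta_apply, smul_smul, mul_right_comm, ← mul_pow]
    norm_num

theorem xi_eq_dualForm (n : ℕ) (k : Fin (n - 1)) : xi n (k + 1) = dualForm n k := by
  have hn : 1 ≤ n := by have := k.pos; omega
  set m := (List.finRange (n - 1)).erase k with hm
  have h1 : (List.range' 1 (n - 1)).erase ((k : ℕ) + 1) =
      m.map fun j : Fin (n - 1) => (j : ℕ) + 1 := by
    rw [range'_eq_map_finRange, hm, List.map_erase]
    intro i j h
    exact Fin.ext (Nat.succ.inj h)
  obtain ⟨s, hs, h2⟩ := map_partialNeg_prod n m (vandermondeForm n)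
  obtain ⟨c, hc, h3⟩ := exists_deltaList_eq_smul_dualProd n hn [k] m
    (List.perm_cons_erase (List.mem_finRange k)).symm
  have h4 : (((List.range' 1 (n - 1)).erase ((k : ℕ) + 1)).map (partialNeg n)).prod
      (vandermondeForm n) = (s * c) • dualForm n k := by
    rw [h1, h2, h3, smul_smul, dualProd, List.map_cons, List.map_nil, List.prod_singleton]
  -- Moving ∂_{-(k+1)} to the front costs (-1)^k, and its value on ωₖ is (-1)^(k+1). The product -1
  -- explains the sign in the definition of ξ.
  have h5 : nu n = -(s * c) := by
    have h6 := map_prod_anticomm (fun j : Fin (n - 1) => partialNeg n (j + 1))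
      (fun i j => partialNeg_anticomm n _ _) (List.finRange (n - 1)) (List.mem_finRange k)
      (vandermondeForm n)
    have h7 : ∀ l : List (Fin (n - 1)), l.map (fun j : Fin (n - 1) => partialNeg n (j + 1)) =
        (l.map fun j : Fin (n - 1) => (j : ℕ) + 1).map (partialNeg n) := fun l => by
      rw [List.map_map]
      rfl
    rw [h7, h7, ← range'_eq_map_finRange, ← hm, ← h1, List.idxOf_finRange] at h6
    have h8 := delta_dualForm n k k
    rw [if_pos rfl, delta_apply] at h8
    rw [h4, map_smul, smul_smul] at h6
    have h9 : partialNeg n ((k : ℕ) + 1) (dualForm n k) = (-1 : ℂ) ^ ((k : ℕ) + 1) • 1 := by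
      rw [← h8, smul_smul, ← mul_pow]
      norm_num
    rw [h9, smul_smul] at h6
    have h10 : (-1 : ℂ) ^ (k : ℕ) * (s * c) * (-1) ^ ((k : ℕ) + 1) = -(s * c) := by
      rw [pow_succ]
      have : (-1 : ℂ) ^ (k : ℕ) * (-1) ^ (k : ℕ) = 1 := by
        rw [← mul_pow]
        norm_num
      linear_combination -(s * c) * this
    rw [h10] at h6
    rw [nu, h6, map_smul]
    have : functionPart n 1 = 1 := by
      have := functionPart_scal n 1
      rwa [map_one] at this
    rw [this]
    change MvPolynomial.constantCoeff (-(s * c) • (1 : MvPolynomial (Fin n) ℂ)) = _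
    rw [MvPolynomial.constantCoeff_smul, map_one, smul_eq_mul, mul_one]
  have hsc : s * c ≠ 0 := mul_ne_zero hs hc
  rw [xi, h4, h5, smul_smul, inv_neg, neg_neg, inv_mul_cancel₀ hsc, one_smul]

lemma partialPos_oneForm (n N : ℕ) (i : Fin n) :
    partialPos n N (oneForm n (basisProj n i)) =
      scal n (xTilde n i ^ N - (n : ℂ)⁻¹ • ∑ j, xTilde n j ^ N) := by
  have h1 : ∀ j, ctr n (coord n j) (oneForm n (basisProj n i)) =
      ((if j = i then 1 else 0) - (n : ℂ)⁻¹) • 1 := by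
    intro j
    have := ctr_scal_mul_oneForm n (coord n j) 1 (basisProj n i)
    rwa [map_one, one_mul, coord_basisProj] at this
  rw [partialPos_apply]
  simp only [h1, mul_smul_comm, mul_one]
  rw [sum_indicator_sub_smul (fun j => scal n (xTilde n j ^ N)), map_sub, map_smul, map_sum]

lemma partialPos_scal_mul (n N : ℕ) (p : polyRep n) (y : Forms n) :
    partialPos n N (scal n p * y) = scal n p * partialPos n N y := by
  rw [partialPos_mul, partialPos_scal, zero_mul, zero_add, hat_scal]

lemma partialPos_dualForm (n N : ℕ) (k : Fin (n - 1)) :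
    ∃ r ∈ invPoly n, partialPos n N (dualForm n k) = scal n r := by
  have : partialPos n N (dualForm n k) ∈ (scal n).range := by
    simp only [dualForm, genForm, map_sum, Finset.mul_sum]
    refine sum_mem fun a _ => sum_mem fun i _ => ?_
    rw [partialPos_scal_mul, partialPos_scal_mul, partialPos_oneForm, ← map_mul, ← map_mul]
    exact (AlgHom.mem_range _).2 ⟨_, rfl⟩
  obtain ⟨r, hr⟩ := (AlgHom.mem_range _).1 this
  refine ⟨r, mem_invPoly_of_scal_mem n ?_, hr.symm⟩
  have h := partialPos_mem n N (dualForm_mem n k)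
  rwa [← hr] at h

/-- The function `∂_N ξ_{k+1}`. -/
noncomputable def contractedXi (n N : ℕ) (k : Fin (n - 1)) : polyRep n :=
  functionPart n (partialPos n N (dualForm n k))

lemma partialPos_dualForm_eq (n N : ℕ) (k : Fin (n - 1)) :
    partialPos n N (dualForm n k) = scal n (contractedXi n N k) := by
  obtain ⟨r, -, h⟩ := partialPos_dualForm n N k
  rw [contractedXi, h, functionPart_scal]

lemma u_eq (n : ℕ) (k : Fin (n - 1)) : u n (k + 1) = contractedXi n 1 k := by
  rw [u, xi_eq_dualForm]
  rfl

lemma u_mem (n : ℕ) (k : Fin (n - 1)) : u n (k + 1) ∈ invPoly n := by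
  obtain ⟨r, hr, h⟩ := partialPos_dualForm n 1 k
  rwa [u_eq, contractedXi, h, functionPart_scal]

/-! ## Derivatives of a monic polynomial -/

section Derivatives

variable {A : Type*} [CommRing A]

lemma coeff_derivative_top [IsDomain A] [CharZero A] {p : A[X]} (hp : p.Monic) {j k : ℕ}
    (hk : k < p.natDegree) (hjk : k < j ∨ j = k) :
    (derivative^[j + 1] p).coeff (p.natDegree - 1 - k) =
      if j = k then (p.natDegree.descFactorial (k + 1) : A) else 0 := by
  rw [coeff_iterate_derivative]
  rcases hjk with h | rfl
  · rw [if_neg h.ne', coeff_eq_zero_of_natDegree_lt (by omega), smul_zero]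
  · have h1 : p.natDegree - 1 - j + (j + 1) = p.natDegree := by omega
    rw [if_pos rfl, h1, coeff_natDegree, hp, nsmul_one]

/-- The derivatives of a monic polynomial are linearly independent. -/
lemma eq_of_sum_derivative_eq [IsDomain A] [CharZero A] {p : A[X]} (hp : p.Monic) {a b : ℕ → A}
    (h : ∑ k ∈ Finset.range p.natDegree, C (a k) * derivative^[k + 1] p =
      ∑ k ∈ Finset.range p.natDegree, C (b k) * derivative^[k + 1] p) (k : ℕ)
    (hk : k < p.natDegree) : a k = b k := by
  induction k using Nat.strong_induction_on with
  | _ k ih =>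
  have h1 := congrArg (fun q : A[X] => q.coeff (p.natDegree - 1 - k)) h
  simp only [finsetSum_coeff, coeff_C_mul] at h1
  rw [← sub_eq_zero, ← Finset.sum_sub_distrib, Finset.sum_eq_single k] at h1
  · rw [coeff_derivative_top hp hk (Or.inr rfl), if_pos rfl, ← sub_mul] at h1
    refine sub_eq_zero.1 ((mul_eq_zero.1 h1).resolve_right ?_)
    rw [Nat.cast_eq_zero, Nat.descFactorial_eq_zero_iff_lt]
    omega
  · intro j hj hjk
    rcases lt_or_gt_of_ne hjk with hlt | hgt
    · rw [ih j hlt (Finset.mem_range.1 hj), sub_self]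
    · rw [coeff_derivative_top hp hk (Or.inl hgt), if_neg hjk, mul_zero, mul_zero, sub_zero]
  · intro h
    exact absurd (Finset.mem_range.2 hk) h

/-- Coefficients of the powers of the operator `t ↦ n - ∂ t + c(t)`, see `mul_sum_derivative`. -/
def powCoeff (n : ℕ) (c : ℕ → A) : ℕ → ℕ → A
  | 0, k => if k = 0 then 1 else 0
  | N + 1, k => ((n : A) - k - 1) * powCoeff n c N (k + 1) +
      ∑ ij ∈ Finset.HasAntidiagonal.antidiagonal k, c ij.1 * powCoeff n c N ij.2

lemma map_powCoeff {B : Type*} [CommRing B] (f : A →+* B) (n : ℕ) (c : ℕ → A) (N k : ℕ) :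
    f (powCoeff n c N k) = powCoeff n (fun j => f (c j)) N k := by
  induction N generalizing k with
  | zero => simp [powCoeff, apply_ite f]
  | succ N ih => simp [powCoeff, ih]

/-- The equation differentiated k times; each derivative of the left side costs one copy of the next
lower derivative of p, whence n - k. -/
lemma X_mul_iterate_derivative {p : A[X]} {n : ℕ} {c : ℕ → A}
    (h : X * derivative p = (n : A[X]) * p +
      ∑ j ∈ Finset.range n, C (c j) * derivative^[j + 1] p) (k : ℕ) :
    X * derivative^[k + 1] p = ((n : A[X]) - (k : A[X])) * derivative^[k] p +
      ∑ j ∈ Finset.range n, C (c j) * derivative^[j + k + 1] p := by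
  induction k with
  | zero => simpa using h
  | succ k ih =>
    have h1 := congrArg derivative ih
    simp only [derivative_mul, derivative_add, derivative_sum, derivative_X, derivative_C, zero_mul,
      zero_add, one_mul, ← Function.iterate_succ_apply' (derivative (R := A)), derivative_sub,
      derivative_natCast, sub_self] at h1
    push_cast
    have h2 : X * derivative^[k + 1 + 1] p = ((n : A[X]) - (k : A[X])) * derivative^[k + 1] p +
        ∑ j ∈ Finset.range n, C (c j) * derivative^[j + k + 1 + 1] p - derivative^[k + 1] p := by
      rw [← h1]
      ring
    rw [h2]
    have h3 : ∀ j, j + (k + 1) + 1 = j + k + 1 + 1 := fun j => by omega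
    simp only [h3]
    ring

lemma sum_range_sum_range_eq {M : Type*} [AddCommMonoid M] (n : ℕ) (F : ℕ → ℕ → M)
    (hF : ∀ j k, n ≤ j + k → F j k = 0) :
    ∑ k ∈ Finset.range n, ∑ j ∈ Finset.range n, F j k =
      ∑ m ∈ Finset.range n, ∑ ij ∈ Finset.HasAntidiagonal.antidiagonal m, F ij.1 ij.2 := by
  rw [Finset.sum_comm, ← Finset.sum_product', Finset.sum_sigma']
  symm
  apply Finset.sum_of_injOn (fun x : (_ : ℕ) × ℕ × ℕ => x.2)
  · rintro ⟨m, i, j⟩ h ⟨m', i', j'⟩ h' e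
    simp only [Finset.coe_sigma, Set.mem_sigma_iff, Finset.mem_coe, Finset.mem_range,
      Finset.HasAntidiagonal.mem_antidiagonal] at h h'
    simp only [Prod.mk.injEq] at e
    obtain ⟨rfl, rfl⟩ := e
    obtain rfl : m = m' := h.2.symm.trans h'.2
    rfl
  · rintro ⟨m, i, j⟩ h
    simp only [Finset.coe_sigma, Set.mem_sigma_iff, Finset.mem_coe, Finset.mem_range,
      Finset.HasAntidiagonal.mem_antidiagonal, Finset.mem_product] at h ⊢
    omega
  · rintro ⟨i, j⟩ _ h
    apply hF
    by_contra hlt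
    apply h
    refine ⟨⟨i + j, i, j⟩, ?_, rfl⟩
    simp only [Finset.coe_sigma, Set.mem_sigma_iff, Finset.mem_coe, Finset.mem_range,
      Finset.HasAntidiagonal.mem_antidiagonal, and_true]
    omega
  · intro _ _
    rfl

lemma X_mul_sum_derivative {p : A[X]} {n : ℕ} (hn : 0 < n) (hp : p.natDegree = n) {c : ℕ → A}
    (h : X * derivative p = (n : A[X]) * p +
      ∑ j ∈ Finset.range n, C (c j) * derivative^[j + 1] p) (N : ℕ) :
    X * ∑ k ∈ Finset.range n, C (powCoeff n c N k) * derivative^[k + 1] p =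
      C (n * powCoeff n c N 0) * p +
      ∑ k ∈ Finset.range n, C (powCoeff n c (N + 1) k) * derivative^[k + 1] p := by
  have h0 : ∀ m, n ≤ m → derivative^[m + 1] p = 0 := fun m hm =>
    iterate_derivative_eq_zero (by omega)
  have h1 : ∀ k, X * (C (powCoeff n c N k) * derivative^[k + 1] p) =
      C (((n : A) - k) * powCoeff n c N k) * derivative^[k] p +
      ∑ j ∈ Finset.range n, C (c j * powCoeff n c N k) * derivative^[j + k + 1] p := by
    intro k
    rw [mul_left_comm, X_mul_iterate_derivative h, mul_add, Finset.mul_sum]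
    congr 1
    · rw [C_mul, C_sub, C_eq_natCast, C_eq_natCast]
      ring
    · refine Finset.sum_congr rfl fun j _ => ?_
      rw [C_mul]
      ring
  rw [Finset.mul_sum, Finset.sum_congr rfl fun k _ => h1 k, Finset.sum_add_distrib,
    sum_range_sum_range_eq n (fun j k => C (c j * powCoeff n c N k) * derivative^[j + k + 1] p)
      (fun j k hjk => by rw [h0 _ hjk, mul_zero])]
  obtain ⟨m, rfl⟩ : ∃ m, n = m + 1 := ⟨n - 1, by omega⟩
  -- The shift k ↦ k + 1 splits off the term with p itself. At the other end the coefficient n - k -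
  -- 1 vanishes for k = n - 1, so both ranges can stay the same.
  have h2 : ∑ k ∈ Finset.range (m + 1),
      C ((((m + 1 : ℕ) : A) - k) * powCoeff (m + 1) c N k) * derivative^[k] p =
      C (((m + 1 : ℕ) : A) * powCoeff (m + 1) c N 0) * p +
      ∑ k ∈ Finset.range (m + 1),
        C ((((m + 1 : ℕ) : A) - k - 1) * powCoeff (m + 1) c N (k + 1)) * derivative^[k + 1] p := by
    rw [Finset.sum_range_succ', Finset.sum_range_succ (fun k =>
      C ((((m + 1 : ℕ) : A) - k - 1) * powCoeff (m + 1) c N (k + 1)) * derivative^[k + 1] p)]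
    have : ((m + 1 : ℕ) : A) - m - 1 = 0 := by push_cast; ring
    rw [this, zero_mul, C_0, zero_mul, add_zero, add_comm]
    congr 1
    · simp
    · refine Finset.sum_congr rfl fun k _ => ?_
      push_cast
      congr 3
      ring
  rw [h2, add_assoc, ← Finset.sum_add_distrib]
  congr 1
  refine Finset.sum_congr rfl fun k _ => ?_
  rw [powCoeff, C_add, add_mul, map_sum, Finset.sum_mul]
  congr 1
  refine Finset.sum_congr rfl fun ij hij => ?_
  rw [Finset.HasAntidiagonal.mem_antidiagonal.1 hij]

end Derivatives

/-! ## The values of the contractions on the generators -/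

instance (n : ℕ) : CharZero (polyRep n) :=
  charZero_of_injective_algebraMap (algebraMap ℂ (polyRep n)).injective

lemma genForm_eq_sum (n m : ℕ) : genForm n m =
    ∑ k : Fin (n - 1), scal n ((derivative^[(k : ℕ) + 2] (rootPoly n Finset.univ)).coeff m) *
      dualForm n k := by
  by_cases hm : n ≤ m + 1
  · rw [genForm_eq_zero n m hm]
    symm
    refine Finset.sum_eq_zero fun k _ => ?_
    rw [coeff_iterate_derivative, coeff_eq_zero_of_natDegree_lt, smul_zero, map_zero, zero_mul]
    rw [natDegree_rootPoly_univ]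
    omega
  · have h := genForm_eq n ⟨n - 2 - m, by omega⟩
    have e : n - 2 - (n - 2 - m) = m := by omega
    simp only [derivMatrix, Matrix.of_apply, e] at h
    exact h

/-- `∂_N ξ_k`, and the normalized power sum for `k = 0`. -/
noncomputable def contracted (n N : ℕ) : ℕ → polyRep n
  | 0 => (n : ℂ)⁻¹ • ∑ j, xTilde n j ^ N
  | k + 1 => if h : k < n - 1 then contractedXi n N ⟨k, h⟩ else 0

lemma contracted_succ (n N : ℕ) (k : Fin (n - 1)) :
    contracted n N (k + 1) = contractedXi n N k := by
  rw [contracted, dif_pos k.2]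

/-- This is ∂_N applied to the coframe identity. On eᵢ the contraction gives x̃ᵢ^N minus the mean;
the mean multiplies ∑ Pᵢ = P' and becomes the term k = 0. -/
lemma sum_pow_mul_rootPoly (n N : ℕ) (hn : 0 < n) :
    ∑ i, C (xTilde n i ^ N) * rootPoly n (Finset.univ.erase i) =
      ∑ k ∈ Finset.range n, C (contracted n N k) * derivative^[k + 1] (rootPoly n Finset.univ) := by
  ext1 m
  have h1 := congrArg (partialPos n N) (genForm_eq_sum n m)
  rw [genForm] at h1
  simp only [map_sum, partialPos_scal_mul, partialPos_dualForm_eq, partialPos_oneForm, ← map_mul]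
    at h1
  simp only [← map_sum] at h1
  have h2 := scal_injective n h1
  obtain ⟨m', rfl⟩ : ∃ m', n = m' + 1 := ⟨n - 1, by omega⟩
  rw [Finset.sum_range_succ', zero_add, derivative_rootPoly_univ, finsetSum_coeff, coeff_add,
    finsetSum_coeff, Finset.mul_sum, finsetSum_coeff, Finset.sum_range, contracted]
  simp only [coeff_C_mul]
  have h3 : ∀ i, (rootPoly (m' + 1) (Finset.univ.erase i)).coeff m * (xTilde (m' + 1) i ^ N -
      ((m' + 1 : ℕ) : ℂ)⁻¹ • ∑ j, xTilde (m' + 1) j ^ N) =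
      xTilde (m' + 1) i ^ N * (rootPoly (m' + 1) (Finset.univ.erase i)).coeff m -
      (((m' + 1 : ℕ) : ℂ)⁻¹ • ∑ j, xTilde (m' + 1) j ^ N) *
        (rootPoly (m' + 1) (Finset.univ.erase i)).coeff m := fun i => by ring
  simp only [h3, Finset.sum_sub_distrib] at h2
  rw [sub_eq_iff_eq_add] at h2
  rw [h2]
  congr 1
  refine Finset.sum_congr rfl fun k _ => ?_
  rw [mul_comm]
  congr 1
  exact (contracted_succ (m' + 1) N k).symm

lemma add_left_cancel_of_addGroup {G : Type*} [AddGroup G] {a b c : G} (h : a + b = a + c) :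
    b = c :=
  add_left_cancel h

/-- Write t = (t - x̃ᵢ) + x̃ᵢ in each summand; the first part restores the missing factor of P. -/
lemma X_mul_sum_rootPoly (n N : ℕ) :
    X * ∑ i, C (xTilde n i ^ N) * rootPoly n (Finset.univ.erase i) =
      C (∑ i, xTilde n i ^ N) * rootPoly n Finset.univ +
      ∑ i, C (xTilde n i ^ (N + 1)) * rootPoly n (Finset.univ.erase i) := by
  rw [map_sum, Finset.sum_mul, ← Finset.sum_add_distrib, Finset.mul_sum]
  refine Finset.sum_congr rfl fun i _ => ?_
  rw [rootPoly_erase n (Finset.mem_univ i), pow_succ, C_mul]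
  ring

lemma rootPoly_ode (n : ℕ) (hn : 0 < n) : X * derivative (rootPoly n Finset.univ) =
    (n : (polyRep n)[X]) * rootPoly n Finset.univ + ∑ j ∈ Finset.range n,
      C (contracted n 1 j) * derivative^[j + 1] (rootPoly n Finset.univ) := by
  rw [← sum_pow_mul_rootPoly n 1 hn]
  have h := X_mul_sum_rootPoly n 0
  simp only [pow_zero, C_1, one_mul, Finset.sum_const, Finset.card_univ, Fintype.card_fin, nsmul_one,
    zero_add] at h
  have h1 := derivative_rootPoly_univ n 0
  simp only [zero_add, Function.iterate_one, Function.iterate_zero, id] at h1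
  rw [h1, h]
  congr 2

theorem contracted_eq_powCoeff (n : ℕ) (hn : 0 < n) (N k : ℕ) (hk : k < n) :
    contracted n N k = powCoeff n (contracted n 1) N k := by
  have hm := monic_rootPoly n Finset.univ
  have hd := natDegree_rootPoly_univ n
  have key : ∑ k ∈ Finset.range n, C (contracted n N k) *
      derivative^[k + 1] (rootPoly n Finset.univ) =
      ∑ k ∈ Finset.range n, C (powCoeff n (contracted n 1) N k) *
      derivative^[k + 1] (rootPoly n Finset.univ) := by
    rw [← sum_pow_mul_rootPoly n N hn]
    induction N generalizing k with
    | zero =>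
      obtain ⟨m, rfl⟩ : ∃ m, n = m + 1 := ⟨n - 1, by omega⟩
      rw [Finset.sum_range_succ', derivative_rootPoly_univ]
      simp [powCoeff]
    | succ N ih =>
      have h0 : contracted n N 0 = powCoeff n (contracted n 1) N 0 := by
        have h1 := ih 0 hn
        rw [sum_pow_mul_rootPoly n N hn] at h1
        have := eq_of_sum_derivative_eq (a := contracted n N)
          (b := powCoeff n (contracted n 1) N) hm (by rw [hd]; exact h1) 0 (by rw [hd]; exact hn)
        exact this
      have h2 := X_mul_sum_rootPoly n N
      rw [ih 0 hn, X_mul_sum_derivative hn hd (rootPoly_ode n hn), ← h0, contracted] at h2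
      have h3 : (n : polyRep n) * ((n : ℂ)⁻¹ • ∑ j, xTilde n j ^ N) = ∑ j, xTilde n j ^ N := by
        rw [← nsmul_eq_mul, ← Nat.cast_smul_eq_nsmul ℂ, smul_inv_smul₀]
        exact_mod_cast hn.ne'
      -- The multiples of P on the two sides agree because n times the mean is the power sum;
      -- cancelling them yields the expansion for N + 1. Uniqueness of the coefficients then gives
      -- the recursion.
      rw [h3] at h2
      exact (add_left_cancel_of_addGroup h2).symm
  exact eq_of_sum_derivative_eq (a := contracted n N)
    (b := powCoeff n (contracted n 1) N) hm (by rw [hd]; exact key) k (by rw [hd]; exact hk)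

/-- The variable `u_j` of the polynomial ring, for `1 ≤ j ≤ n - 1`, and zero otherwise. -/
noncomputable def uVar (n : ℕ) : ℕ → MvPolynomial (Fin (n - 1)) ℂ
  | 0 => 0
  | k + 1 => if h : k < n - 1 then MvPolynomial.X ⟨k, h⟩ else 0

lemma uVar_succ (n : ℕ) (k : Fin (n - 1)) : uVar n (k + 1) = MvPolynomial.X k := by
  rw [uVar, dif_pos k.2]

/-- The evaluation of polynomials at the functions `u_j`. -/
noncomputable def evalU (n : ℕ) : MvPolynomial (Fin (n - 1)) ℂ →ₐ[ℂ] polyRep n :=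
  MvPolynomial.aeval fun k => u n (k + 1)

lemma evalU_X (n : ℕ) (k : Fin (n - 1)) : evalU n (MvPolynomial.X k) = u n (k + 1) :=
  MvPolynomial.aeval_X _ _

lemma evalU_uVar (n j : ℕ) : evalU n (uVar n j) = contracted n 1 j := by
  cases j with
  | zero => simp only [uVar, contracted, map_zero, pow_one, sum_xTilde, smul_zero]
  | succ k =>
    by_cases h : k < n - 1
    · rw [uVar, dif_pos h, contracted, dif_pos h, evalU_X]
      exact u_eq n ⟨k, h⟩
    · rw [uVar, dif_neg h, contracted, dif_neg h, map_zero]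

theorem contractedXi_eq_evalU (n N : ℕ) (k : Fin (n - 1)) :
    contractedXi n N k = evalU n (powCoeff n (uVar n) N (k + 1)) := by
  have h := map_powCoeff (evalU n : MvPolynomial (Fin (n - 1)) ℂ →+* polyRep n) n (uVar n) N (k + 1)
  rw [RingHom.coe_coe] at h
  rw [h, ← contracted_succ, contracted_eq_powCoeff n (by have := k.pos; omega) N _ (by omega)]
  congr 1
  exact funext fun j => (evalU_uVar n j).symm

/-! ## The invariant polynomials are the polynomials in the `u_j` -/

lemma coeff_X_mul_derivative {A : Type*} [CommRing A] (p : A[X]) (m : ℕ) :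
    (X * derivative p).coeff m = m * p.coeff m := by
  cases m with
  | zero => simp
  | succ m =>
    rw [coeff_X_mul, coeff_derivative]
    push_cast
    ring

/-- The coefficient of t^m in the equation for P expresses (m - n) times the m-th coefficient
through the u's and coefficients of higher index. Descending from the leading coefficient, where m =
n, one never divides by zero. -/
lemma coeff_rootPoly_mem (n : ℕ) (hn : 0 < n) (m : ℕ) :
    (rootPoly n Finset.univ).coeff m ∈ (evalU n).range := by
  have key : ∀ d m, n ≤ m + d → (rootPoly n Finset.univ).coeff m ∈ (evalU n).range := by
    intro d
    induction d using Nat.strong_induction_on with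
    | _ d ih =>
    intro m hm
    rcases lt_trichotomy m n with hlt | rfl | hgt
    · have h := congrArg (fun q : (polyRep n)[X] => q.coeff m) (rootPoly_ode n hn)
      simp only [coeff_add, finsetSum_coeff, coeff_C_mul, coeff_X_mul_derivative,
        ← C_eq_natCast] at h
      have hc : ((m : ℂ) - n) ≠ 0 := by
        rw [sub_ne_zero]
        exact_mod_cast hlt.ne
      have h1 : ((m : ℂ) - n) • (rootPoly n Finset.univ).coeff m =
          ∑ j ∈ Finset.range n, contracted n 1 j *
            (derivative^[j + 1] (rootPoly n Finset.univ)).coeff m := by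
        rw [sub_smul, Nat.cast_smul_eq_nsmul, Nat.cast_smul_eq_nsmul, nsmul_eq_mul, nsmul_eq_mul, h]
        ring
      rw [← inv_smul_smul₀ hc ((rootPoly n Finset.univ).coeff m), h1]
      refine Subalgebra.smul_mem _ (sum_mem fun j _ => mul_mem ?_ ?_) _
      · rw [← evalU_uVar]
        exact (AlgHom.mem_range _).2 ⟨_, rfl⟩
      · rw [coeff_iterate_derivative]
        exact nsmul_mem (ih (d - 1) (by omega) _ (by omega)) _
    · have : (rootPoly m Finset.univ).coeff m = 1 := by
        have := monic_rootPoly m Finset.univ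
        rwa [Monic, leadingCoeff, natDegree_rootPoly_univ] at this
      rw [this]
      exact one_mem _
    · rw [coeff_eq_zero_of_natDegree_lt (by rwa [natDegree_rootPoly_univ])]
      exact zero_mem _
  exact key n m (by omega)

lemma coe_xTilde (n : ℕ) (i : Fin n) : (xTilde n i : MvPolynomial (Fin n) ℂ) =
    (n : ℂ)⁻¹ • ∑ j, (MvPolynomial.X i - MvPolynomial.X j) := by
  rw [xTilde]
  change (n : ℂ)⁻¹ • ((∑ j, xDiff n i j : polyRep n) : MvPolynomial (Fin n) ℂ) = _
  rw [AddSubmonoidClass.coe_finsetSum]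
  rfl

lemma aeval_coe_xTilde {A : Type*} [CommRing A] [Algebra ℂ A] (n : ℕ) (y : Fin n → A)
    (hy : ∑ i, y i = 0) (i : Fin n) :
    MvPolynomial.aeval y (xTilde n i : MvPolynomial (Fin n) ℂ) = y i := by
  rw [coe_xTilde, map_smul, map_sum]
  simp only [map_sub, MvPolynomial.aeval_X, Finset.sum_sub_distrib, hy, sub_zero, Finset.sum_const,
    Finset.card_univ, Fintype.card_fin]
  rw [← Nat.cast_smul_eq_nsmul ℂ, inv_smul_smul₀]
  exact_mod_cast i.pos.ne'

lemma aeval_xTilde (n : ℕ) (p : polyRep n) :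
    MvPolynomial.aeval (xTilde n) (p : MvPolynomial (Fin n) ℂ) = p := by
  induction p using polyRep_induction with
  | hC r => exact AlgHom.commutes _ r
  | hx i => exact aeval_coe_xTilde n _ (sum_xTilde n) i
  | hadd p q hp hq =>
    rw [Subalgebra.coe_add, map_add, hp, hq]
  | hmul p q hp hq =>
    rw [Subalgebra.coe_mul, map_mul, hp, hq]

theorem range_evalU (n : ℕ) (hn : 0 < n) : (evalU n).range = invPoly n := by
  apply le_antisymm
  · rw [evalU, MvPolynomial.aeval_range, Algebra.adjoin_le_iff]
    rintro _ ⟨k, rfl⟩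
    exact u_mem n k
  · intro p hp
    rw [mem_invPoly] at hp
    have hs : (p : MvPolynomial (Fin n) ℂ).IsSymmetric := fun σ => by
      rw [← permPoly_coe, hp]
    obtain ⟨g, hg⟩ := MvPolynomial.esymmAlgHom_surjective (R := ℂ) (σ := Fin n) (n := n) (by simp)
      ⟨_, hs⟩
    have hg' : (p : MvPolynomial (Fin n) ℂ) =
        MvPolynomial.aeval (fun i : Fin n => MvPolynomial.esymm (Fin n) ℂ (i + 1)) g := by
      rw [← MvPolynomial.esymmAlgHom_apply, hg]
    -- Substituting x̃ for x does not change p, so p is a polynomial in the elementary symmetric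
    -- functions of the x̃ᵢ, which are the coefficients of P up to sign.
    rw [← aeval_xTilde n p, hg', ← AlgHom.comp_apply, MvPolynomial.comp_aeval]
    have he : ∀ i : Fin n, MvPolynomial.aeval (xTilde n) (MvPolynomial.esymm (Fin n) ℂ (i + 1)) ∈
        (evalU n).range := by
      intro i
      rw [MvPolynomial.aeval_esymm_eq_multiset_esymm]
      have h1 := Multiset.prod_X_sub_C_coeff (Finset.univ.val.map (xTilde n)) (k := n - (i + 1))
        (by simp)
      have h2 := coeff_rootPoly_mem n hn (n - (i + 1))
      have h3 : rootPoly n Finset.univ =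
          (((Finset.univ : Finset (Fin n)).val.map (xTilde n)).map fun t => X - C t).prod := by
        rw [Multiset.map_map]
        rfl
      have h4 : n - (n - ((i : ℕ) + 1)) = i + 1 := by omega
      rw [h3, h1] at h2
      simp only [Multiset.card_map, Finset.card_val, Finset.card_univ, Fintype.card_fin, h4] at h2
      have h5 := mul_mem (pow_mem (neg_mem (one_mem (evalU n).range)) ((i : ℕ) + 1)) h2
      rw [← mul_assoc, ← mul_pow] at h5
      have h6 : (-1 : polyRep n) * -1 = 1 := by ring
      rwa [h6, one_pow, one_mul] at h5
    have h7 : MvPolynomial.aeval (fun i : Fin n =>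
        MvPolynomial.aeval (xTilde n) (MvPolynomial.esymm (Fin n) ℂ (i + 1))) g ∈
        (MvPolynomial.aeval (R := ℂ) (fun i : Fin n =>
          MvPolynomial.aeval (xTilde n) (MvPolynomial.esymm (Fin n) ℂ (i + 1)))).range :=
      (AlgHom.mem_range _).2 ⟨g, rfl⟩
    rw [MvPolynomial.aeval_range] at h7
    refine Algebra.adjoin_le ?_ h7
    rintro _ ⟨i, rfl⟩
    exact he i

/-! ## Algebraic independence of the `u_j` -/

/-- The operator of the equation maps polynomials of degree at most n to those of degree less than
n, so it has a kernel. On leading coefficients it multiplies by degree minus n, so a nonzero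
solution has degree exactly n. -/
lemma exists_monic_ode (n : ℕ) (c : ℕ → ℂ) :
    ∃ p : ℂ[X], p.Monic ∧ p.natDegree = n ∧ X * derivative p = (n : ℂ[X]) * p +
      ∑ j ∈ Finset.range n, C (c j) * derivative^[j + 1] p := by
  let T : ℂ[X] →ₗ[ℂ] ℂ[X] := LinearMap.mulLeft ℂ X ∘ₗ derivative - (n : ℂ) • LinearMap.id -
    ∑ j ∈ Finset.range n, c j • (derivative ^ (j + 1) : Module.End ℂ ℂ[X])
  have hT : ∀ p, T p = X * derivative p - (n : ℂ) • p -
      ∑ j ∈ Finset.range n, c j • derivative^[j + 1] p := fun p => by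
    simp only [T, LinearMap.sub_apply, LinearMap.comp_apply, LinearMap.mulLeft_apply,
      LinearMap.smul_apply, LinearMap.id_apply, LinearMap.sum_apply, Module.End.pow_apply]
  have hTc : ∀ p m, (T p).coeff m = ((m : ℂ) - n) * p.coeff m - ∑ j ∈ Finset.range n,
      c j * ((m + (j + 1)).descFactorial (j + 1) * p.coeff (m + (j + 1))) := fun p m => by
    rw [hT, coeff_sub, coeff_sub, coeff_X_mul_derivative, finsetSum_coeff, coeff_smul, smul_eq_mul,
      ← sub_mul]
    congr 1
    exact Finset.sum_congr rfl fun j _ => by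
      rw [coeff_smul, coeff_iterate_derivative, smul_eq_mul, nsmul_eq_mul]
  have hmem : ∀ p ∈ degreeLT ℂ (n + 1), T p ∈ degreeLT ℂ n := by
    intro p hp
    rw [mem_degreeLT, degree_lt_iff_coeff_zero] at hp ⊢
    intro m hm
    rw [hTc, Finset.sum_eq_zero, sub_zero]
    · rcases hm.eq_or_lt with rfl | h
      · rw [sub_self, zero_mul]
      · rw [hp m h, mul_zero]
    · intro j _
      rw [hp _ (by omega), mul_zero, mul_zero]
  have hker : LinearMap.ker (T.restrict hmem) ≠ ⊥ := by
    have := (degreeLTEquiv ℂ (n + 1)).symm.finiteDimensional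
    have := (degreeLTEquiv ℂ n).symm.finiteDimensional
    apply LinearMap.ker_ne_bot_of_finrank_lt
    rw [(degreeLTEquiv ℂ (n + 1)).finrank_eq, (degreeLTEquiv ℂ n).finrank_eq]
    simp
  obtain ⟨⟨p, hp⟩, hpk, hp0⟩ := Submodule.exists_mem_ne_zero_of_ne_bot hker
  have hTp : T p = 0 := congrArg Subtype.val (LinearMap.mem_ker.1 hpk)
  have hp0 : p ≠ 0 := fun h => hp0 (Subtype.ext h)
  have hdeg : p.natDegree = n := by
    have h := hTc p p.natDegree
    rw [hTp, coeff_zero, Finset.sum_eq_zero, sub_zero] at h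
    · have h1 := (mul_eq_zero.1 h.symm).resolve_right (leadingCoeff_ne_zero.2 hp0)
      rw [sub_eq_zero] at h1
      exact_mod_cast h1
    · intro j _
      rw [coeff_eq_zero_of_natDegree_lt (by omega), mul_zero, mul_zero]
  have hl := leadingCoeff_ne_zero.2 hp0
  refine ⟨p.leadingCoeff⁻¹ • p, ?_, ?_, ?_⟩
  · rw [Monic, leadingCoeff_smul_of_smul_regular _ (IsSMulRegular.of_ne_zero (inv_ne_zero hl)),
      smul_eq_mul, inv_mul_cancel₀ hl]
  · rw [natDegree_smul _ (inv_ne_zero hl), hdeg]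
  · have h : T (p.leadingCoeff⁻¹ • p) = 0 := by rw [map_smul, hTp, smul_zero]
    rw [hT, sub_eq_zero, sub_eq_iff_eq_add] at h
    rw [h, add_comm]
    congr 1
    · rw [Nat.cast_smul_eq_nsmul, nsmul_eq_mul]
    · exact Finset.sum_congr rfl fun j _ => smul_eq_C_mul _

lemma exists_roots {n : ℕ} {p : ℂ[X]} (hp : p.Monic) (hd : p.natDegree = n) :
    ∃ y : Fin n → ℂ, p = ∏ i, (X - C (y i)) := by
  subst hd
  have hs := IsAlgClosed.splits p
  have hcard : p.roots.toList.length = p.natDegree := by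
    rw [Multiset.length_toList, hs.natDegree_eq_card_roots]
  refine ⟨fun i => p.roots.toList[i], ?_⟩
  have h1 := hs.eq_prod_roots_of_monic hp
  have h2 : (Finset.univ.val.map fun i : Fin p.natDegree => p.roots.toList[i]) = p.roots := by
    rw [Fin.univ_val_map]
    conv_rhs => rw [← Multiset.coe_toList p.roots]
    congr 1
    apply List.ext_getElem
    · simp [hcard]
    · intro i _ _
      simp
  conv_lhs => rw [h1, ← h2, Multiset.map_map]
  rfl

/-- Take the roots of the solution as values of the x̃ᵢ. They sum to zero because the coefficient
with index 0 in the equation is zero. The image of the equation for P is then the given one, and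
uniqueness of its coefficients identifies the values of the u's. -/
lemma exists_evaluation (n : ℕ) (hn : 0 < n) (c : Fin (n - 1) → ℂ) :
    ∃ f : polyRep n →ₐ[ℂ] ℂ, ∀ k : Fin (n - 1), f (u n (k + 1)) = c k := by
  let c' : ℕ → ℂ := fun j => MvPolynomial.eval c (uVar n j)
  obtain ⟨p, hm, hd, hode⟩ := exists_monic_ode n c'
  obtain ⟨y, hy⟩ := exists_roots hm hd
  have hsum : ∑ i, y i = 0 := by
    have h1 : p.coeff (n - 1) = -∑ i, y i := by
      have := prod_X_sub_C_coeff_card_pred Finset.univ y (by simpa using hn)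
      rw [← hy, Finset.card_univ, Fintype.card_fin] at this
      exact this
    have h2 := congrArg (fun q : ℂ[X] => q.coeff (n - 1)) hode
    simp only [coeff_add, finsetSum_coeff, coeff_C_mul, coeff_X_mul_derivative, ← C_eq_natCast]
      at h2
    rw [Finset.sum_eq_zero, add_zero] at h2
    · have h3 : ((n - 1 : ℕ) : ℂ) = n - 1 := by
        rw [Nat.cast_sub hn, Nat.cast_one]
      rw [h3] at h2
      have h4 : p.coeff (n - 1) = 0 := by linear_combination -h2
      rw [h1, neg_eq_zero] at h4
      exact h4
    · intro j _
      rcases Nat.eq_zero_or_pos j with rfl | hj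
      · simp [c', uVar]
      · rw [coeff_iterate_derivative, coeff_eq_zero_of_natDegree_lt (by omega), smul_zero, mul_zero]
  obtain ⟨f, hf⟩ : ∃ f : polyRep n →ₐ[ℂ] ℂ, ∀ i, f (xTilde n i) = y i :=
    ⟨(MvPolynomial.aeval y).comp (polyRep n).val, aeval_coe_xTilde n y hsum⟩
  have hP : (rootPoly n Finset.univ).map (f : polyRep n →+* ℂ) = p := by
    conv_rhs => rw [hy]
    rw [rootPoly, Polynomial.map_prod]
    refine Finset.prod_congr rfl fun i _ => ?_
    rw [Polynomial.map_sub, map_X, map_C, RingHom.coe_coe, hf]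
  have h1 := congrArg (Polynomial.map (f : polyRep n →+* ℂ)) (rootPoly_ode n hn)
  simp only [Polynomial.map_mul, Polynomial.map_add, Polynomial.map_sum, map_X, map_C,
    Polynomial.map_natCast, ← derivative_map, ← iterate_derivative_map, hP] at h1
  rw [hode] at h1
  have h2 := eq_of_sum_derivative_eq (a := c') (b := fun j => f (contracted n 1 j)) hm
    (by rw [hd]; exact add_left_cancel h1)
  refine ⟨f, fun k => ?_⟩
  have h3 := h2 (k + 1) (by omega)
  rw [contracted_succ, ← u_eq] at h3
  simp only [c', uVar_succ, MvPolynomial.eval_X] at h3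
  exact h3.symm

theorem evalU_injective (n : ℕ) (hn : 0 < n) : Function.Injective (evalU n) := by
  rw [injective_iff_map_eq_zero]
  intro g hg
  apply MvPolynomial.funext
  intro c
  obtain ⟨f, hf⟩ := exists_evaluation n hn c
  have h : f.comp (evalU n) = MvPolynomial.aeval c := by
    apply MvPolynomial.algHom_ext
    intro k
    rw [AlgHom.comp_apply, evalU_X, hf, MvPolynomial.aeval_X]
  have h1 := congrArg f hg
  rw [← AlgHom.comp_apply, h, map_zero] at h1
  rw [map_zero]
  exact h1

/-! ## The model algebra -/

noncomputable section

/-- The linear map `∑ vₖ ξₖ`. -/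
def xiLin (n : ℕ) : (Fin (n - 1) → ℂ) →ₗ[ℂ] Forms n :=
  ∑ k, (LinearMap.proj k : (Fin (n - 1) → ℂ) →ₗ[ℂ] ℂ).smulRight (dualForm n k)

lemma xiLin_apply (n : ℕ) (v : Fin (n - 1) → ℂ) : xiLin n v = ∑ k, v k • dualForm n k := by
  simp [xiLin, LinearMap.sum_apply]

lemma hat_xiLin (n : ℕ) (v : Fin (n - 1) → ℂ) : hat n (xiLin n v) = -xiLin n v := by
  rw [xiLin_apply, map_sum, ← form_sum_neg]
  exact Finset.sum_congr rfl fun k _ => by rw [map_smul, hat_dualForm, smul_neg]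

lemma mul_xiLin (n : ℕ) (v : Fin (n - 1) → ℂ) (y : Forms n) :
    y * xiLin n v = xiLin n v * hat n y := by
  rw [xiLin_apply, Finset.mul_sum, Finset.sum_mul]
  exact Finset.sum_congr rfl fun k _ => by
    rw [mul_smul_comm, smul_mul_assoc, mul_dualForm]

lemma xiLin_sq (n : ℕ) (v : Fin (n - 1) → ℂ) : xiLin n v * xiLin n v = 0 := by
  apply eq_zero_of_eq_neg_self
  conv_lhs => rw [mul_xiLin, hat_xiLin]
  exact form_mul_neg _ _

/-- The homomorphism from the model algebra to forms that sends generators to generators. -/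
def modelHom (n : ℕ) : Model n →ₐ[ℂ] Forms n :=
  Algebra.TensorProduct.lift (ExteriorAlgebra.lift ℂ ⟨xiLin n, xiLin_sq n⟩)
    ((scal n).comp (evalU n)) fun _ p => (scal_comm n (evalU n p) _).symm

end

lemma modelHom_tmul (n : ℕ) (a : ExteriorAlgebra ℂ (Fin (n - 1) → ℂ))
    (p : MvPolynomial (Fin (n - 1)) ℂ) :
    modelHom n (a ⊗ₜ p) = ExteriorAlgebra.lift ℂ ⟨xiLin n, xiLin_sq n⟩ a * scal n (evalU n p) :=
  Algebra.TensorProduct.lift_tmul _ _ _ _ _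

lemma inclU_apply (n : ℕ) (p : MvPolynomial (Fin (n - 1)) ℂ) : inclU n p = 1 ⊗ₜ p := rfl

lemma modelHom_inclU (n : ℕ) (p : MvPolynomial (Fin (n - 1)) ℂ) :
    modelHom n (inclU n p) = scal n (evalU n p) := by
  rw [inclU_apply, modelHom_tmul, map_one, one_mul]

lemma modelHom_genXi (n : ℕ) (k : Fin (n - 1)) : modelHom n (genXi n k) = dualForm n k := by
  rw [genXi, modelHom_tmul, map_one, map_one, mul_one, ExteriorAlgebra.lift_ι_apply]
  change xiLin n _ = _
  rw [xiLin_apply, Finset.sum_eq_single k]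
  · rw [Pi.single_eq_same, one_smul]
  · intro j _ hj
    rw [Pi.single_eq_of_ne hj, zero_smul]
  · simp

lemma genXi_mul_tmul (n : ℕ) (k : Fin (n - 1)) (a : ExteriorAlgebra ℂ (Fin (n - 1) → ℂ))
    (p : MvPolynomial (Fin (n - 1)) ℂ) :
    genXi n k * a ⊗ₜ p = (ExteriorAlgebra.ι ℂ (Pi.single k (1 : ℂ)) * a) ⊗ₜ p := by
  rw [genXi, Algebra.TensorProduct.tmul_mul_tmul, one_mul]

lemma ι_mul_tmul_eq_sum (n : ℕ) (v : Fin (n - 1) → ℂ) (a : ExteriorAlgebra ℂ (Fin (n - 1) → ℂ))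
    (p : MvPolynomial (Fin (n - 1)) ℂ) :
    (ExteriorAlgebra.ι ℂ v * a) ⊗ₜ[ℂ] p = ∑ k, genXi n k * a ⊗ₜ (v k • p) := by
  have h : v = ∑ k, v k • Pi.single k (1 : ℂ) := by
    simpa using (pi_eq_sum_univ' v)
  conv_lhs => rw [h]
  rw [map_sum, Finset.sum_mul, TensorProduct.sum_tmul]
  refine Finset.sum_congr rfl fun k _ => ?_
  rw [genXi_mul_tmul, map_smul, smul_mul_assoc, TensorProduct.smul_tmul]

lemma model_induction (n : ℕ) {C : Model n → Prop} (hU : ∀ p, C (inclU n p))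
    (hadd : ∀ x y, C x → C y → C (x + y)) (hmul : ∀ k x, C x → C (genXi n k * x)) (x : Model n) :
    C x := by
  have h0 : C 0 := by simpa using hU 0
  induction x using TensorProduct.induction_on with
  | zero => exact h0
  | add x y hx hy => exact hadd x y hx hy
  | tmul a p =>
    induction a using exterior_induction generalizing p with
    | hr r =>
      rw [Algebra.algebraMap_eq_smul_one, TensorProduct.smul_tmul]
      exact hU _
    | hadd a b ha hb => rw [TensorProduct.add_tmul]; exact hadd _ _ (ha p) (hb p)
    | hmul v a ha =>
      rw [ι_mul_tmul_eq_sum]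
      exact Finset.sum_induction _ C hadd h0 fun k _ => hmul k _ (ha _)

lemma modelHom_mem (n : ℕ) (x : Model n) : modelHom n x ∈ stableH n := by
  induction x using model_induction with
  | hU p =>
    rw [modelHom_inclU]
    exact scal_mem_stableH n (by
      rcases Nat.eq_zero_or_pos n with rfl | hn
      · rw [mem_invPoly]
        intro σ
        rw [Subsingleton.elim σ 1, permPoly_one]
      · rw [← range_evalU n hn]
        exact (AlgHom.mem_range _).2 ⟨p, rfl⟩)
  | hadd x y hx hy => rw [map_add]; exact add_mem hx hy
  | hmul k x hx => rw [map_mul, modelHom_genXi]; exact mul_mem (dualForm_mem n k) hx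

/-- The derivative of the model algebra with respect to `ξₖ`. -/
noncomputable def modelDelta (n : ℕ) (k : Fin (n - 1)) : Model n →ₗ[ℂ] Model n :=
  LinearMap.rTensor _ (CliffordAlgebra.contractLeft (Q := (0 : QuadraticForm ℂ (Fin (n - 1) → ℂ)))
    (LinearMap.proj k : (Fin (n - 1) → ℂ) →ₗ[ℂ] ℂ))

lemma modelDelta_tmul (n : ℕ) (k : Fin (n - 1)) (a : ExteriorAlgebra ℂ (Fin (n - 1) → ℂ))
    (p : MvPolynomial (Fin (n - 1)) ℂ) : modelDelta n k (a ⊗ₜ p) =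
      CliffordAlgebra.contractLeft (LinearMap.proj k : (Fin (n - 1) → ℂ) →ₗ[ℂ] ℂ) a ⊗ₜ p := rfl

lemma modelDelta_inclU (n : ℕ) (k : Fin (n - 1)) (p : MvPolynomial (Fin (n - 1)) ℂ) :
    modelDelta n k (inclU n p) = 0 := by
  rw [inclU_apply, modelDelta_tmul, CliffordAlgebra.contractLeft_one, TensorProduct.zero_tmul]

lemma modelDelta_genXi_mul (n : ℕ) (j k : Fin (n - 1)) (x : Model n) :
    modelDelta n k (genXi n j * x) + genXi n j * modelDelta n k x = if k = j then x else 0 := by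
  induction x using TensorProduct.induction_on with
  | zero => simp
  | add x y hx hy =>
    have : (if k = j then x + y else 0) = (if k = j then x else 0) + if k = j then y else 0 := by
      split_ifs <;> simp
    rw [this, ← hx, ← hy, mul_add, map_add, map_add, mul_add]
    abel
  | tmul a p =>
    rw [genXi_mul_tmul, modelDelta_tmul, modelDelta_tmul, genXi_mul_tmul, ← TensorProduct.add_tmul,
      contractLeft_ι_mul', sub_add_cancel]
    change ((Pi.single j (1 : ℂ) : Fin (n - 1) → ℂ) k • a) ⊗ₜ p = _
    by_cases h : k = j
    · rw [if_pos h, h, Pi.single_eq_same, one_smul]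
    · rw [if_neg h, Pi.single_eq_of_ne h, zero_smul, TensorProduct.zero_tmul]

lemma modelDelta_anticomm (n : ℕ) (j k : Fin (n - 1)) (x : Model n) :
    modelDelta n j (modelDelta n k x) + modelDelta n k (modelDelta n j x) = 0 := by
  induction x using TensorProduct.induction_on with
  | zero => simp
  | add x y hx hy =>
    simp only [map_add]
    rw [add_add_add_comm, hx, hy, add_zero]
  | tmul a p =>
    simp only [modelDelta_tmul]
    rw [← TensorProduct.add_tmul, CliffordAlgebra.contractLeft_comm, neg_add_cancel,
      TensorProduct.zero_tmul]

lemma modelDelta_modelDelta (n : ℕ) (k : Fin (n - 1)) (x : Model n) :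
    modelDelta n k (modelDelta n k x) = 0 := by
  have h := modelDelta_anticomm n k k x
  rw [← two_smul ℂ] at h
  exact (smul_eq_zero_iff_right (by norm_num)).1 h

lemma exists_inclU_of_modelDelta_eq_zero (n : ℕ) {x : Model n} (h : ∀ k, modelDelta n k x = 0) :
    ∃ p, x = inclU n p :=
  exists_one_tmul_of_contractLeft_eq_zero (Pi.basisFun ℂ (Fin (n - 1))) x fun k => by
    have : (Pi.basisFun ℂ (Fin (n - 1))).coord k =
        (LinearMap.proj k : (Fin (n - 1) → ℂ) →ₗ[ℂ] ℂ) := LinearMap.ext fun v => by simp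
    rw [this]
    exact h k

/-- To deduce `C` from `P` on the model algebra, it suffices to do so for polynomials if these
properties, which may depend on an integer, are compatible with the generators and their
derivatives. -/
theorem model_peel (n : ℕ) {P C : ℤ → Model n → Prop}
    (hbase : ∀ i p, P i (inclU n p) → C i (inclU n p))
    (hδ : ∀ i (k : Fin (n - 1)) x, P i x → P (i + ((k : ℕ) + 1)) (modelDelta n k x))
    (hξ : ∀ i (k : Fin (n - 1)) x, C (i + ((k : ℕ) + 1)) x → C i (genXi n k * x))
    (hadd : ∀ i x y, C i x → C i y → C i (x + y))
    (hP : ∀ i k x, P i x → C i (genXi n k * modelDelta n k x) → P i (modelDelta n k (genXi n k * x)))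
    (i : ℤ) (x : Model n) (hx : P i x) : C i x := by
  have key : ∀ (S : Finset (Fin (n - 1))) (i : ℤ) (x : Model n), P i x →
      (∀ k ∉ S, modelDelta n k x = 0) → C i x := by
    intro S
    induction S using Finset.induction_on with
    | empty =>
      intro i x hx h
      obtain ⟨p, rfl⟩ := exists_inclU_of_modelDelta_eq_zero n fun k => h k (Finset.notMem_empty k)
      exact hbase i p hx
    | insert k S hk ih =>
      intro i x hx h
      have e : ∀ j, j ∉ S → modelDelta n j (modelDelta n k x) = 0 := by
        intro j hj
        by_cases hjk : j = k
        · rw [hjk, modelDelta_modelDelta]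
        · have := modelDelta_anticomm n j k x
          rwa [h j (by simp [hjk, hj]), map_zero, add_zero] at this
      have h1 := hξ i k _ (ih _ _ (hδ i k x hx) e)
      -- The second part of the homotopy formula. It is killed by δₖ and by the δ's outside the set,
      -- so the induction hypothesis applies once `hP` transfers P to it.
      have h2 : C i (modelDelta n k (genXi n k * x)) := by
        refine ih _ _ (hP i k x hx h1) fun j hj => ?_
        by_cases hjk : j = k
        · rw [hjk, modelDelta_modelDelta]
        · have h3 := modelDelta_anticomm n j k (genXi n k * x)
          have h4 := modelDelta_genXi_mul n k j x
          rw [if_neg hjk, h j (by simp [hjk, hj]), mul_zero, add_zero] at h4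
          rwa [h4, map_zero, add_zero] at h3
      have h5 := modelDelta_genXi_mul n k k x
      rw [if_pos rfl] at h5
      rw [← h5]
      exact hadd i _ _ h2 h1
  exact key Finset.univ i x hx fun k hk => absurd (Finset.mem_univ k) hk

/-- Both operators vanish on functions and satisfy the same relation with multiplication by each
generator. -/
lemma modelHom_modelDelta (n : ℕ) (k : Fin (n - 1)) (x : Model n) :
    modelHom n (modelDelta n k x) = delta n k (modelHom n x) := by
  induction x using model_induction with
  | hU p => rw [modelDelta_inclU, map_zero, modelHom_inclU, delta_scal]
  | hadd x y hx hy => simp only [map_add, hx, hy]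
  | hmul j x hx =>
    have h := congrArg (modelHom n) (modelDelta_genXi_mul n j k x)
    rw [map_add, map_mul (modelHom n) (genXi n j) (modelDelta n k x), modelHom_genXi, hx] at h
    rw [map_mul (modelHom n) (genXi n j) x, modelHom_genXi]
    by_cases hjk : k = j
    · subst hjk
      rw [if_pos rfl, add_comm] at h
      have h2 := dualForm_mul_delta n k (modelHom_mem n x)
      exact add_left_cancel_of_addGroup (h.trans h2.symm)
    · rw [if_neg hjk, map_zero] at h
      rw [delta_dualForm_mul_of_ne n hjk (modelHom_mem n x)]
      exact eq_neg_of_add_eq_zero_left h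

/-- The kernel is stable under the derivatives of the model, so peeling reduces to functions, where
the u's are algebraically independent. The integer index of `model_peel` is idle here. -/
theorem modelHom_injective (n : ℕ) (hn : 0 < n) : Function.Injective (modelHom n) := by
  rw [injective_iff_map_eq_zero]
  refine fun x hx => model_peel n (P := fun _ x => modelHom n x = 0) (C := fun _ x => x = 0)
    ?_ ?_ ?_ ?_ ?_ 0 x hx
  · intro _ p h
    rw [modelHom_inclU] at h
    have h1 := scal_injective n (h.trans (map_zero _).symm)
    rw [evalU_injective n hn (h1.trans (map_zero _).symm), map_zero]
  · intro _ k x h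
    rw [modelHom_modelDelta, h, map_zero]
  · rintro _ k x rfl
    exact mul_zero _
  · rintro _ x y rfl rfl
    exact add_zero _
  · intro _ k x h _
    rw [modelHom_modelDelta, map_mul, h, mul_zero, map_zero]

theorem exists_modelHom_eq (n : ℕ) (hn : 0 < n) {y : Forms n} (hy : y ∈ stableH n) :
    ∃ x, modelHom n x = y := by
  refine stableH_induction n (C := fun y => ∃ x, modelHom n x = y) ?_ ?_ ?_ hy
  · intro p hp
    rw [← range_evalU n hn] at hp
    obtain ⟨q, rfl⟩ := (AlgHom.mem_range _).1 hp
    exact ⟨inclU n q, modelHom_inclU n q⟩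
  · rintro _ _ ⟨a, rfl⟩ ⟨b, rfl⟩
    exact ⟨a + b, map_add _ _ _⟩
  · rintro k _ _ ⟨a, rfl⟩
    exact ⟨genXi n k * a, by rw [map_mul, modelHom_genXi]⟩

/-- The isomorphism of the model algebra with the algebra of invariant forms. -/
noncomputable def modelEquiv (n : ℕ) (hn : 0 < n) : Model n ≃ₐ[ℂ] stableH n :=
  AlgEquiv.ofBijective ((modelHom n).codRestrict (stableH n) (modelHom_mem n))
    ⟨fun x y h => modelHom_injective n hn (congrArg Subtype.val h), fun y => by
      obtain ⟨x, hx⟩ := exists_modelHom_eq n hn y.2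
      exact ⟨x, Subtype.ext hx⟩⟩

lemma modelEquiv_coe (n : ℕ) (hn : 0 < n) (x : Model n) :
    (modelEquiv n hn x : Forms n) = modelHom n x := rfl

/-! ## Polynomials with vanishing low coefficients -/

section LowCoefficients

variable {A : Type*} [Semiring A]

/-- All coefficients of `t^w` with `w < -i` vanish. -/
def VanishesBelow (i : ℤ) (q : A[X]) : Prop := ∀ w : ℕ, (w : ℤ) < -i → q.coeff w = 0

/-- The coefficient of `t^(-i)`. -/
def coeffNeg (i : ℤ) (q : A[X]) : A := if i ≤ 0 then q.coeff (-i).toNat else 0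

lemma coeffNeg_natCast (w : ℕ) (q : A[X]) : coeffNeg (-(w : ℤ)) q = q.coeff w := by
  rw [coeffNeg, if_pos (by omega)]
  congr 1
  omega

lemma VanishesBelow.mono {i j : ℤ} {q : A[X]} (h : VanishesBelow i q) (hij : i ≤ j) :
    VanishesBelow j q := fun w hw => h w (by omega)

lemma VanishesBelow.mul {i j : ℤ} {q r : A[X]} (hq : VanishesBelow i q) (hr : VanishesBelow j r) :
    VanishesBelow (i + j) (q * r) := by
  intro w hw
  rw [coeff_mul]
  refine Finset.sum_eq_zero fun ab hab => ?_
  rw [Finset.HasAntidiagonal.mem_antidiagonal] at hab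
  by_cases h : (ab.1 : ℤ) < -i
  · rw [hq _ h, zero_mul]
  · rw [hr ab.2 (by omega), mul_zero]

lemma VanishesBelow.coeffNeg_of_lt {i j : ℤ} {q : A[X]} (h : VanishesBelow i q) (hij : i < j) :
    coeffNeg j q = 0 := by
  rw [coeffNeg]
  split_ifs with hj
  · exact h _ (by omega)
  · rfl

/-- Lowest coefficients multiply. For a positive index the coefficient is zero by convention; then
the factor already vanishes below 0, so the product has no coefficient there either. -/
lemma VanishesBelow.coeffNeg_mul {i j : ℤ} {q r : A[X]} (hq : VanishesBelow i q)
    (hr : VanishesBelow j r) : coeffNeg (i + j) (q * r) = coeffNeg i q * coeffNeg j r := by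
  by_cases hi : i ≤ 0
  · by_cases hj : j ≤ 0
    · obtain ⟨a, rfl⟩ : ∃ a : ℕ, i = -a := ⟨(-i).toNat, by omega⟩
      obtain ⟨b, rfl⟩ : ∃ b : ℕ, j = -b := ⟨(-j).toNat, by omega⟩
      have e : -(a : ℤ) + -b = -((a + b : ℕ) : ℤ) := by push_cast; ring
      rw [e, coeffNeg_natCast, coeffNeg_natCast, coeffNeg_natCast, coeff_mul,
        Finset.sum_eq_single (a, b)]
      · rintro ⟨c, d⟩ hcd hne
        rw [Finset.HasAntidiagonal.mem_antidiagonal] at hcd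
        simp only at hcd
        by_cases h : c < a
        · rw [hq c (by omega), zero_mul]
        · rw [hr d, mul_zero]
          have : c ≠ a := by
            rintro rfl
            exact hne (by rw [add_left_cancel hcd])
          omega
      · intro h
        exact (h (Finset.HasAntidiagonal.mem_antidiagonal.2 rfl)).elim
    · have h0 : VanishesBelow 0 r := fun w hw => by omega
      have h1 := (hq.mul h0).coeffNeg_of_lt (show i + 0 < i + j by omega)
      rw [h1, coeffNeg, coeffNeg, if_neg hj, mul_zero]
  · have h0 : VanishesBelow 0 q := fun w hw => by omega
    have h1 := (h0.mul hr).coeffNeg_of_lt (show 0 + j < i + j by omega)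
    rw [h1, coeffNeg, if_neg hi, zero_mul]

/-- All coefficients, except perhaps that of `t^(-i)`, vanish. -/
def IsPure (i : ℤ) (q : A[X]) : Prop := ∀ w : ℕ, (w : ℤ) ≠ -i → q.coeff w = 0

lemma IsPure.vanishesBelow {i : ℤ} {q : A[X]} (h : IsPure i q) : VanishesBelow i q :=
  fun w hw => h w hw.ne

lemma isPure_zero (i : ℤ) : IsPure i (0 : A[X]) := fun w _ => coeff_zero w

lemma IsPure.mul {i j : ℤ} {q r : A[X]} (hq : IsPure i q) (hr : IsPure j r) :
    IsPure (i + j) (q * r) := by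
  intro w hw
  rw [coeff_mul]
  refine Finset.sum_eq_zero fun ab hab => ?_
  rw [Finset.HasAntidiagonal.mem_antidiagonal] at hab
  by_cases h : (ab.1 : ℤ) = -i
  · rw [hr ab.2 (by omega), mul_zero]
  · rw [hq _ h, zero_mul]

lemma IsPure.sum {ι : Type*} (s : Finset ι) {i : ℤ} {q : ι → A[X]} (h : ∀ j ∈ s, IsPure i (q j)) :
    IsPure i (∑ j ∈ s, q j) := fun w hw => by
  rw [finsetSum_coeff]
  exact Finset.sum_eq_zero fun j hj => h j hj w hw

lemma coeff_monomial_mul_eq (d w : ℕ) (a : A) (q : A[X]) :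
    (monomial d a * q).coeff w = if d ≤ w then a * q.coeff (w - d) else 0 := by
  rw [← C_mul_X_pow_eq_monomial, mul_assoc, coeff_C_mul, coeff_X_pow_mul']
  split_ifs <;> simp

lemma isPure_monomial (d : ℕ) (a : A) : IsPure (-(d : ℤ)) (monomial d a) := fun w hw => by
  rw [coeff_monomial, if_neg]
  omega

end LowCoefficients

/-! ## The weight decomposition of the model algebra -/

noncomputable section

/-- The coaction on `ℂ[u]` that gives `u_{k+1}` the weight `k`. -/
def weightU (n : ℕ) :
    MvPolynomial (Fin (n - 1)) ℂ →ₐ[ℂ] (MvPolynomial (Fin (n - 1)) ℂ)[X] :=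
  MvPolynomial.aeval fun k => monomial (k : ℕ) (MvPolynomial.X k)

/-- `∑ vₖ ξₖ t^k`. -/
def weightXi (n : ℕ) : (Fin (n - 1) → ℂ) →ₗ[ℂ] (Model n)[X] :=
  ∑ k, (LinearMap.proj k : (Fin (n - 1) → ℂ) →ₗ[ℂ] ℂ).smulRight
    (monomial ((k : ℕ) + 1) (genXi n k))

end

lemma weightU_X (n : ℕ) (k : Fin (n - 1)) :
    weightU n (MvPolynomial.X k) = monomial (k : ℕ) (MvPolynomial.X k) :=
  MvPolynomial.aeval_X _ _

lemma genXi_anticomm (n : ℕ) (j k : Fin (n - 1)) :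
    genXi n j * genXi n k + genXi n k * genXi n j = 0 := by
  rw [genXi, genXi, Algebra.TensorProduct.tmul_mul_tmul, Algebra.TensorProduct.tmul_mul_tmul,
    ← TensorProduct.add_tmul, ι_mul_ι_comm, neg_add_cancel, TensorProduct.zero_tmul]

lemma sum_smul_sq_eq_zero {ι A : Type*} [Fintype ι] [Semiring A] [Algebra ℂ A] (e : ι → A)
    (he : ∀ j k, e j * e k + e k * e j = 0) (v : ι → ℂ) :
    (∑ k, v k • e k) * ∑ k, v k • e k = 0 := by
  have h1 : (∑ k, v k • e k) * ∑ k, v k • e k = ∑ j, ∑ k, (v j * v k) • (e j * e k) := by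
    rw [Finset.sum_mul_sum]
    simp only [smul_mul_smul_comm]
  have h1' : (∑ k, v k • e k) * ∑ k, v k • e k = ∑ j, ∑ k, (v k * v j) • (e k * e j) :=
    h1.trans Finset.sum_comm
  have h2 : (2 : ℂ) • ((∑ k, v k • e k) * ∑ k, v k • e k) = 0 := by
    rw [two_smul]
    refine (congrArg₂ (· + ·) h1 h1').trans ?_
    simp only [← Finset.sum_add_distrib]
    refine Finset.sum_eq_zero fun j _ => Finset.sum_eq_zero fun k _ => ?_
    rw [mul_comm (v k), ← smul_add, he, smul_zero]
  have h3 := congrArg ((2 : ℂ)⁻¹ • ·) h2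
  simpa only [inv_smul_smul₀ (two_ne_zero : (2 : ℂ) ≠ 0), smul_zero] using h3

lemma weightXi_apply (n : ℕ) (v : Fin (n - 1) → ℂ) :
    weightXi n v = ∑ k, v k • monomial ((k : ℕ) + 1) (genXi n k) := by
  simp [weightXi, LinearMap.sum_apply]

lemma weightXi_sq (n : ℕ) (v : Fin (n - 1) → ℂ) : weightXi n v * weightXi n v = 0 := by
  rw [weightXi_apply]
  apply sum_smul_sq_eq_zero
  intro j k
  rw [monomial_mul_monomial, monomial_mul_monomial, add_comm ((k : ℕ) + 1), ← map_add,
    genXi_anticomm, map_zero]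

lemma inclU_comm (n : ℕ) (p : MvPolynomial (Fin (n - 1)) ℂ) (x : Model n) :
    x * inclU n p = inclU n p * x := by
  rw [inclU_apply]
  induction x using TensorProduct.induction_on with
  | zero => rw [zero_mul, mul_zero]
  | add x y hx hy => rw [add_mul, mul_add, hx, hy]
  | tmul a q =>
    rw [Algebra.TensorProduct.tmul_mul_tmul, Algebra.TensorProduct.tmul_mul_tmul, mul_one, one_mul,
      mul_comm]

lemma map_inclU_comm (n : ℕ) (q : (MvPolynomial (Fin (n - 1)) ℂ)[X]) (r : (Model n)[X]) :
    r * mapAlgHom (inclU n) q = mapAlgHom (inclU n) q * r := by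
  induction q using Polynomial.induction_on' with
  | add p q hp hq => rw [map_add, mul_add, add_mul, hp, hq]
  | monomial d a =>
    rw [coe_mapAlgHom, map_monomial, ← C_mul_X_pow_eq_monomial, ← mul_assoc, mul_assoc (C _),
      X_pow_mul, ← mul_assoc]
    congr 1
    ext1 m
    rw [coeff_mul_C, coeff_C_mul]
    exact inclU_comm n a _

/-- The coaction on the model algebra that gives `ξ_k` the weight `k` and `u_k` the weight
`k - 1`. -/
noncomputable def theta (n : ℕ) : Model n →ₐ[ℂ] (Model n)[X] :=
  Algebra.TensorProduct.lift (ExteriorAlgebra.lift ℂ ⟨weightXi n, weightXi_sq n⟩)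
    ((mapAlgHom (inclU n)).comp (weightU n)) fun _ p =>
      (map_inclU_comm n (weightU n p) _ : Commute _ _)

lemma theta_tmul (n : ℕ) (a : ExteriorAlgebra ℂ (Fin (n - 1) → ℂ))
    (p : MvPolynomial (Fin (n - 1)) ℂ) :
    theta n (a ⊗ₜ p) = ExteriorAlgebra.lift ℂ ⟨weightXi n, weightXi_sq n⟩ a *
      mapAlgHom (inclU n) (weightU n p) :=
  Algebra.TensorProduct.lift_tmul _ _ _ _ _

lemma theta_inclU (n : ℕ) (p : MvPolynomial (Fin (n - 1)) ℂ) :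
    theta n (inclU n p) = mapAlgHom (inclU n) (weightU n p) := by
  rw [inclU_apply, theta_tmul, map_one, one_mul]

lemma theta_genXi (n : ℕ) (k : Fin (n - 1)) :
    theta n (genXi n k) = monomial ((k : ℕ) + 1) (genXi n k) := by
  rw [genXi, theta_tmul, map_one, map_one, mul_one, ExteriorAlgebra.lift_ι_apply]
  change weightXi n _ = _
  rw [weightXi_apply, Finset.sum_eq_single k]
  · rw [Pi.single_eq_same, one_smul]
    rfl
  · intro j _ hj
    rw [Pi.single_eq_of_ne hj, zero_smul]
  · simp

lemma coeff_theta_inclU (n : ℕ) (p : MvPolynomial (Fin (n - 1)) ℂ) (w : ℕ) :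
    (theta n (inclU n p)).coeff w = inclU n ((weightU n p).coeff w) := by
  rw [theta_inclU, coe_mapAlgHom, coeff_map]
  rfl

lemma coeff_theta_genXi_mul (n : ℕ) (k : Fin (n - 1)) (x : Model n) (w : ℕ) :
    (theta n (genXi n k * x)).coeff w =
      if (k : ℕ) + 1 ≤ w then genXi n k * (theta n x).coeff (w - (k + 1)) else 0 := by
  rw [map_mul, theta_genXi, coeff_monomial_mul_eq]

lemma weightU_coeff (n : ℕ) (p : MvPolynomial (Fin (n - 1)) ℂ) (w : ℕ) :
    weightU n ((weightU n p).coeff w) = monomial w ((weightU n p).coeff w) := by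
  induction p using MvPolynomial.induction_on generalizing w with
  | C a =>
    have h : weightU n (MvPolynomial.C a) = C (MvPolynomial.C a) := AlgHom.commutes _ a
    rw [h, coeff_C]
    split_ifs with hw
    · rw [h, hw]
      rfl
    · rw [map_zero, map_zero]
  | add p q hp hq => rw [map_add, coeff_add, map_add, hp, hq, map_add]
  | mul_X p k hp =>
    rw [mul_comm, map_mul, weightU_X, coeff_monomial_mul_eq]
    split_ifs with hw
    · rw [map_mul, weightU_X, hp, monomial_mul_monomial, Nat.add_sub_cancel' hw]
    · rw [map_zero, map_zero]

/-- Coassociativity: each coefficient of the coaction is homogeneous. With `eval_one_theta`, which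
sums the coefficients, this yields the weight decomposition. -/
lemma theta_coeff (n : ℕ) (x : Model n) (w : ℕ) :
    theta n ((theta n x).coeff w) = monomial w ((theta n x).coeff w) := by
  induction x using model_induction generalizing w with
  | hU p =>
    rw [coeff_theta_inclU, theta_inclU, weightU_coeff, coe_mapAlgHom, map_monomial]
    rfl
  | hadd x y hx hy => rw [map_add, coeff_add, map_add, hx, hy, map_add]
  | hmul k x hx =>
    rw [coeff_theta_genXi_mul]
    split_ifs with hw
    · rw [map_mul, theta_genXi, hx, monomial_mul_monomial, Nat.add_sub_cancel' hw]
    · rw [map_zero, map_zero]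

lemma sum_coeff_weightU (n : ℕ) (p : MvPolynomial (Fin (n - 1)) ℂ) :
    (weightU n p).eval 1 = p := by
  induction p using MvPolynomial.induction_on with
  | C a =>
    have h : weightU n (MvPolynomial.C a) = C (MvPolynomial.C a) := AlgHom.commutes _ a
    rw [h, eval_C]
  | add p q hp hq => rw [map_add, eval_add, hp, hq]
  | mul_X p k hp => rw [map_mul, eval_mul, hp, weightU_X, eval_monomial, one_pow, mul_one]

lemma eval_one_theta (n : ℕ) (x : Model n) : (theta n x).eval 1 = x := by
  induction x using model_induction with
  | hU p =>
    rw [theta_inclU, coe_mapAlgHom, eval_one_map]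
    exact congrArg _ (sum_coeff_weightU n p)
  | hadd x y hx hy => rw [map_add, eval_add, hx, hy]
  | hmul k x hx =>
    rw [map_mul, theta_genXi, ← C_mul_X_pow_eq_monomial, mul_assoc, X_pow_mul, eval_C_mul,
      eval_mul_X_pow, hx, one_pow, mul_one]

lemma sum_coeff_theta (n : ℕ) (x : Model n) :
    ∑ w ∈ (theta n x).support, (theta n x).coeff w = x := by
  conv_rhs => rw [← eval_one_theta n x, eval_eq_sum, Polynomial.sum_def]
  exact Finset.sum_congr rfl fun w _ => by rw [one_pow, mul_one]

/-! ## The weight filtration -/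

noncomputable section

/-- The filtration of `ℂ[u]` by minus the weight. -/
def uFilt (n : ℕ) (i : ℤ) : Submodule ℂ (MvPolynomial (Fin (n - 1)) ℂ) where
  carrier := {p | VanishesBelow i (weightU n p)}
  zero_mem' := fun w _ => by rw [map_zero, coeff_zero]
  add_mem' := fun {p q} hp hq w hw => by rw [map_add, coeff_add, hp w hw, hq w hw, add_zero]
  smul_mem' := fun c p hp w hw => by rw [map_smul, coeff_smul, hp w hw, smul_zero]

/-- The filtration of the model algebra by minus the weight. -/
def modelFilt (n : ℕ) (i : ℤ) : Submodule ℂ (Model n) where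
  carrier := {x | VanishesBelow i (theta n x)}
  zero_mem' := fun w _ => by rw [map_zero, coeff_zero]
  add_mem' := fun {p q} hp hq w hw => by rw [map_add, coeff_add, hp w hw, hq w hw, add_zero]
  smul_mem' := fun c p hp w hw => by rw [map_smul, coeff_smul, hp w hw, smul_zero]

/-- The component of weight `-i`. -/
def weightPart (n : ℕ) (i : ℤ) : Model n →ₗ[ℂ] Model n where
  toFun x := coeffNeg i (theta n x)
  map_add' x y := by
    rw [map_add, coeffNeg, coeffNeg, coeffNeg]
    split_ifs
    · rw [coeff_add]
    · rw [add_zero]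
  map_smul' c x := by
    rw [map_smul, coeffNeg, coeffNeg, RingHom.id_apply]
    split_ifs
    · rw [coeff_smul]
    · rw [smul_zero]

end

lemma mem_uFilt (n : ℕ) (i : ℤ) (p : MvPolynomial (Fin (n - 1)) ℂ) :
    p ∈ uFilt n i ↔ VanishesBelow i (weightU n p) := Iff.rfl

lemma mem_modelFilt (n : ℕ) (i : ℤ) (x : Model n) :
    x ∈ modelFilt n i ↔ VanishesBelow i (theta n x) := Iff.rfl

lemma weightPart_apply (n : ℕ) (i : ℤ) (x : Model n) : weightPart n i x = coeffNeg i (theta n x) :=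
  rfl

lemma uFilt_mono (n : ℕ) {i j : ℤ} (h : i ≤ j) : uFilt n i ≤ uFilt n j :=
  fun _ hp => VanishesBelow.mono hp h

lemma modelFilt_mono (n : ℕ) {i j : ℤ} (h : i ≤ j) : modelFilt n i ≤ modelFilt n j :=
  fun _ hp => VanishesBelow.mono hp h

lemma mul_mem_uFilt (n : ℕ) {i j : ℤ} {p q : MvPolynomial (Fin (n - 1)) ℂ} (hp : p ∈ uFilt n i)
    (hq : q ∈ uFilt n j) : p * q ∈ uFilt n (i + j) := by
  rw [mem_uFilt, map_mul]
  exact VanishesBelow.mul hp hq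

lemma mul_mem_modelFilt (n : ℕ) {i j : ℤ} {x y : Model n} (hx : x ∈ modelFilt n i)
    (hy : y ∈ modelFilt n j) : x * y ∈ modelFilt n (i + j) := by
  rw [mem_modelFilt, map_mul]
  exact VanishesBelow.mul hx hy

lemma weightPart_mul (n : ℕ) {i j : ℤ} {x y : Model n} (hx : x ∈ modelFilt n i)
    (hy : y ∈ modelFilt n j) :
    weightPart n (i + j) (x * y) = weightPart n i x * weightPart n j y := by
  simp only [weightPart_apply, map_mul]
  exact VanishesBelow.coeffNeg_mul hx hy

lemma weightPart_of_mem (n : ℕ) {i : ℤ} {x : Model n} (hx : x ∈ modelFilt n (i - 1)) :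
    weightPart n i x = 0 :=
  VanishesBelow.coeffNeg_of_lt hx (by omega)

lemma modelFilt_of_nonneg (n : ℕ) {i : ℤ} (hi : 0 ≤ i) (x : Model n) : x ∈ modelFilt n i :=
  fun w hw => by omega

lemma theta_weightPart (n : ℕ) (w : ℕ) (x : Model n) :
    theta n (weightPart n (-(w : ℤ)) x) = monomial w (weightPart n (-(w : ℤ)) x) := by
  rw [weightPart_apply, coeffNeg_natCast, theta_coeff]

lemma isPure_theta_weightPart (n : ℕ) (i : ℤ) (x : Model n) :
    IsPure i (theta n (weightPart n i x)) := by
  by_cases hi : i ≤ 0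
  · obtain ⟨a, rfl⟩ : ∃ a : ℕ, i = -a := ⟨(-i).toNat, by omega⟩
    rw [theta_weightPart]
    exact isPure_monomial _ _
  · rw [weightPart_apply, coeffNeg, if_neg hi, map_zero]
    exact isPure_zero i

lemma weightPart_mem (n : ℕ) (i : ℤ) (x : Model n) : weightPart n i x ∈ modelFilt n i :=
  (isPure_theta_weightPart n i x).vanishesBelow

lemma weightPart_weightPart (n : ℕ) (w : ℕ) (x : Model n) :
    weightPart n (-(w : ℤ)) (weightPart n (-(w : ℤ)) x) = weightPart n (-(w : ℤ)) x := by
  rw [weightPart_apply n _ (weightPart n _ x), theta_weightPart, coeffNeg_natCast, coeff_monomial,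
    if_pos rfl]

lemma sub_weightPart_mem (n : ℕ) {i : ℤ} {x : Model n} (hx : x ∈ modelFilt n i) :
    x - weightPart n i x ∈ modelFilt n (i - 1) := by
  by_cases hi : i ≤ 0
  · obtain ⟨a, rfl⟩ : ∃ a : ℕ, i = -a := ⟨(-i).toNat, by omega⟩
    intro w hw
    have h1 : theta n (x - weightPart n (-(a : ℤ)) x) =
        theta n x - monomial a ((theta n x).coeff a) := by
      rw [map_sub, theta_weightPart, weightPart_apply, coeffNeg_natCast]
    rw [h1, coeff_sub, coeff_monomial]
    split_ifs with h
    · rw [h]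
      exact sub_self _
    · rw [hx w (by omega)]
      exact sub_self _
  · exact modelFilt_of_nonneg n (by omega) _

lemma weightPart_of_isPure (n : ℕ) {i : ℤ} {x : Model n} (hx : IsPure i (theta n x)) :
    weightPart n i x = x := by
  conv_rhs => rw [← sum_coeff_theta n x]
  by_cases hi : i ≤ 0
  · obtain ⟨a, rfl⟩ : ∃ a : ℕ, i = -a := ⟨(-i).toNat, by omega⟩
    rw [weightPart_apply, coeffNeg_natCast, Finset.sum_eq_single a]
    · intro w _ hw
      exact hx w (by omega)
    · intro h
      exact notMem_support_iff.1 h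
  · rw [weightPart_apply, coeffNeg, if_neg hi]
    symm
    exact Finset.sum_eq_zero fun w _ => hx w (by omega)

lemma isPure_theta_genXi (n : ℕ) (k : Fin (n - 1)) :
    IsPure (-((k : ℤ) + 1)) (theta n (genXi n k)) := by
  rw [theta_genXi]
  have := isPure_monomial ((k : ℕ) + 1) (genXi n k)
  push_cast at this
  exact this

lemma isPure_theta_inclU (n : ℕ) {i : ℤ} {p : MvPolynomial (Fin (n - 1)) ℂ}
    (hp : IsPure i (weightU n p)) : IsPure i (theta n (inclU n p)) := fun w hw => by
  rw [coeff_theta_inclU, hp w hw, map_zero]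

lemma isPure_weightU_X (n : ℕ) (k : Fin (n - 1)) :
    IsPure (-(k : ℤ)) (weightU n (MvPolynomial.X k)) := by
  rw [weightU_X]
  exact isPure_monomial _ _

lemma inclU_mem_modelFilt (n : ℕ) {i : ℤ} {p : MvPolynomial (Fin (n - 1)) ℂ}
    (hp : p ∈ uFilt n i) : inclU n p ∈ modelFilt n i := fun w hw => by
  rw [coeff_theta_inclU, hp w hw, map_zero]

/-! ## Powers of the generating function of the `u_k` -/

/-- The generating function `∑ u_k t^k`. -/
noncomputable def genU (n : ℕ) : (MvPolynomial (Fin (n - 1)) ℂ)[X] :=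
  ∑ k : Fin (n - 1), monomial ((k : ℕ) + 1) (MvPolynomial.X k)

lemma coeff_genU (n j : ℕ) : (genU n).coeff j = uVar n j := by
  rw [genU, finsetSum_coeff]
  simp only [coeff_monomial]
  cases j with
  | zero => simp [uVar]
  | succ k =>
    by_cases h : k < n - 1
    · rw [Finset.sum_eq_single ⟨k, h⟩]
      · rw [if_pos rfl, uVar, dif_pos h]
      · intro j _ hj
        rw [if_neg]
        intro e
        exact hj (Fin.ext (Nat.succ.inj e))
      · simp
    · rw [uVar, dif_neg h]
      refine Finset.sum_eq_zero fun j _ => if_neg ?_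
      omega

lemma isPure_weightU_uVar (n j : ℕ) : IsPure (1 - (j : ℤ)) (weightU n (uVar n j)) := by
  cases j with
  | zero =>
    rw [uVar, map_zero]
    exact isPure_zero _
  | succ k =>
    rw [uVar]
    split_ifs with h
    · have := isPure_weightU_X n ⟨k, h⟩
      have e : (1 : ℤ) - (k + 1 : ℕ) = -k := by push_cast; ring
      rw [e]
      exact this
    · rw [map_zero]
      exact isPure_zero _

/-- Each monomial u_{j₁} ⋯ u_{j_N} with indices summing to k has weight ∑ (jₛ - 1) = k - N. -/
lemma isPure_weightU_coeff_pow (n N k : ℕ) :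
    IsPure ((N : ℤ) - k) (weightU n ((genU n ^ N).coeff k)) := by
  induction N generalizing k with
  | zero =>
    rw [pow_zero, coeff_one]
    split_ifs with h
    · rw [map_one, h]
      exact isPure_monomial 0 1
    · rw [map_zero]
      exact isPure_zero _
  | succ N ih =>
    rw [pow_succ', coeff_mul, map_sum]
    refine IsPure.sum _ fun ij hij => ?_
    rw [Finset.HasAntidiagonal.mem_antidiagonal] at hij
    rw [map_mul, coeff_genU]
    have h := (isPure_weightU_uVar n ij.1).mul (ih ij.2)
    have e : (1 - (ij.1 : ℤ)) + ((N : ℤ) - ij.2) = ((N + 1 : ℕ) : ℤ) - k := by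
      push_cast
      omega
    rwa [e] at h

lemma natCast_mem_uFilt (n : ℕ) (a : MvPolynomial (Fin (n - 1)) ℂ) : a ∈ uFilt n 0 :=
  fun w hw => by omega

/-- In the recursion the convolution with u reproduces the power of the generating function. The
term with the factor n - k - 1 has index k + 1 instead of k and one factor u fewer, so its weight is
higher. -/
lemma powCoeff_sub_mem_uFilt (n N k : ℕ) :
    powCoeff n (uVar n) N k - (genU n ^ N).coeff k ∈ uFilt n ((N : ℤ) - k - 1) := by
  induction N generalizing k with
  | zero =>
    rw [powCoeff, pow_zero, coeff_one, sub_self]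
    exact zero_mem _
  | succ N ih =>
    rw [powCoeff, pow_succ', coeff_mul, add_sub_assoc, ← Finset.sum_sub_distrib]
    refine add_mem ?_ (sum_mem fun ij hij => ?_)
    · have h1 : powCoeff n (uVar n) N (k + 1) ∈ uFilt n ((N : ℤ) - (k + 1 : ℕ)) := by
        have h2 := add_mem (uFilt_mono n (by omega) (ih (k + 1)))
          (show (genU n ^ N).coeff (k + 1) ∈ uFilt n ((N : ℤ) - (k + 1 : ℕ)) from
            (isPure_weightU_coeff_pow n N (k + 1)).vanishesBelow)
        rwa [sub_add_cancel] at h2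
      refine uFilt_mono n ?_ (mul_mem_uFilt n (natCast_mem_uFilt n _) h1)
      push_cast
      omega
    · rw [Finset.HasAntidiagonal.mem_antidiagonal] at hij
      rw [coeff_genU, ← mul_sub]
      refine uFilt_mono n ?_ (mul_mem_uFilt n
        (show uVar n ij.1 ∈ uFilt n (1 - (ij.1 : ℤ)) from
          (isPure_weightU_uVar n ij.1).vanishesBelow) (ih ij.2))
      push_cast
      omega

lemma powCoeff_mem_uFilt (n N k : ℕ) : powCoeff n (uVar n) N k ∈ uFilt n ((N : ℤ) - k) := by
  have h := add_mem (uFilt_mono n (by omega) (powCoeff_sub_mem_uFilt n N k))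
    (show (genU n ^ N).coeff k ∈ uFilt n ((N : ℤ) - k) from
      (isPure_weightU_coeff_pow n N k).vanishesBelow)
  rwa [sub_add_cancel] at h

/-! ## Monomials in the `u_j` and the filtration of `L` -/

/-- The monomial with exponents `a`. -/
noncomputable def uMonomial (n : ℕ) (a : Fin (n - 1) → ℕ) : MvPolynomial (Fin (n - 1)) ℂ :=
  ∏ j, MvPolynomial.X j ^ a j

/-- The weight of a monomial. -/
def uWeight (n : ℕ) (a : Fin (n - 1) → ℕ) : ℕ := ∑ j : Fin (n - 1), (j : ℕ) * a j

lemma evalU_uMonomial (n : ℕ) (a : Fin (n - 1) → ℕ) :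
    evalU n (uMonomial n a) = ∏ j : Fin (n - 1), u n ((j : ℕ) + 1) ^ a j := by
  rw [uMonomial, map_prod]
  exact Finset.prod_congr rfl fun j _ => by rw [map_pow, evalU_X]

lemma weightU_uMonomial (n : ℕ) (a : Fin (n - 1) → ℕ) :
    weightU n (uMonomial n a) = monomial (uWeight n a) (uMonomial n a) := by
  have h : ∀ s : Finset (Fin (n - 1)), weightU n (∏ j ∈ s, MvPolynomial.X j ^ a j) =
      monomial (∑ j ∈ s, (j : ℕ) * a j) (∏ j ∈ s, MvPolynomial.X j ^ a j) := by
    intro s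
    induction s using Finset.induction_on with
    | empty => simp
    | insert k s hk ih =>
      rw [Finset.prod_insert hk, Finset.sum_insert hk, map_mul, map_pow, weightU_X, monomial_pow, ih,
        monomial_mul_monomial]
  exact h Finset.univ

/-- The variable with index j stands for u_{j+1}, of degree j + 2 in x. Twice the u-degree cancels
the 2, leaving minus the weight. -/
lemma degree_eq_neg_uWeight (n : ℕ) (a : Fin (n - 1) → ℕ) (k : ℕ) :
    2 * (∑ j, (a j : ℤ)) -
      ((∑ j : Fin (n - 1), (((j : ℕ) : ℤ) + 2) * (a j : ℤ)) + (n.choose 2 : ℤ) - (k : ℤ)) =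
    (k : ℤ) - n.choose 2 - uWeight n a := by
  have h : ∑ j : Fin (n - 1), (((j : ℕ) : ℤ) + 2) * (a j : ℤ) =
      (uWeight n a : ℤ) + 2 * ∑ j, (a j : ℤ) := by
    rw [uWeight, Finset.mul_sum, Nat.cast_sum, ← Finset.sum_add_distrib]
    exact Finset.sum_congr rfl fun j _ => by push_cast; ring
  rw [h]
  ring

lemma mul_mem_filtL (n : ℕ) {i : ℤ} {k : ℕ} (a : Fin (n - 1) → ℕ)
    (h : (k : ℤ) - n.choose 2 - uWeight n a ≤ i) {p : polyRep n} (hp : p ∈ wordSpan n k) :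
    evalU n (uMonomial n a) * p ∈ filtL n i := by
  induction hp using Submodule.span_induction with
  | zero => rw [mul_zero]; exact zero_mem _
  | add p q _ _ hp hq => rw [mul_add]; exact add_mem hp hq
  | smul c p _ hp => rw [mul_smul_comm]; exact Submodule.smul_mem _ c hp
  | mem p hp =>
    obtain ⟨l, rfl, rfl⟩ := hp
    refine Submodule.subset_span ⟨a, l.map (basisProj n), ?_, ?_⟩
    · rw [List.length_map, degree_eq_neg_uWeight]
      exact h
    · have e : (l.map (basisProj n)).map (dunklVec n) = l.map (dunkl n) := by
        rw [List.map_map]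
        exact List.map_congr_left fun i _ => dunklVec_basisProj n i
      rw [evalU_uMonomial, e]

lemma filtL_le (n : ℕ) {i : ℤ} {M : Submodule ℂ (polyRep n)}
    (h : ∀ (k : ℕ) (a : Fin (n - 1) → ℕ), (k : ℤ) - n.choose 2 - uWeight n a ≤ i →
      ∀ p ∈ wordSpan n k, evalU n (uMonomial n a) * p ∈ M) : filtL n i ≤ M := by
  rw [filtL, Submodule.span_le]
  rintro _ ⟨a, w, hw, rfl⟩
  rw [degree_eq_neg_uWeight] at hw
  rw [← evalU_uMonomial]
  exact h _ a hw _ (dunklVec_word_mem n w)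

lemma evalU_mem (n : ℕ) (p : MvPolynomial (Fin (n - 1)) ℂ) : evalU n p ∈ invPoly n := by
  induction p using MvPolynomial.induction_on with
  | C a =>
    have : evalU n (MvPolynomial.C a) = algebraMap ℂ _ a := AlgHom.commutes _ a
    rw [this]
    exact Subalgebra.algebraMap_mem _ a
  | add p q hp hq => rw [map_add]; exact add_mem hp hq
  | mul_X p k hp => rw [map_mul, evalU_X]; exact mul_mem hp (u_mem n k)

lemma dunkl_filtL (n : ℕ) (i : ℤ) (j : Fin n) {p : polyRep n} (hp : p ∈ filtL n i) :
    dunkl n j p ∈ filtL n (i + 1) := by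
  refine filtL_le n (M := (filtL n (i + 1)).comap (dunkl n j)) (fun k a h p hp => ?_) hp
  rw [Submodule.mem_comap,
    dunkl_mul_of_invariant n j ((mem_invPoly n _).1 (evalU_mem n (uMonomial n a)))]
  exact mul_mem_filtL n a (by push_cast; omega) (dunkl_wordSpan n k j hp)

lemma uMonomial_mem_uFilt (n : ℕ) {i : ℤ} (a : Fin (n - 1) → ℕ) (h : -(uWeight n a : ℤ) ≤ i) :
    uMonomial n a ∈ uFilt n i := by
  rw [mem_uFilt, weightU_uMonomial]
  exact (isPure_monomial _ _).vanishesBelow.mono h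

theorem mem_uFilt_of_evalU_mem (n : ℕ) (hn : 0 < n) {i : ℤ} {p : MvPolynomial (Fin (n - 1)) ℂ}
    (hp : evalU n p ∈ filtL n i) : p ∈ uFilt n i := by
  have key : avgPoly n (evalU n p) ∈ (uFilt n i).map (evalU n).toLinearMap := by
    refine filtL_le n (M := ((uFilt n i).map (evalU n).toLinearMap).comap (avgPoly n))
      (fun k a h p hp => ?_) hp
    rw [Submodule.mem_comap, avgPoly_mul n (evalU_mem n (uMonomial n a))]
    -- Averaging kills short words, and long ones are constants. In the second case k is at least
    -- n(n-1)/2, so the bound on the filtration degree becomes a bound on the weight alone.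
    by_cases hk : k < n.choose 2
    · have h0 : avgPoly n p = 0 := by
        induction hp using Submodule.span_induction with
        | zero => rw [map_zero]
        | add p q _ _ hp hq => rw [map_add, hp, hq, add_zero]
        | smul c p _ hp => rw [map_smul, hp, smul_zero]
        | mem p hp =>
          obtain ⟨l, rfl, rfl⟩ := hp
          exact avgPoly_word n l hk
      rw [h0, mul_zero]
      exact zero_mem _
    · obtain ⟨c, rfl⟩ := exists_algebraMap_of_mem_wordSpan n k (not_lt.1 hk) hp
      rw [avgPoly_of_mem n (Subalgebra.algebraMap_mem _ c), mul_comm, ← Algebra.smul_def]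
      exact Submodule.smul_mem _ _
        (Submodule.mem_map_of_mem (f := (evalU n).toLinearMap)
          (uMonomial_mem_uFilt n a (by omega)))
  rw [avgPoly_of_mem n (evalU_mem n p)] at key
  obtain ⟨q, hq, h⟩ := key
  rwa [← evalU_injective n hn h]

/-! ## Elements of low weight have low degree -/

lemma list_prod_genXi (n : ℕ) (l : List (Fin (n - 1))) : (l.map (genXi n)).prod =
    ((l.map fun k => (Pi.single k 1 : Fin (n - 1) → ℂ)).map (ExteriorAlgebra.ι ℂ)).prod ⊗ₜ 1 := by
  induction l with
  | nil => rfl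
  | cons k l ih =>
    rw [List.map_cons, List.prod_cons, ih, genXi_mul_tmul, List.map_cons, List.map_cons,
      List.prod_cons]

lemma list_prod_genXi_eq_zero (n : ℕ) {l : List (Fin (n - 1))} (h : ¬ l.Nodup) :
    (l.map (genXi n)).prod = 0 := by
  induction l with
  | nil => exact absurd List.nodup_nil h
  | cons k l ih =>
    rw [List.map_cons, List.prod_cons]
    by_cases hk : k ∈ l
    · have h0 := ι_mul_prod_eq_zero (R := ℂ) (m := (Pi.single k 1 : Fin (n - 1) → ℂ))
        (l := l.map fun k => Pi.single k 1) (List.mem_map.2 ⟨k, hk, rfl⟩)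
      rw [list_prod_genXi, genXi_mul_tmul, h0, TensorProduct.zero_tmul]
    · rw [ih fun hl => h (List.nodup_cons.2 ⟨hk, hl⟩), mul_zero]

lemma model_monomial_induction (n : ℕ) {C : Model n → Prop} (hadd : ∀ x y, C x → C y → C (x + y))
    (hsmul : ∀ (c : ℂ) x, C x → C (c • x))
    (hmon : ∀ (l : List (Fin (n - 1))) (a : Fin (n - 1) → ℕ), C ((l.map (genXi n)).prod * inclU n (uMonomial n a))) (x : Model n) : C x := by
  have key : ∀ l : List (Fin (n - 1)), C ((l.map (genXi n)).prod * x) := by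
    induction x using model_induction with
    | hU p =>
      intro l
      induction p using MvPolynomial.induction_on' with
      | monomial s c =>
        have : MvPolynomial.monomial s c = c • uMonomial n s := by
          rw [MvPolynomial.monomial_eq, uMonomial, MvPolynomial.smul_eq_C_mul,
            Finsupp.prod_fintype _ _ fun i => pow_zero _]
        rw [this, map_smul, mul_smul_comm]
        exact hsmul _ _ (hmon l s)
      | add p q hp hq => rw [map_add, mul_add]; exact hadd _ _ hp hq
    | hadd x y hx hy => intro l; rw [mul_add]; exact hadd _ _ (hx l) (hy l)
    | hmul k x hx =>
      intro l
      have := hx (l ++ [k])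
      rwa [List.map_append, List.prod_append, List.map_singleton, List.prod_singleton,
        mul_assoc] at this
  simpa using key []

lemma modelHom_list_prod (n : ℕ) (l : List (Fin (n - 1))) :
    modelHom n (l.map (genXi n)).prod = dualProd n l := by
  rw [map_list_prod, List.map_map, dualProd]
  exact congrArg _ (List.map_congr_left fun k _ => modelHom_genXi n k)

lemma theta_list_prod (n : ℕ) (l : List (Fin (n - 1))) : theta n (l.map (genXi n)).prod =
    monomial (l.map fun j : Fin (n - 1) => (j : ℕ) + 1).sum (l.map (genXi n)).prod := by
  induction l with
  | nil => exact map_one _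
  | cons k l ih =>
    rw [List.map_cons, List.prod_cons, map_mul, theta_genXi, ih, monomial_mul_monomial,
      List.map_cons (f := fun j : Fin (n - 1) => (j : ℕ) + 1), List.sum_cons]

lemma mem_filtH (n : ℕ) (i : ℤ) (y : Forms n) :
    y ∈ filtH n i ↔ y ∈ stableH n ∧ y ∈ formsIn n (filtL n i) := Iff.rfl

/-- The Dunkl word for a product of ξ's has length n(n-1)/2 minus the weight of the product, so the
filtration degree is minus the total weight. A repeated generator gives zero. -/
lemma modelHom_monomial_mem_filtH (n : ℕ) (hn : 1 ≤ n) (l : List (Fin (n - 1)))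
    (a : Fin (n - 1) → ℕ) : modelHom n ((l.map (genXi n)).prod * inclU n (uMonomial n a)) ∈
      filtH n (-(((l.map fun j : Fin (n - 1) => (j : ℕ) + 1).sum + uWeight n a : ℕ) : ℤ)) := by
  by_cases hl : l.Nodup
  · refine (mem_filtH _ _ _).2 ⟨modelHom_mem n _, ?_⟩
    obtain ⟨k, hk, h⟩ := dualProd_mem_formsIn n hn l hl
    rw [map_mul, modelHom_list_prod, modelHom_inclU, ← scal_comm, ← onCoeff_mulLeft]
    exact onCoeff_mem_formsIn n _ (fun p hp => mul_mem_filtL n a (by rw [← hk, Nat.cast_add, Nat.cast_add]; omega) hp) h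
  · rw [list_prod_genXi_eq_zero n hl, zero_mul, map_zero]
    exact zero_mem _

lemma modelHom_coeff_theta_mem_filtH (n : ℕ) (hn : 1 ≤ n) (x : Model n) (w : ℕ) :
    modelHom n ((theta n x).coeff w) ∈ filtH n (-(w : ℤ)) := by
  induction x using model_monomial_induction with
  | hadd x y hx hy => rw [map_add, coeff_add, map_add]; exact add_mem hx hy
  | hsmul c x hx => rw [map_smul, coeff_smul, map_smul]; exact Submodule.smul_mem _ _ hx
  | hmon l a =>
    have e : theta n ((l.map (genXi n)).prod * inclU n (uMonomial n a)) =
        monomial ((l.map fun j : Fin (n - 1) => (j : ℕ) + 1).sum + uWeight n a)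
          ((l.map (genXi n)).prod * inclU n (uMonomial n a)) := by
      rw [map_mul, theta_list_prod, theta_inclU, weightU_uMonomial, coe_mapAlgHom, map_monomial,
        monomial_mul_monomial]
      rfl
    rw [e, coeff_monomial]
    split_ifs with h
    · rw [← h]
      exact modelHom_monomial_mem_filtH n hn l a
    · rw [map_zero]
      exact zero_mem _

lemma filtL_mono (n : ℕ) {i j : ℤ} (h : i ≤ j) : filtL n i ≤ filtL n j :=
  filtL_le n fun _ a hk _ hp => mul_mem_filtL n a (hk.trans h) hp

lemma filtH_mono (n : ℕ) {i j : ℤ} (h : i ≤ j) : filtH n i ≤ filtH n j :=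
  inf_le_inf_left _ (formsIn_mono n (filtL_mono n h))

lemma modelHom_mem_filtH (n : ℕ) (hn : 1 ≤ n) {i : ℤ} {x : Model n} (hx : x ∈ modelFilt n i) :
    modelHom n x ∈ filtH n i := by
  rw [← sum_coeff_theta n x, map_sum]
  refine sum_mem fun w hw => filtH_mono n ?_ (modelHom_coeff_theta_mem_filtH n hn x w)
  by_contra h
  exact mem_support_iff.1 hw (hx w (by omega))

/-! ## Elements of low degree have low weight -/

/-- The component of exterior degree zero of an element of the model algebra. -/
noncomputable def modelFunctionPart (n : ℕ) : Model n →ₗ[ℂ] MvPolynomial (Fin (n - 1)) ℂ :=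
  (TensorProduct.lid ℂ _).toLinearMap ∘ₗ TensorProduct.map
    (ExteriorAlgebra.algebraMapInv (R := ℂ) (M := Fin (n - 1) → ℂ)).toLinearMap LinearMap.id

lemma modelFunctionPart_tmul (n : ℕ) (a : ExteriorAlgebra ℂ (Fin (n - 1) → ℂ))
    (p : MvPolynomial (Fin (n - 1)) ℂ) :
    modelFunctionPart n (a ⊗ₜ p) = ExteriorAlgebra.algebraMapInv a • p := rfl

lemma modelFunctionPart_inclU (n : ℕ) (p : MvPolynomial (Fin (n - 1)) ℂ) :
    modelFunctionPart n (inclU n p) = p := by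
  rw [inclU_apply, modelFunctionPart_tmul, map_one, one_smul]

lemma modelFunctionPart_genXi_mul (n : ℕ) (k : Fin (n - 1)) (x : Model n) :
    modelFunctionPart n (genXi n k * x) = 0 := by
  induction x using TensorProduct.induction_on with
  | zero => rw [mul_zero, map_zero]
  | add x y hx hy => rw [mul_add, map_add, hx, hy, add_zero]
  | tmul a p => rw [genXi_mul_tmul, modelFunctionPart_tmul, algebraMapInv_ι_mul, zero_smul]

lemma functionPart_mul (n : ℕ) (y z : Forms n) :
    functionPart n (y * z) = functionPart n y * functionPart n z := by
  induction y using TensorProduct.induction_on with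
  | zero => rw [zero_mul, map_zero, zero_mul]
  | add y y' h h' => rw [add_mul, map_add, map_add, h, h', add_mul]
  | tmul a p =>
    induction z using TensorProduct.induction_on with
    | zero => rw [mul_zero, map_zero, mul_zero]
    | add z z' h h' => rw [mul_add, map_add, map_add, h, h', mul_add]
    | tmul b q =>
      rw [Algebra.TensorProduct.tmul_mul_tmul, functionPart_tmul, functionPart_tmul,
        functionPart_tmul, map_mul, smul_mul_smul_comm]

lemma functionPart_dualForm (n : ℕ) (k : Fin (n - 1)) : functionPart n (dualForm n k) = 0 := by
  have h : ∀ y : Forms n, functionPart n (hat n y) = functionPart n y := by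
    intro y
    induction y using TensorProduct.induction_on with
    | zero => rw [map_zero]
    | add y z hy hz => rw [map_add, map_add, map_add, hy, hz]
    | tmul a p =>
      rw [hat_tmul, functionPart_tmul, functionPart_tmul]
      congr 1
      induction a using exterior_induction with
      | hr r => rw [AlgHom.commutes]
      | hadd a b ha hb => rw [map_add, map_add, map_add, ha, hb]
      | hmul v a ha =>
        rw [map_mul, involute_ι, neg_mul, map_neg, algebraMapInv_ι_mul, algebraMapInv_ι_mul,
          neg_zero]
  have h1 := h (dualForm n k)
  rw [hat_dualForm, map_neg] at h1
  exact self_eq_neg.1 h1.symm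

lemma functionPart_modelHom (n : ℕ) (x : Model n) :
    functionPart n (modelHom n x) = evalU n (modelFunctionPart n x) := by
  induction x using model_induction with
  | hU p => rw [modelHom_inclU, functionPart_scal, modelFunctionPart_inclU]
  | hadd x y hx hy => simp only [map_add, hx, hy]
  | hmul k x hx =>
    rw [map_mul, modelHom_genXi, functionPart_mul, functionPart_dualForm, zero_mul,
      modelFunctionPart_genXi_mul, map_zero]

lemma coeff_weightU_modelFunctionPart (n : ℕ) (x : Model n) (w : ℕ) :
    (weightU n (modelFunctionPart n x)).coeff w = modelFunctionPart n ((theta n x).coeff w) := by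
  induction x using model_induction with
  | hU p => rw [coeff_theta_inclU, modelFunctionPart_inclU, modelFunctionPart_inclU]
  | hadd x y hx hy => simp only [map_add, coeff_add, hx, hy]
  | hmul k x hx =>
    rw [coeff_theta_genXi_mul, modelFunctionPart_genXi_mul, map_zero, coeff_zero]
    split_ifs
    · rw [modelFunctionPart_genXi_mul]
    · rw [map_zero]

lemma modelFunctionPart_mem (n : ℕ) {i : ℤ} {x : Model n} (hx : x ∈ modelFilt n i) :
    modelFunctionPart n x ∈ uFilt n i := fun w hw => by
  rw [coeff_weightU_modelFunctionPart, hx w hw, map_zero]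

/-- Removing a generator of weight k + 1 lowers weights by k + 1. -/
lemma modelDelta_coeff_theta (n : ℕ) (k : Fin (n - 1)) (x : Model n) (w : ℕ) :
    modelDelta n k ((theta n x).coeff w) =
      (X ^ ((k : ℕ) + 1) * theta n (modelDelta n k x)).coeff w := by
  induction x using model_induction generalizing w with
  | hU p => rw [coeff_theta_inclU, modelDelta_inclU, modelDelta_inclU, map_zero, mul_zero, coeff_zero]
  | hadd x y hx hy => simp only [map_add, coeff_add, hx, hy, mul_add]
  | hmul j x hx =>
    have h1 : (X ^ ((k : ℕ) + 1) * theta n (modelDelta n k (genXi n j * x))).coeff w +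
        (X ^ ((k : ℕ) + 1) * theta n (genXi n j * modelDelta n k x)).coeff w =
        (X ^ ((k : ℕ) + 1) * theta n (if k = j then x else 0)).coeff w := by
      rw [← modelDelta_genXi_mul n j k x, map_add, mul_add, coeff_add]
    have h2 : (X ^ ((k : ℕ) + 1) * theta n (genXi n j * modelDelta n k x)).coeff w =
        if (j : ℕ) + 1 ≤ w then genXi n j * modelDelta n k ((theta n x).coeff (w - (j + 1))) else 0 := by
      rw [map_mul, theta_genXi, hx, ← mul_assoc, X_pow_mul, mul_assoc, coeff_monomial_mul_eq]
    refine add_right_cancel (Eq.trans ?_ h1.symm)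
    rw [h2, coeff_theta_genXi_mul, coeff_X_pow_mul']
    by_cases hj : (j : ℕ) + 1 ≤ w
    · rw [if_pos hj, if_pos hj, modelDelta_genXi_mul]
      by_cases hjk : k = j
      · rw [hjk, if_pos rfl, if_pos rfl, if_pos hj]
      · rw [if_neg hjk, if_neg hjk, map_zero, coeff_zero, ite_self]
    · rw [if_neg hj, if_neg hj, map_zero, add_zero]
      by_cases hjk : k = j
      · rw [hjk, if_neg hj]
      · rw [if_neg hjk, map_zero, coeff_zero, ite_self]

lemma modelDelta_mem (n : ℕ) (k : Fin (n - 1)) {i : ℤ} {x : Model n} (hx : x ∈ modelFilt n i) :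
    modelDelta n k x ∈ modelFilt n (i + ((k : ℕ) + 1)) := fun w hw => by
  have h := modelDelta_coeff_theta n k x (w + (k + 1))
  rw [coeff_X_pow_mul, hx _ (by push_cast; omega), map_zero] at h
  exact h.symm

/-- The composition of the derivatives with respect to the generators in a list. -/
noncomputable def modelDeltaList (n : ℕ) (l : List (Fin (n - 1))) : Module.End ℂ (Model n) :=
  (l.map fun k => (modelDelta n k : Module.End ℂ (Model n))).prod

lemma modelDeltaList_nil (n : ℕ) (x : Model n) : modelDeltaList n [] x = x := rfl

lemma modelDeltaList_cons (n : ℕ) (k : Fin (n - 1)) (l : List (Fin (n - 1))) (x : Model n) :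
    modelDeltaList n (k :: l) x = modelDelta n k (modelDeltaList n l x) := by
  rw [modelDeltaList, List.map_cons, List.prod_cons, Module.End.mul_apply, modelDeltaList]

lemma modelDeltaList_concat (n : ℕ) (l : List (Fin (n - 1))) (k : Fin (n - 1)) (x : Model n) :
    modelDeltaList n (l ++ [k]) x = modelDeltaList n l (modelDelta n k x) := by
  rw [modelDeltaList, List.map_append, List.prod_append, List.map_singleton, List.prod_singleton,
    Module.End.mul_apply, modelDeltaList]

lemma modelDeltaList_mem (n : ℕ) (l : List (Fin (n - 1))) {i : ℤ} {x : Model n}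
    (hx : x ∈ modelFilt n i) : modelDeltaList n l x ∈
      modelFilt n (i + (l.map fun j : Fin (n - 1) => (j : ℕ) + 1).sum) := by
  induction l with
  | nil => rw [modelDeltaList_nil]; simpa using hx
  | cons k l ih =>
    rw [modelDeltaList_cons, List.map_cons (f := fun j : Fin (n - 1) => (j : ℕ) + 1), List.sum_cons]
    refine modelFilt_mono n ?_ (modelDelta_mem n k ih)
    push_cast
    omega

lemma modelHom_modelDeltaList (n : ℕ) (l : List (Fin (n - 1))) (x : Model n) :
    modelHom n (modelDeltaList n l x) =
      (l.map (delta n)).prod (modelHom n x) := by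
  induction l with
  | nil => rfl
  | cons k l ih =>
    rw [modelDeltaList_cons, modelHom_modelDelta, ih, List.map_cons,
      List.prod_cons, Module.End.mul_apply]

/-- An element of the model is determined by the function parts of its iterated derivatives; peeling
shows that its weights are too. -/
theorem mem_modelFilt_of_modelFunctionPart (n : ℕ) (i : ℤ) (x : Model n)
    (hx : ∀ l : List (Fin (n - 1)), modelFunctionPart n (modelDeltaList n l x) ∈
      uFilt n (i + (l.map fun j : Fin (n - 1) => (j : ℕ) + 1).sum)) : x ∈ modelFilt n i := by
  refine model_peel n (P := fun i x => ∀ l : List (Fin (n - 1)), modelFunctionPart n (modelDeltaList n l x) ∈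
      uFilt n (i + (l.map fun j : Fin (n - 1) => (j : ℕ) + 1).sum))
    (C := fun i x => x ∈ modelFilt n i) ?_ ?_ ?_ ?_ ?_ i x hx
  · intro i p h
    have := h []
    rw [modelDeltaList_nil, modelFunctionPart_inclU] at this
    exact inclU_mem_modelFilt n (uFilt_mono n (by simp) this)
  · intro i k x h l
    have := h (l ++ [k])
    rw [modelDeltaList_concat] at this
    refine uFilt_mono n ?_ this
    rw [List.map_append, List.sum_append]
    simp only [List.map_cons, List.map_nil, List.sum_cons, List.sum_nil]
    push_cast
    omega
  · intro i k x h
    refine modelFilt_mono n ?_ (mul_mem_modelFilt n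
      (show genXi n k ∈ modelFilt n _ from (isPure_theta_genXi n k).vanishesBelow) h)
    omega
  · exact fun i x y => add_mem
  · intro i k x h h' l
    have h1 := modelDelta_genXi_mul n k k x
    rw [if_pos rfl] at h1
    have h2 := h l
    rw [← h1, map_add, map_add] at h2
    have h3 := modelFunctionPart_mem n (modelDeltaList_mem n l h')
    exact (Submodule.add_mem_iff_left _ h3).1 h2

theorem modelHom_mem_filtH_iff (n : ℕ) (hn : 1 ≤ n) (i : ℤ) (x : Model n) :
    modelHom n x ∈ filtH n i ↔ x ∈ modelFilt n i := by
  refine ⟨fun h => mem_modelFilt_of_modelFunctionPart n i x fun l => ?_, modelHom_mem_filtH n hn⟩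
  apply mem_uFilt_of_evalU_mem n hn
  rw [← functionPart_modelHom, modelHom_modelDeltaList]
  -- Each Dunkl operator raises the filtration by one, so δ with index j raises it by j + 1, the
  -- weight of the generator it removes. The function part of the result is then handled by
  -- averaging.
  have h1 := deltaList_mem_formsIn n l (S := fun k : ℕ => filtL n (i + k))
    (fun k j p hp => by
      have := dunkl_filtL n _ j hp
      rw [add_assoc] at this
      exact_mod_cast this) 0 (y := modelHom n x) (by simpa using h.2)
  rw [zero_add] at h1
  exact functionPart_mem n h1

/-! ## The associated graded algebra -/

section Classes

variable {A : Type} [Ring A] [Algebra ℂ A]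

lemma cls_congr (F : ℤ → Submodule ℂ A) {i j : ℤ} (hij : i = j) {x y : A} (hxy : x = y)
    (hx : x ∈ F i) (hy : y ∈ F j) : cls F i ⟨x, hx⟩ = cls F j ⟨y, hy⟩ := by
  subst hij
  subst hxy
  rfl

lemma grMap_grMul (F : ℤ → Submodule ℂ A)
    (hF : ∀ i j, ∀ x ∈ F i, ∀ y ∈ F j, x * y ∈ F (i + j)) (T : Module.End ℂ A) (N : ℤ)
    (hT : ∀ i, ∀ x ∈ F i, T x ∈ F (i + N)) (i : ℤ) (x : F i) (c : ℂ)
    (h : ∀ y, T (x * y) = T x * y + c • (x * T y)) (y : Gr F) :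
    grMap F T N hT (grMul F hF (cls F i x) y) =
      grMul F hF (grMap F T N hT (cls F i x)) y +
        c • grMul F hF (cls F i x) (grMap F T N hT y) := by
  have key : grMap F T N hT ∘ₗ grMul F hF (cls F i x) =
      grMul F hF (grMap F T N hT (cls F i x)) +
        c • (grMul F hF (cls F i x) ∘ₗ grMap F T N hT) := by
    refine gr_ext _ fun j y => ?_
    -- The three classes lie in degrees that agree only up to reassociation of the integer sum;
    -- `cls_congr` transports them to a common degree.
    rw [LinearMap.comp_apply, LinearMap.add_apply, LinearMap.smul_apply, LinearMap.comp_apply,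
      grMul_cls, grMap_cls, grMap_cls, grMap_cls, grMul_cls, grMul_cls]
    have h1 := hF (i + N) j _ (hT i x x.2) y y.2
    have h2 := hF i (j + N) x x.2 _ (hT j y y.2)
    have e1 : i + N + j = i + j + N := by ring
    have e2 : i + (j + N) = i + j + N := by ring
    rw [cls_congr F e1 rfl h1 (e1 ▸ h1), cls_congr F e2 rfl h2 (e2 ▸ h2), ← map_smul, ← map_add]
    exact cls_congr _ rfl (h y) _ _
  exact LinearMap.congr_fun key y

end Classes

noncomputable section

/-- The element of the model algebra that corresponds to an element of `F_i H`. -/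
def modelInv (n : ℕ) (hn : 1 ≤ n) (i : ℤ) : ↥(filtH n i) →ₗ[ℂ] Model n where
  toFun φ := (modelEquiv n hn).symm ⟨φ, φ.2.1⟩
  map_add' φ ψ := map_add (modelEquiv n hn).symm ⟨φ, φ.2.1⟩ ⟨ψ, ψ.2.1⟩
  map_smul' c φ := map_smul (modelEquiv n hn).symm c ⟨φ, φ.2.1⟩

lemma modelHom_modelInv (n : ℕ) (hn : 1 ≤ n) (i : ℤ) (φ : ↥(filtH n i)) :
    modelHom n (modelInv n hn i φ) = φ :=
  congrArg Subtype.val ((modelEquiv n hn).apply_symm_apply ⟨φ, φ.2.1⟩)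

lemma modelInv_modelHom (n : ℕ) (hn : 1 ≤ n) (i : ℤ) (x : Model n) (h : modelHom n x ∈ filtH n i) :
    modelInv n hn i ⟨modelHom n x, h⟩ = x :=
  (modelEquiv n hn).symm_apply_apply x

lemma modelInv_mem (n : ℕ) (hn : 1 ≤ n) (i : ℤ) (φ : ↥(filtH n i)) {j : ℤ}
    (h : (φ : Forms n) ∈ filtH n j) : modelInv n hn i φ ∈ modelFilt n j := by
  rwa [← modelHom_mem_filtH_iff n hn, modelHom_modelInv]

/-- The map that sends the class of an element of `F_i` to its component of weight `-i`. -/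
def grToModel (n : ℕ) (hn : 1 ≤ n) : Gr (filtH n) →ₗ[ℂ] Model n :=
  grLift (filtH n) (fun i => weightPart n i ∘ₗ modelInv n hn i) fun i φ h =>
    weightPart_of_mem n (modelInv_mem n hn i φ h)

lemma grToModel_cls (n : ℕ) (hn : 1 ≤ n) (i : ℤ) (φ : ↥(filtH n i)) :
    grToModel n hn (cls (filtH n) i φ) = weightPart n i (modelInv n hn i φ) :=
  grLift_cls _ _ _ i φ

/-- The class of the component of weight `w`. -/
def weightCls (n : ℕ) (hn : 1 ≤ n) (w : ℕ) : Model n →ₗ[ℂ] Gr (filtH n) where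
  toFun x := cls (filtH n) (-(w : ℤ)) ⟨modelHom n (weightPart n (-(w : ℤ)) x),
    modelHom_mem_filtH n hn (weightPart_mem n _ x)⟩
  map_add' x y := by
    rw [← map_add]
    exact cls_congr _ rfl (by rw [map_add, map_add]) _ _
  map_smul' c x := by
    rw [RingHom.id_apply, ← map_smul]
    exact cls_congr _ rfl (by rw [map_smul, map_smul]) _ _

lemma weightCls_apply (n : ℕ) (hn : 1 ≤ n) (w : ℕ) (x : Model n) : weightCls n hn w x =
    cls (filtH n) (-(w : ℤ)) ⟨modelHom n (weightPart n (-(w : ℤ)) x),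
      modelHom_mem_filtH n hn (weightPart_mem n _ x)⟩ := rfl

/-- The map that sends an element of weight `w` to its class in degree `-w`. -/
def modelToGr (n : ℕ) (hn : 1 ≤ n) : Model n →ₗ[ℂ] Gr (filtH n) :=
  Polynomial.lsum (weightCls n hn) ∘ₗ (theta n).toLinearMap

lemma modelToGr_apply (n : ℕ) (hn : 1 ≤ n) (x : Model n) : modelToGr n hn x =
    (theta n x).sum fun w y => weightCls n hn w y := rfl

lemma cls_weightPart (n : ℕ) (hn : 1 ≤ n) (i : ℤ) (φ : ↥(filtH n i)) :
    cls (filtH n) i φ = cls (filtH n) i ⟨modelHom n (weightPart n i (modelInv n hn i φ)),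
      modelHom_mem_filtH n hn (weightPart_mem n i _)⟩ := by
  rw [← sub_eq_zero, ← map_sub]
  apply cls_eq_zero
  have h := modelHom_mem_filtH n hn (sub_weightPart_mem n (modelInv_mem n hn i φ φ.2))
  rw [map_sub, modelHom_modelInv] at h
  exact h

lemma modelToGr_grToModel (n : ℕ) (hn : 1 ≤ n) :
    modelToGr n hn ∘ₗ grToModel n hn = LinearMap.id := by
  refine gr_ext _ fun i φ => ?_
  rw [LinearMap.comp_apply, grToModel_cls, LinearMap.id_apply]
  by_cases hi : i ≤ 0
  · obtain ⟨a, rfl⟩ : ∃ a : ℕ, i = -a := ⟨(-i).toNat, by omega⟩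
    rw [modelToGr_apply, theta_weightPart, sum_monomial_index _ _ (map_zero (weightCls n hn a)), weightCls_apply]
    exact (cls_congr _ rfl (by rw [weightPart_weightPart]) _ _).trans (cls_weightPart n hn _ φ).symm
  -- All weights are nonnegative, so the filtration is already everything in degree 0 and its graded
  -- pieces of positive degree vanish.
  · have h := modelFilt_of_nonneg n (i := i - 1) (by omega) (modelInv n hn i φ)
    rw [weightPart_of_mem n h, map_zero]
    symm
    apply cls_eq_zero
    rw [← modelHom_modelInv n hn i φ]
    exact modelHom_mem_filtH n hn h

lemma grToModel_modelToGr (n : ℕ) (hn : 1 ≤ n) :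
    grToModel n hn ∘ₗ modelToGr n hn = LinearMap.id := by
  refine LinearMap.ext fun x => ?_
  rw [LinearMap.comp_apply, modelToGr_apply, Polynomial.sum_def, map_sum, LinearMap.id_apply]
  conv_rhs => rw [← sum_coeff_theta n x]
  refine Finset.sum_congr rfl fun w _ => ?_
  rw [weightCls_apply, grToModel_cls, modelInv_modelHom, weightPart_weightPart, weightPart_apply,
    coeffNeg_natCast, theta_coeff, coeff_monomial, if_pos rfl]

/-- The model algebra is the associated graded of `H`. -/
def grEquiv (n : ℕ) (hn : 1 ≤ n) : Model n ≃ₗ[ℂ] Gr (filtH n) :=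
  LinearEquiv.ofLinearMap (modelToGr n hn) (grToModel n hn) (modelToGr_grToModel n hn)
    (grToModel_modelToGr n hn)

lemma grEquiv_symm_apply (n : ℕ) (hn : 1 ≤ n) (y : Gr (filtH n)) :
    (grEquiv n hn).symm y = grToModel n hn y := rfl

lemma grEquiv_of_isPure (n : ℕ) (hn : 1 ≤ n) {i : ℤ} {x : Model n} (hx : IsPure i (theta n x))
    (h : modelHom n x ∈ filtH n i) : grEquiv n hn x = cls (filtH n) i ⟨modelHom n x, h⟩ := by
  rw [← LinearEquiv.eq_symm_apply, grEquiv_symm_apply, grToModel_cls, modelInv_modelHom,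
    weightPart_of_isPure n hx]

lemma mul_mem_filtH (n : ℕ) (hn : 1 ≤ n) (i j : ℤ) (φ : Forms n) (hφ : φ ∈ filtH n i) (ψ : Forms n)
    (hψ : ψ ∈ filtH n j) : φ * ψ ∈ filtH n (i + j) := by
  have h := mul_mem_modelFilt n (modelInv_mem n hn i ⟨φ, hφ⟩ hφ) (modelInv_mem n hn j ⟨ψ, hψ⟩ hψ)
  have h1 := modelHom_mem_filtH n hn h
  rwa [map_mul, modelHom_modelInv, modelHom_modelInv] at h1

lemma grToModel_grMul (n : ℕ) (hn : 1 ≤ n)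
    (hmul : ∀ i j, ∀ φ ∈ filtH n i, ∀ ψ ∈ filtH n j, φ * ψ ∈ filtH n (i + j))
    (y z : Gr (filtH n)) : grToModel n hn (grMul (filtH n) hmul y z) =
      grToModel n hn y * grToModel n hn z := by
  have key : (grMul (filtH n) hmul).compr₂ (grToModel n hn) =
      (LinearMap.mul ℂ (Model n)).compl₁₂ (grToModel n hn) (grToModel n hn) := by
    refine gr_ext _ fun i φ => gr_ext _ fun j ψ => ?_
    rw [LinearMap.compr₂_apply, LinearMap.compl₁₂_apply, LinearMap.mul_apply', grMul_cls,
      grToModel_cls, grToModel_cls, grToModel_cls,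
      ← weightPart_mul n (modelInv_mem n hn i φ φ.2) (modelInv_mem n hn j ψ ψ.2)]
    congr 1
    apply modelHom_injective n hn
    rw [map_mul, modelHom_modelInv, modelHom_modelInv, modelHom_modelInv]
  exact LinearMap.congr_fun (LinearMap.congr_fun key y) z

lemma grEquiv_mul (n : ℕ) (hn : 1 ≤ n)
    (hmul : ∀ i j, ∀ φ ∈ filtH n i, ∀ ψ ∈ filtH n j, φ * ψ ∈ filtH n (i + j)) (a b : Model n) :
    grEquiv n hn (a * b) = grMul (filtH n) hmul (grEquiv n hn a) (grEquiv n hn b) := by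
  rw [← LinearEquiv.eq_symm_apply, grEquiv_symm_apply, grToModel_grMul, ← grEquiv_symm_apply,
    ← grEquiv_symm_apply, LinearEquiv.symm_apply_apply, LinearEquiv.symm_apply_apply]

end

/-! ## The contractions and the filtration -/

/-- By the Leibniz rule ∂_N replaces one ξ_k, of weight k, by c_{N,k}, of weight at least k - N.
Thus it lowers weights by at most N. -/
lemma exists_partialPos_coeff (n N : ℕ) (x : Model n) (w : ℕ) :
    ∃ y ∈ modelFilt n ((N : ℤ) - w),
      modelHom n y = partialPos n N (modelHom n ((theta n x).coeff w)) := by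
  induction x using model_induction generalizing w with
  | hU p =>
    refine ⟨0, zero_mem _, ?_⟩
    rw [coeff_theta_inclU, modelHom_inclU, partialPos_scal, map_zero]
  | hadd x y hx hy =>
    obtain ⟨a, ha, ha'⟩ := hx w
    obtain ⟨b, hb, hb'⟩ := hy w
    exact ⟨a + b, add_mem ha hb, by rw [map_add, ha', hb', map_add, coeff_add, map_add, map_add]⟩
  | hmul k x hx =>
    rw [coeff_theta_genXi_mul]
    split_ifs with hk
    · obtain ⟨y, hy, hy'⟩ := hx (w - (k + 1))
      refine ⟨inclU n (powCoeff n (uVar n) N (k + 1)) * (theta n x).coeff (w - (k + 1)) +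
        (-1 : ℂ) • (genXi n k * y), add_mem ?_ (Submodule.smul_mem _ _ ?_), ?_⟩
      · have h : (theta n x).coeff (w - (k + 1)) ∈ modelFilt n (-((w - (k + 1) : ℕ) : ℤ)) := by
          rw [mem_modelFilt, theta_coeff]
          exact (isPure_monomial _ _).vanishesBelow
        refine modelFilt_mono n ?_ (mul_mem_modelFilt n
          (inclU_mem_modelFilt n (powCoeff_mem_uFilt n N (k + 1))) h)
        push_cast
        omega
      · refine modelFilt_mono n ?_ (mul_mem_modelFilt n
          (show genXi n k ∈ modelFilt n _ from (isPure_theta_genXi n k).vanishesBelow) hy)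
        omega
      · rw [map_mul (modelHom n), partialPos_mul, modelHom_genXi, hat_dualForm, partialPos_dualForm_eq,
          contractedXi_eq_evalU, map_add, map_mul (modelHom n), modelHom_inclU, map_smul,
          map_mul (modelHom n), modelHom_genXi, ← hy']
        exact congrArg _ ((neg_one_smul ℂ _).trans (form_neg_mul _ _).symm)
    · exact ⟨0, zero_mem _, by rw [map_zero, map_zero]⟩

lemma partialPos_mem_filtH (n : ℕ) (hn : 1 ≤ n) (N : ℕ) (i : ℤ) (φ : Forms n)
    (hφ : φ ∈ filtH n i) : partialPos n N φ ∈ filtH n (i + N) := by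
  have hx := modelInv_mem n hn i ⟨φ, hφ⟩ hφ
  have e := modelHom_modelInv n hn i ⟨φ, hφ⟩
  generalize modelInv n hn i ⟨φ, hφ⟩ = x at hx e
  change modelHom n x = φ at e
  rw [← e, ← sum_coeff_theta n x, map_sum, map_sum]
  refine sum_mem fun w hw => ?_
  obtain ⟨y, hy, hy'⟩ := exists_partialPos_coeff n N x w
  rw [← hy']
  refine filtH_mono n ?_ (modelHom_mem_filtH n hn hy)
  have : ¬ (w : ℤ) < -i := fun h => mem_support_iff.1 hw (hx w h)
  omega

lemma hat_of_mem (n p : ℕ) {φ : Forms n} (h : φ ∈ formsOfDegree n p) :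
    hat n φ = (-1 : ℂ) ^ p • φ := by
  obtain ⟨z, rfl⟩ := h
  induction z using TensorProduct.induction_on with
  | zero => rw [map_zero, map_zero, smul_zero]
  | add y z hy hz => rw [map_add, map_add, hy, hz, smul_add]
  | tmul a q =>
    rw [TensorProduct.map_tmul, hat_tmul, TensorProduct.smul_tmul']
    congr 1
    exact involute_of_mem_exteriorPower p a.2

lemma partialPos_mul_of_mem (n N p : ℕ) {φ : Forms n} (h : φ ∈ formsOfDegree n p) (ψ : Forms n) :
    partialPos n N (φ * ψ) = partialPos n N φ * ψ + (-1 : ℂ) ^ p • (φ * partialPos n N ψ) := by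
  rw [partialPos_mul, hat_of_mem n p h, smul_mul_assoc]

/-! ## The coefficients of the powers of the generating function -/

lemma coeff_genU_pow (n N m : ℕ) : (genU n ^ N).coeff m =
    ∑ j : Fin N → Fin (n - 1) with ∑ s, ((j s : ℕ) + 1) = m, ∏ s, MvPolynomial.X (j s) := by
  have h : ∀ (j : Fin N → Fin (n - 1)) (t : Finset (Fin N)),
      (∏ s ∈ t, monomial ((j s : ℕ) + 1) (MvPolynomial.X (R := ℂ) (j s))) =
      monomial (∑ s ∈ t, ((j s : ℕ) + 1)) (∏ s ∈ t, MvPolynomial.X (j s)) := by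
    intro j t
    induction t using Finset.induction_on with
    | empty => simp
    | insert s t hs ih =>
      rw [Finset.prod_insert hs, ih, monomial_mul_monomial, Finset.sum_insert hs,
        Finset.prod_insert hs]
  rw [genU, Fintype.sum_pow, finsetSum_coeff, Finset.sum_filter]
  exact Finset.sum_congr rfl fun j _ => by rw [h, coeff_monomial]

lemma grMap_genXi (n : ℕ) (hn : 1 ≤ n) (N : ℕ)
    (hd : ∀ i, ∀ φ ∈ filtH n i, partialPos n N φ ∈ filtH n (i + N)) (k : Fin (n - 1)) :
    grMap (filtH n) (partialPos n N) N hd (grEquiv n hn (genXi n k)) =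
      grEquiv n hn (inclU n ((genU n ^ N).coeff (k + 1))) := by
  have h1 := isPure_theta_genXi n k
  have h2 := isPure_theta_inclU n (isPure_weightU_coeff_pow n N (k + 1))
  have m2 := modelHom_mem_filtH n hn h2.vanishesBelow
  rw [grEquiv_of_isPure n hn h1 (modelHom_mem_filtH n hn h1.vanishesBelow), grMap_cls,
    grEquiv_of_isPure n hn h2 m2]
  have e : ((N : ℤ) - ((k : ℕ) + 1 : ℕ)) = -((k : ℤ) + 1) + N := by push_cast; ring
  have m2' : modelHom n (inclU n ((genU n ^ N).coeff (k + 1))) ∈ filtH n (-((k : ℤ) + 1) + N) := by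
    rwa [← e]
  rw [cls_congr (filtH n) e rfl m2 m2', ← sub_eq_zero, ← map_sub]
  apply cls_eq_zero
  -- The value ∂_N ξ differs from the coefficient of u^N by an element one step lower in the
  -- filtration, so their classes coincide.
  have h3 := modelHom_mem_filtH n hn (inclU_mem_modelFilt n (powCoeff_sub_mem_uFilt n N (k + 1)))
  rw [e, map_sub, map_sub, modelHom_inclU, ← contractedXi_eq_evalU, ← partialPos_dualForm_eq,
    ← modelHom_genXi] at h3
  exact h3

lemma X_pow_dvd_sub {A : Type*} [Ring A] (n N : ℕ) (hN : 1 ≤ N) (a b : Fin (n - 1) → A)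
    (h : ∀ k : Fin (n - 1), a k =
      ((∑ k : Fin (n - 1), C (b k) * X ^ ((k : ℕ) + 1)) ^ N).coeff (k + 1)) :
    (X ^ n : A[X]) ∣ (∑ k : Fin (n - 1), C (a k) * X ^ ((k : ℕ) + 1)) -
      (∑ k : Fin (n - 1), C (b k) * X ^ ((k : ℕ) + 1)) ^ N := by
  rw [X_pow_dvd_iff]
  intro m hm
  rw [coeff_sub, sub_eq_zero, finsetSum_coeff]
  simp only [coeff_C_mul_X_pow]
  cases m with
  | zero =>
    -- The constant coefficient is where N ≥ 1 is needed: u has no constant term, whereas its zeroth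
    -- power is 1.
    obtain ⟨M, rfl⟩ : ∃ M, N = M + 1 := ⟨N - 1, by omega⟩
    rw [pow_succ, mul_coeff_zero, finsetSum_coeff]
    simp
  | succ k =>
    rw [← h ⟨k, by omega⟩, Finset.sum_eq_single ⟨k, by omega⟩]
    · rw [if_pos rfl]
    · intro j _ hj
      rw [if_neg]
      intro e
      exact hj (Fin.ext (Nat.succ.inj e).symm)
    · simp

lemma map_genU (n : ℕ) : mapAlgHom (inclU n) (genU n) =
    ∑ k : Fin (n - 1), C (inclU n (MvPolynomial.X k)) * X ^ ((k : ℕ) + 1) := by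
  rw [genU, map_sum]
  refine Finset.sum_congr rfl fun k _ => ?_
  rw [coe_mapAlgHom, map_monomial, C_mul_X_pow_eq_monomial]
  rfl

end StableTorus

/-! ### The proposition -/

theorem proposition1p5 (n : ℕ) (hn : 1 ≤ n) :
    ∃ (hmul : ∀ i j, ∀ φ ∈ StableTorus.filtH n i, ∀ ψ ∈ StableTorus.filtH n j,
          φ * ψ ∈ StableTorus.filtH n (i + j))
      (hxi : ∀ k : Fin (n - 1),
          StableTorus.xi n (k + 1) ∈ StableTorus.filtH n (-((k : ℤ) + 1)))
      (hu : ∀ k : Fin (n - 1),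
          (1 : ExteriorAlgebra ℂ (StableTorus.cartan n)) ⊗ₜ[ℂ] StableTorus.u n (k + 1) ∈
            StableTorus.filtH n (1 - ((k : ℤ) + 1)))
      (ρ₀ : StableTorus.Model n ≃ₐ[ℂ] StableTorus.stableH n)
      (ρ : StableTorus.Model n ≃ₗ[ℂ] StableTorus.Gr (StableTorus.filtH n)),
      -- `ρ₀` identifies `Λ*(ξ) ⊗ ℂ[u]` with `H_{∞/n}`
      (∀ k : Fin (n - 1),
        (ρ₀ (StableTorus.genXi n k) : StableTorus.Forms n) = StableTorus.xi n (k + 1)) ∧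
      (∀ k : Fin (n - 1),
        (ρ₀ (StableTorus.inclU n (MvPolynomial.X k)) : StableTorus.Forms n) =
          1 ⊗ₜ[ℂ] StableTorus.u n (k + 1)) ∧
      -- `ρ` identifies `Λ*(ξ) ⊗ ℂ[u]`, as a ring, with the associated graded of `H_{∞/n}`
      (∀ a b, ρ (a * b) = StableTorus.grMul (StableTorus.filtH n) hmul (ρ a) (ρ b)) ∧
      (∀ k : Fin (n - 1), ρ (StableTorus.genXi n k) =
        StableTorus.cls (StableTorus.filtH n) (-((k : ℤ) + 1)) ⟨_, hxi k⟩) ∧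
      (∀ k : Fin (n - 1), ρ (StableTorus.inclU n (MvPolynomial.X k)) =
        StableTorus.cls (StableTorus.filtH n) (1 - ((k : ℤ) + 1)) ⟨_, hu k⟩) ∧
      ∀ N : ℕ, 1 ≤ N →
        -- `∂_N` preserves `H_{∞/n}` and raises the filtration by `N`
        ∃ hd : ∀ i, ∀ φ ∈ StableTorus.filtH n i,
            StableTorus.partialPos n N φ ∈ StableTorus.filtH n (i + N),
          -- `d` is the differential `d_N` on the associated graded
          let d := StableTorus.grMap (StableTorus.filtH n) (StableTorus.partialPos n N) N hd
          -- graded Leibniz rule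
          (∀ (p : ℕ) (i : ℤ) (φ : StableTorus.filtH n i),
            (φ : StableTorus.Forms n) ∈ StableTorus.formsOfDegree n p →
            ∀ y : StableTorus.Gr (StableTorus.filtH n),
              d (StableTorus.grMul (StableTorus.filtH n) hmul
                  (StableTorus.cls (StableTorus.filtH n) i φ) y) =
                StableTorus.grMul (StableTorus.filtH n) hmul
                  (d (StableTorus.cls (StableTorus.filtH n) i φ)) y +
                (-1 : ℂ) ^ p • StableTorus.grMul (StableTorus.filtH n) hmul
                  (StableTorus.cls (StableTorus.filtH n) i φ) (d y)) ∧
          -- `d_N u_k = 0`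
          (∀ k : Fin (n - 1), d (ρ (StableTorus.inclU n (MvPolynomial.X k))) = 0) ∧
          -- `d_N ξ_{k+1}` is the sum of `u_{j₁+1} ⋯ u_{j_N+1}` over `(j₁+1) + ⋯ + (j_N+1) = k+1`
          (∀ k : Fin (n - 1), d (ρ (StableTorus.genXi n k)) =
            ρ (StableTorus.inclU n
              (∑ j : Fin N → Fin (n - 1) with ∑ s, ((j s : ℕ) + 1) = (k : ℕ) + 1,
                ∏ s, MvPolynomial.X (j s)))) ∧
          -- `d_N ξ = u ^ N` modulo `t ^ n`
          (Polynomial.X ^ n : Polynomial (StableTorus.Model n)) ∣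
            (∑ k : Fin (n - 1),
                Polynomial.C (ρ.symm (d (ρ (StableTorus.genXi n k)))) *
                  Polynomial.X ^ ((k : ℕ) + 1)) -
              (∑ k : Fin (n - 1),
                Polynomial.C (StableTorus.inclU n (MvPolynomial.X k)) *
                  Polynomial.X ^ ((k : ℕ) + 1)) ^ N := by
  have hxi : ∀ k : Fin (n - 1), StableTorus.xi n (k + 1) ∈ StableTorus.filtH n (-((k : ℤ) + 1)) := by
    intro k
    rw [StableTorus.xi_eq_dualForm, ← StableTorus.modelHom_genXi]
    exact StableTorus.modelHom_mem_filtH n hn (StableTorus.isPure_theta_genXi n k).vanishesBelow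
  -- The index k stands for u_{k+1}, whose weight is k; hence filtration degree 1 - (k + 1).
  have hu' : ∀ k : Fin (n - 1),
      StableTorus.IsPure (1 - ((k : ℤ) + 1)) (StableTorus.theta n
        (StableTorus.inclU n (MvPolynomial.X k))) := by
    intro k
    have e : (1 : ℤ) - ((k : ℤ) + 1) = -k := by ring
    rw [e]
    exact StableTorus.isPure_theta_inclU n (StableTorus.isPure_weightU_X n k)
  have eu : ∀ k : Fin (n - 1),
      StableTorus.modelHom n (StableTorus.inclU n (MvPolynomial.X k)) =
        (1 : ExteriorAlgebra ℂ (StableTorus.cartan n)) ⊗ₜ[ℂ] StableTorus.u n (k + 1) := by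
    intro k
    rw [StableTorus.modelHom_inclU, StableTorus.evalU_X, StableTorus.scal_apply]
  have hu : ∀ k : Fin (n - 1),
      (1 : ExteriorAlgebra ℂ (StableTorus.cartan n)) ⊗ₜ[ℂ] StableTorus.u n (k + 1) ∈
        StableTorus.filtH n (1 - ((k : ℤ) + 1)) := by
    intro k
    rw [← eu]
    exact StableTorus.modelHom_mem_filtH n hn (hu' k).vanishesBelow
  have ρu : ∀ k : Fin (n - 1),
      StableTorus.grEquiv n hn (StableTorus.inclU n (MvPolynomial.X k)) =
        StableTorus.cls (StableTorus.filtH n) (1 - ((k : ℤ) + 1)) ⟨_, hu k⟩ := by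
    intro k
    rw [StableTorus.grEquiv_of_isPure n hn (hu' k)
      (StableTorus.modelHom_mem_filtH n hn (hu' k).vanishesBelow)]
    exact StableTorus.cls_congr _ rfl (eu k) _ _
  refine ⟨StableTorus.mul_mem_filtH n hn, hxi, hu, StableTorus.modelEquiv n hn,
    StableTorus.grEquiv n hn, fun k => ?_, fun k => ?_, StableTorus.grEquiv_mul n hn _, fun k => ?_,
    ρu, fun N hN => ⟨StableTorus.partialPos_mem_filtH n hn N,
      fun p i φ hφ => StableTorus.grMap_grMul _ _ _ _ _ i φ _
        (StableTorus.partialPos_mul_of_mem n N p hφ), fun k => ?_, fun k => ?_, ?_⟩⟩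
  · rw [StableTorus.modelEquiv_coe, StableTorus.modelHom_genXi, StableTorus.xi_eq_dualForm]
  · rw [StableTorus.modelEquiv_coe, eu]
  · have h := StableTorus.isPure_theta_genXi n k
    rw [StableTorus.grEquiv_of_isPure n hn h
      (StableTorus.modelHom_mem_filtH n hn h.vanishesBelow)]
    exact StableTorus.cls_congr _ rfl
      ((StableTorus.modelHom_genXi n k).trans (StableTorus.xi_eq_dualForm n k).symm) _ _
  · rw [ρu, StableTorus.grMap_cls]
    apply StableTorus.cls_eq_zero
    have h := StableTorus.partialPos_scal n N (StableTorus.u n ((k : ℕ) + 1))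
    rw [StableTorus.scal_apply] at h
    change StableTorus.partialPos n N (1 ⊗ₜ[ℂ] StableTorus.u n (k + 1)) ∈ _
    rw [h]
    exact zero_mem _
  · rw [StableTorus.grMap_genXi, StableTorus.coeff_genU_pow]
  · refine StableTorus.X_pow_dvd_sub n N hN _ _ fun k => ?_
    rw [StableTorus.grMap_genXi, LinearEquiv.symm_apply_apply, ← StableTorus.map_genU, ← map_pow,
      Polynomial.coe_mapAlgHom, Polynomial.coeff_map]
    rfl
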